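/- Let $G=(V,E)$ be a finite simple directed graph (no loops, no parallel edges) with $n$ vertices, $m$ edges and edge weights $w:E\to\mathbb{R}$, and let $s,t\in V$. Let $P=v_0v_1\cdots v_\ell$ be a shortest path from $s=v_0$ to $t=v_\ell$, i.e. a path whose length is at most the length of every walk from $s$ to $t$ (negative weights are allowed). For an edge $e$ let $r_G(e)$ denote the length of a shortest $s$–$t$ path in $G$ that avoids $e$, with $r_G(e)=\infty$ if there is none. An elimination forest of $G$ is a rooted forest on the vertex set $V$ such that for every edge $uv\in E$ one of $u$ and $v$ is an ancestor of the other; its depth is the maximum number of vertices on a path from a root to a leaf. There is an algorithm that, given $G$ (as a list of its edges in arbitrary order), $w$, $P$, and an elimination forest of $G$ of depth $k$ (as a list of parents), computes $r_G(v_iv_{i+1})$ for all $i\in\{0,\ldots,\ell-1\}$ in $O(k(m+n\log n)+1)$ time. The model of computation is a random access machine with words of $O(\log(n+m+2))$ bits on which real numbers can be stored, moved, added, subtracted and compared in unit time; the program and the constants are the same for all inputs. -/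

import Mathlib

/-! ## Weighted directed graphs, shortest paths, replacement distances -/

namespace Digraph

variable {V : Type*}

/-- `p` lists the vertices of a walk of `G` from `s` to `t` in order. -/
def IsWalkFromTo (G : Digraph V) (s t : V) (p : List V) : Prop :=
  p.head? = some s ∧ p.getLast? = some t ∧ p.IsChain G.Adj

/-- A path is a walk without repeated vertices. -/
def IsPathFromTo (G : Digraph V) (s t : V) (p : List V) : Prop :=
  G.IsWalkFromTo s t p ∧ p.Nodup

end Digraph

/-- The edges traversed by the walk with vertex list `p`, in order. -/
def walkEdges {V : Type*} (p : List V) : List (V × V) :=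
  p.zip p.tail

/-- The length of the walk with vertex list `p` with respect to the edge weights `w`. -/
def walkLength {V : Type*} (w : V → V → ℝ) (p : List V) : ℝ :=
  ((walkEdges p).map fun e => w e.1 e.2).sum

namespace Digraph

variable {V : Type*}

/-- `p` is a shortest path from `s` to `t`: it is a path, and no walk from `s` to `t` is shorter.
Negative weights are allowed; walks rather than paths are compared, so that no negative cycle lies
on a walk from `s` to `t`. -/
def IsShortestPath (G : Digraph V) (w : V → V → ℝ) (s t : V) (p : List V) : Prop :=
  G.IsPathFromTo s t p ∧ ∀ q, G.IsWalkFromTo s t q → walkLength w p ≤ walkLength w q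

/-- The replacement distance: the length of a shortest path from `s` to `t` avoiding the edge `e`
(`⊤` if there is no such path). -/
noncomputable def replacementDist (G : Digraph V) (w : V → V → ℝ) (s t : V) (e : V × V) : EReal :=
  ⨅ p ∈ {p : List V | G.IsPathFromTo s t p ∧ e ∉ walkEdges p}, (walkLength w p : EReal)

end Digraph

/-! ## Elimination forests

A rooted forest on `V` is given by its parent function; `none` is the parent of the roots. -/

/-- `u` is an ancestor of `v` (every vertex is an ancestor of itself). -/
def IsAncestor {V : Type*} (parent : V → Option V) (u v : V) : Prop :=
  Relation.ReflTransGen (fun x y => parent x = some y) v u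

/-- On a finite vertex set, a parent function describes a rooted forest iff no vertex is reached
from itself by going to the parent one or more times. -/
def IsRootedForest {V : Type*} (parent : V → Option V) : Prop :=
  ∀ v, ¬ Relation.TransGen (fun x y => parent x = some y) v v

/-- Every edge joins two vertices one of which is an ancestor of the other. -/
def Digraph.IsEliminationForest {V : Type*} (G : Digraph V) (parent : V → Option V) : Prop :=
  IsRootedForest parent ∧ ∀ u v, G.Adj u v → IsAncestor parent u v ∨ IsAncestor parent v u

/-- The maximum number of vertices on a path from a root down to a vertex. -/
noncomputable def forestDepth {V : Type*} [Fintype V] (parent : V → Option V) : ℕ :=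
  Finset.univ.sup fun v => {u | IsAncestor parent u v}.ncard

/-! ## A random access machine with real numbers

A program works on finitely many registers and finitely many arrays with random access, each of
which holds either words (natural numbers below a bound `W`) or real numbers. Words can be added,
subtracted, multiplied, divided and compared, and serve as array indices. Real numbers can only be
moved, added, subtracted and compared. Every operation takes one unit of time. A computation that
produces a number `≥ W` has no result. -/

namespace RealRAM

/-- Contents of the registers and of the arrays: `nmem a i` and `rmem a i` are the entries with
index `i` of the array of words, and of the array of reals, that has the name `a`. -/
structure State where
  nreg : ℕ → ℕ
  rreg : ℕ → ℝ
  nmem : ℕ → ℕ → ℕ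
  rmem : ℕ → ℕ → ℝ

/-- Expressions for words. -/
inductive NExpr where
  | lit (v : ℕ)
  | reg (x : ℕ)
  | get (a : ℕ) (i : NExpr)
  | add (e f : NExpr)
  | sub (e f : NExpr)
  | mul (e f : NExpr)
  | div (e f : NExpr)

namespace NExpr

/-- The value of an expression; subtraction is truncated at `0`, division is rounded down. -/
def val (σ : State) : NExpr → ℕ
  | lit v => v
  | reg x => σ.nreg x
  | get a i => σ.nmem a (i.val σ)
  | add e f => e.val σ + f.val σ
  | sub e f => e.val σ - f.val σ
  | mul e f => e.val σ * f.val σ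
  | div e f => e.val σ / f.val σ

/-- The values of the expression and of all its subexpressions are words. -/
def Fits (W : ℕ) (σ : State) : NExpr → Prop
  | lit v => v < W
  | reg x => σ.nreg x < W
  | get a i => i.Fits W σ ∧ σ.nmem a (i.val σ) < W
  | add e f => e.Fits W σ ∧ f.Fits W σ ∧ e.val σ + f.val σ < W
  | sub e f => e.Fits W σ ∧ f.Fits W σ
  | mul e f => e.Fits W σ ∧ f.Fits W σ ∧ e.val σ * f.val σ < W
  | div e f => e.Fits W σ ∧ f.Fits W σ

/-- The number of operations in the evaluation of an expression. -/
def cost : NExpr → ℕ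
  | lit _ => 1
  | reg _ => 1
  | get _ i => i.cost + 1
  | add e f => e.cost + f.cost + 1
  | sub e f => e.cost + f.cost + 1
  | mul e f => e.cost + f.cost + 1
  | div e f => e.cost + f.cost + 1

end NExpr

/-- Expressions for real numbers. -/
inductive RExpr where
  | zero
  | reg (x : ℕ)
  | get (a : ℕ) (i : NExpr)
  | add (e f : RExpr)
  | sub (e f : RExpr)

namespace RExpr

noncomputable def val (σ : State) : RExpr → ℝ
  | zero => 0
  | reg x => σ.rreg x
  | get a i => σ.rmem a (i.val σ)
  | add e f => e.val σ + f.val σ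
  | sub e f => e.val σ - f.val σ

/-- All array indices in the expression are words. -/
def Fits (W : ℕ) (σ : State) : RExpr → Prop
  | zero => True
  | reg _ => True
  | get _ i => i.Fits W σ
  | add e f => e.Fits W σ ∧ f.Fits W σ
  | sub e f => e.Fits W σ ∧ f.Fits W σ

def cost : RExpr → ℕ
  | zero => 1
  | reg _ => 1
  | get _ i => i.cost + 1
  | add e f => e.cost + f.cost + 1
  | sub e f => e.cost + f.cost + 1

end RExpr

/-- Tests: comparisons of words, comparisons of reals, and their Boolean combinations. -/
inductive Test where
  | nlt (e f : NExpr)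
  | neq (e f : NExpr)
  | rlt (e f : RExpr)
  | neg (b : Test)
  | and (b c : Test)

namespace Test

/-- The test is passed. Here `nlt` and `rlt` mean "less than", and `neq` means equality of words. -/
def Holds (σ : State) : Test → Prop
  | nlt e f => e.val σ < f.val σ
  | neq e f => e.val σ = f.val σ
  | rlt e f => e.val σ < f.val σ
  | neg b => ¬ b.Holds σ
  | and b c => b.Holds σ ∧ c.Holds σ

def Fits (W : ℕ) (σ : State) : Test → Prop
  | nlt e f => e.Fits W σ ∧ f.Fits W σ
  | neq e f => e.Fits W σ ∧ f.Fits W σ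
  | rlt e f => e.Fits W σ ∧ f.Fits W σ
  | neg b => b.Fits W σ
  | and b c => b.Fits W σ ∧ c.Fits W σ

def cost : Test → ℕ
  | nlt e f => e.cost + f.cost + 1
  | neq e f => e.cost + f.cost + 1
  | rlt e f => e.cost + f.cost + 1
  | neg b => b.cost + 1
  | and b c => b.cost + c.cost + 1

end Test

/-- Programs: assignments to registers (`nset`, `rset`) and to array entries (`nput`, `rput`),
composition, branching, and loops that are repeated as long as the test is passed. -/
inductive Program where
  | skip
  | nset (x : ℕ) (e : NExpr)
  | rset (x : ℕ) (e : RExpr)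
  | nput (a : ℕ) (i e : NExpr)
  | rput (a : ℕ) (i : NExpr) (e : RExpr)
  | seq (p q : Program)
  | branch (b : Test) (p q : Program)
  | loop (b : Test) (p : Program)

/-- `Exec W p σ T τ`: with words below `W`, the program `p` started in the state `σ` halts after
exactly `T` operations in the state `τ`. -/
inductive Exec (W : ℕ) : Program → State → ℕ → State → Prop
  | skip (σ : State) : Exec W .skip σ 1 σ
  | nset (σ : State) (x : ℕ) (e : NExpr) : e.Fits W σ →
      Exec W (.nset x e) σ (e.cost + 1)
        { σ with nreg := Function.update σ.nreg x (e.val σ) }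
  | rset (σ : State) (x : ℕ) (e : RExpr) : e.Fits W σ →
      Exec W (.rset x e) σ (e.cost + 1)
        { σ with rreg := Function.update σ.rreg x (e.val σ) }
  | nput (σ : State) (a : ℕ) (i e : NExpr) : i.Fits W σ → e.Fits W σ →
      Exec W (.nput a i e) σ (i.cost + e.cost + 1)
        { σ with nmem := Function.update σ.nmem a
                  (Function.update (σ.nmem a) (i.val σ) (e.val σ)) }
  | rput (σ : State) (a : ℕ) (i : NExpr) (e : RExpr) : i.Fits W σ → e.Fits W σ →
      Exec W (.rput a i e) σ (i.cost + e.cost + 1)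
        { σ with rmem := Function.update σ.rmem a
                  (Function.update (σ.rmem a) (i.val σ) (e.val σ)) }
  | seq {p q : Program} {σ σ₁ σ₂ : State} {T₁ T₂ : ℕ} :
      Exec W p σ T₁ σ₁ → Exec W q σ₁ T₂ σ₂ → Exec W (.seq p q) σ (T₁ + T₂) σ₂
  | branch_true {b : Test} {p q : Program} {σ τ : State} {T : ℕ} : b.Fits W σ → b.Holds σ →
      Exec W p σ T τ → Exec W (.branch b p q) σ (b.cost + 1 + T) τ
  | branch_false {b : Test} {p q : Program} {σ τ : State} {T : ℕ} : b.Fits W σ → ¬ b.Holds σ →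
      Exec W q σ T τ → Exec W (.branch b p q) σ (b.cost + 1 + T) τ
  | loop_done {b : Test} {p : Program} {σ : State} : b.Fits W σ → ¬ b.Holds σ →
      Exec W (.loop b p) σ (b.cost + 1) σ
  | loop_next {b : Test} {p : Program} {σ σ₁ σ₂ : State} {T₁ T₂ : ℕ} : b.Fits W σ → b.Holds σ →
      Exec W p σ T₁ σ₁ → Exec W (.loop b p) σ₁ T₂ σ₂ →
      Exec W (.loop b p) σ (b.cost + 1 + T₁ + T₂) σ₂

end RealRAM

/-! ## Input and output of the replacement paths problem -/

/-- The initial state for a graph with vertices `0, …, n - 1` and with `m` edges, which are listed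
by `edge` in some order, edge weights `w`, a path `P`, and a rooted forest `parent`.
The registers `0`, `1`, `2` hold `n`, `m` and the number of vertices of `P`; the arrays of words
`0`, `1`, `2`, `3` hold the tails of the edges, the heads of the edges, the vertices of `P` in order,
and the parents of the vertices (`n` for the roots); the array of reals `0` holds the weights of the
edges. All the rest is `0`. -/
noncomputable def replacementInput {n m : ℕ} (edge : Fin m → Fin n × Fin n)
    (w : Fin n → Fin n → ℝ) (P : List (Fin n)) (parent : Fin n → Option (Fin n)) :
    RealRAM.State where
  nreg x := match x with
    | 0 => n
    | 1 => m
    | 2 => P.length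
    | _ => 0
  rreg _ := 0
  nmem a i := match a with
    | 0 => if h : i < m then (edge ⟨i, h⟩).1 else 0
    | 1 => if h : i < m then (edge ⟨i, h⟩).2 else 0
    | 2 => if h : i < P.length then P[i] else 0
    | 3 => if h : i < n then (match parent ⟨i, h⟩ with
        | some v => v
        | none => n) else 0
    | _ => 0
  rmem a i := match a with
    | 0 => if h : i < m then w (edge ⟨i, h⟩).1 (edge ⟨i, h⟩).2 else 0
    | _ => 0

/-- Entry `i` of the output: entry `i` of the array of reals `1`, or `⊤` if entry `i` of the array
of words `4` is `0`. -/
noncomputable def replacementOutput (τ : RealRAM.State) (i : ℕ) : EReal :=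
  if τ.nmem 4 i = 0 then ⊤ else (τ.rmem 1 i : EReal)

/-! Fix an edge `P i → P (i + 1)` of the shortest path. A walk from s to t that avoids it can be
replaced by one that is no longer and has a simple shape: it follows the path up to some `P a` with
a ≤ i, makes a detour without edges of the path, and follows the path again from some `P b` with b >
i. Indeed, whenever the walk uses an edge of the path before the missing one, everything so far can
be exchanged for the initial part of the path (`ShortestPath.exists_detour`). Only vertices on some
s–t walk matter, and closed walks through these are nonnegative. So, once the edges are restricted
to such vertices, no negative cycle is left.

Let u be a vertex of minimum depth d on a detour. Consecutive vertices are comparable in the forest,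
so the whole detour stays in the tree below u (`Elimination.top_eq_of_walk`). Hence the replacement
distance is the minimum, over all d and all u of depth d, of a sum of two terms: the least length of
an initial part up to some `P a`, a ≤ i, plus the distance from `P a` to u; and the least distance
from u to some `P b`, b > i, plus the rest of the path. Distances are taken below u. This is
`ReplacementInstance.minOf_output`.

For fixed d the trees below the vertices of depth d are disjoint and no edge joins two of them. One
Dijkstra search with all these vertices as sources thus yields all distances from them, and one
search in the reversed graph all distances to them. Negative weights are handled by potentials.
Levels are treated from the deepest upwards, the potentials are feasible strictly below the current
level, and the forward search extends them to the current level (`Elimination.feasibleAbove_step`).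

When i advances by one, only the two minima of the tree that contains `P i` change. Those for
returning to the path are found in advance by a sweep from its end, and a tournament tree over u
maintains the minimum of the sums at logarithmic cost for each i (`RealRAM.wp_forwardSweep`).

A search takes O(m + n log m) time (`RealRAM.wp_dijkstra`), with a hollow heap as priority queue.
Lowering a key creates a new node and leaves a hollow one behind, so each edge, relaxed at most
once, can serve as its own node. The amortized analysis uses the potential `Ghost.pot`; ranks are
logarithmic because nodes of rank r are at least twice as many as those of rank r + 2
(`HollowHeap.Inv.rank_le`). With k levels and m ≤ n² the claimed bound follows.

The programs are verified with a predicate transformer `wp` that also carries the time. It demands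
only that stored sums stay below a bound B; `RealRAM.exec_of_wp` turns this into executions with
words below any W ≥ 40 B. -/

/-! ## Weakest preconditions for the random access machine -/

namespace RealRAM

namespace NExpr

/-- A static condition: no multiplications, and only small literals. -/
def ok : NExpr → Bool
  | lit v => v < 12
  | reg _ => true
  | get _ i => i.ok
  | add e f => e.ok && f.ok
  | sub e f => e.ok && f.ok
  | mul _ _ => false
  | div e f => e.ok && f.ok

/-- What has to be known about the state so that the value of the expression can be stored. -/
def Need (B : ℕ) (σ : State) : NExpr → Prop
  | add e f => e.val σ + f.val σ < B
  | sub e _ => e.Need B σ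
  | div e _ => e.Need B σ
  | _ => True

end NExpr

/-- All words in registers and arrays are below `B`. -/
def Bounded (B : ℕ) (σ : State) : Prop :=
  (∀ x, σ.nreg x < B) ∧ ∀ a i, σ.nmem a i < B

namespace NExpr

theorem cost_pos (e : NExpr) : 1 ≤ e.cost := by cases e <;> simp [cost]

/-- Without products, each leaf and each operation contributes at most one multiple of `B`.
Intermediate values are therefore words for purely static reasons, and only values that are stored
need a proof. -/
theorem val_le {B : ℕ} {σ : State} (hB : 12 ≤ B) (hσ : Bounded B σ) :
    ∀ e : NExpr, e.ok = true → e.val σ ≤ e.cost * B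
  | lit v, h => by simp [ok] at h; simp [val, cost]; omega
  | reg x, _ => by simpa [val, cost] using (hσ.1 x).le
  | get a i, _ => by
      have := (hσ.2 a (i.val σ)).le
      simp only [val, cost]; nlinarith [i.cost_pos]
  | add e f, h => by
      simp [ok] at h
      have h1 := val_le hB hσ e h.1
      have h2 := val_le hB hσ f h.2
      simp only [val, cost]; nlinarith
  | sub e f, h => by
      simp [ok] at h
      have h1 := val_le hB hσ e h.1
      simp only [val, cost]; have := Nat.sub_le (e.val σ) (f.val σ); nlinarith
  | mul e f, h => by simp [ok] at h
  | div e f, h => by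
      simp [ok] at h
      have h1 := val_le hB hσ e h.1
      simp only [val, cost]; have := Nat.div_le_self (e.val σ) (f.val σ); nlinarith

theorem fits {B W : ℕ} {σ : State} (hB : 12 ≤ B) (hσ : Bounded B σ) :
    ∀ e : NExpr, e.ok = true → e.cost * B < W → e.Fits W σ
  | lit v, h, hW => by simp [ok] at h; simp [Fits, cost] at *; omega
  | reg x, _, hW => by have := hσ.1 x; simp [Fits, cost] at *; omega
  | get a i, h, hW => by
      have := hσ.2 a (i.val σ)
      simp only [ok, Fits, cost] at *
      have h1 := i.cost_pos
      exact ⟨fits hB hσ i h (by nlinarith), by nlinarith⟩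
  | add e f, h, hW => by
      have hv := val_le hB hσ _ h
      simp [ok] at h
      simp only [Fits, cost, val] at *
      exact ⟨fits hB hσ e h.1 (by nlinarith), fits hB hσ f h.2 (by nlinarith), by omega⟩
  | sub e f, h, hW => by
      simp [ok] at h
      simp only [Fits, cost] at *
      exact ⟨fits hB hσ e h.1 (by nlinarith), fits hB hσ f h.2 (by nlinarith)⟩
  | mul e f, h, hW => by simp [ok] at h
  | div e f, h, hW => by
      simp [ok] at h
      simp only [Fits, cost] at *
      exact ⟨fits hB hσ e h.1 (by nlinarith), fits hB hσ f h.2 (by nlinarith)⟩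

theorem val_lt_of_need {B : ℕ} {σ : State} (hB : 12 ≤ B) (hσ : Bounded B σ) :
    ∀ e : NExpr, e.ok = true → e.Need B σ → e.val σ < B
  | lit v, h, _ => by simp [ok] at h; simp [val]; omega
  | reg x, _, _ => hσ.1 x
  | get a i, _, _ => hσ.2 a _
  | add e f, _, hn => hn
  | sub e f, h, hn => by
      simp [ok] at h
      exact (Nat.sub_le _ _).trans_lt (val_lt_of_need hB hσ e h.1 hn)
  | mul e f, h, _ => by simp [ok] at h
  | div e f, h, hn => by
      simp [ok] at h
      exact (Nat.div_le_self _ _).trans_lt (val_lt_of_need hB hσ e h.1 hn)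

end NExpr

namespace RExpr

def ok : RExpr → Bool
  | zero => true
  | reg _ => true
  | get _ i => i.ok
  | add e f => e.ok && f.ok
  | sub e f => e.ok && f.ok

theorem fits {B W : ℕ} {σ : State} (hB : 12 ≤ B) (hσ : Bounded B σ) :
    ∀ e : RExpr, e.ok = true → e.cost * B < W → e.Fits W σ
  | zero, _, _ => trivial
  | reg x, _, _ => trivial
  | get a i, h, hW => by
      simp only [ok, Fits, cost] at *
      exact i.fits hB hσ h (by nlinarith)
  | add e f, h, hW => by
      simp [ok] at h
      simp only [Fits, cost] at *
      exact ⟨fits hB hσ e h.1 (by nlinarith), fits hB hσ f h.2 (by nlinarith)⟩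
  | sub e f, h, hW => by
      simp [ok] at h
      simp only [Fits, cost] at *
      exact ⟨fits hB hσ e h.1 (by nlinarith), fits hB hσ f h.2 (by nlinarith)⟩

end RExpr

namespace Test

def ok : Test → Bool
  | nlt e f => e.ok && f.ok
  | neq e f => e.ok && f.ok
  | rlt e f => e.ok && f.ok
  | neg b => b.ok
  | and b c => b.ok && c.ok

theorem fits {B W : ℕ} {σ : State} (hB : 12 ≤ B) (hσ : Bounded B σ) :
    ∀ b : Test, b.ok = true → b.cost * B < W → b.Fits W σ
  | nlt e f, h, hW => by
      simp [ok] at h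
      simp only [Fits, cost] at *
      exact ⟨e.fits hB hσ h.1 (by nlinarith), f.fits hB hσ h.2 (by nlinarith)⟩
  | neq e f, h, hW => by
      simp [ok] at h
      simp only [Fits, cost] at *
      exact ⟨e.fits hB hσ h.1 (by nlinarith), f.fits hB hσ h.2 (by nlinarith)⟩
  | rlt e f, h, hW => by
      simp [ok] at h
      simp only [Fits, cost] at *
      exact ⟨e.fits hB hσ h.1 (by nlinarith), f.fits hB hσ h.2 (by nlinarith)⟩
  | neg b, h, hW => by
      simp only [ok, Fits, cost] at *
      exact b.fits hB hσ h (by nlinarith)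
  | and b c, h, hW => by
      simp [ok] at h
      simp only [Fits, cost] at *
      exact ⟨b.fits hB hσ h.1 (by nlinarith), c.fits hB hσ h.2 (by nlinarith)⟩

end Test

namespace Program

/-- All expressions satisfy the static condition and have cost below `40`. -/
def ok : Program → Bool
  | skip => true
  | nset _ e => e.ok && e.cost < 40
  | rset _ e => e.ok && e.cost < 40
  | nput _ i e => i.ok && e.ok && i.cost < 40 && e.cost < 40
  | rput _ i e => i.ok && e.ok && i.cost < 40 && e.cost < 40
  | seq p q => p.ok && q.ok
  | branch b p q => b.ok && b.cost < 40 && p.ok && q.ok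
  | loop b p => b.ok && b.cost < 40 && p.ok

end Program

/-- At most `k` rounds of a loop with test `b` whose body has the predicate transformer `f`. -/
def loopIter (b : Test) (f : (State → ℕ → Prop) → State → ℕ → Prop) :
    ℕ → (State → ℕ → Prop) → State → ℕ → Prop
  | 0, _, _, _ => False
  | k + 1, Q, σ, t =>
      (b.Holds σ → f (loopIter b f k Q) σ (t + (b.cost + 1))) ∧
      (¬ b.Holds σ → Q σ (t + (b.cost + 1)))

/-- `wp B p Q σ t`: started at time `t` in the state `σ`, the program `p` halts in a state and at
a time that satisfy `Q`, and all sums that it stores are below `B`. -/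
def wp (B : ℕ) : Program → (State → ℕ → Prop) → State → ℕ → Prop
  | .skip, Q, σ, t => Q σ (t + 1)
  | .nset x e, Q, σ, t => e.Need B σ ∧
      Q ⟨Function.update σ.nreg x (e.val σ), σ.rreg, σ.nmem, σ.rmem⟩ (t + (e.cost + 1))
  | .rset x e, Q, σ, t =>
      Q ⟨σ.nreg, Function.update σ.rreg x (e.val σ), σ.nmem, σ.rmem⟩ (t + (e.cost + 1))
  | .nput a i e, Q, σ, t => e.Need B σ ∧
      Q ⟨σ.nreg, σ.rreg, Function.update σ.nmem a
        (Function.update (σ.nmem a) (i.val σ) (e.val σ)), σ.rmem⟩ (t + (i.cost + e.cost + 1))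
  | .rput a i e, Q, σ, t =>
      Q ⟨σ.nreg, σ.rreg, σ.nmem, Function.update σ.rmem a
        (Function.update (σ.rmem a) (i.val σ) (e.val σ))⟩ (t + (i.cost + e.cost + 1))
  | .seq p q, Q, σ, t => wp B p (wp B q Q) σ t
  | .branch b p q, Q, σ, t =>
      (b.Holds σ → wp B p Q σ (t + (b.cost + 1))) ∧
      (¬ b.Holds σ → wp B q Q σ (t + (b.cost + 1)))
  | .loop b p, Q, σ, t => ∃ k, loopIter b (wp B p) k Q σ t

section
variable {B W : ℕ}

theorem loopIter_mono {b : Test} {f : (State → ℕ → Prop) → State → ℕ → Prop}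
    (hf : ∀ {Q Q' : State → ℕ → Prop}, (∀ τ t, Q τ t → Q' τ t) → ∀ {σ t}, f Q σ t → f Q' σ t)
    {Q Q' : State → ℕ → Prop} (h : ∀ τ t, Q τ t → Q' τ t) :
    ∀ (k : ℕ) {σ t}, loopIter b f k Q σ t → loopIter b f k Q' σ t
  | 0, _, _, hk => hk
  | k + 1, _, _, hk =>
      ⟨fun hb => hf (fun _ _ => loopIter_mono hf h k) (hk.1 hb), fun hb => h _ _ (hk.2 hb)⟩

theorem wp_mono : ∀ {p : Program} {Q Q' : State → ℕ → Prop}, (∀ τ t, Q τ t → Q' τ t) →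
    ∀ {σ t}, wp B p Q σ t → wp B p Q' σ t
  | .skip, _, _, h, _, _, hp => h _ _ hp
  | .nset _ _, _, _, h, _, _, hp => ⟨hp.1, h _ _ hp.2⟩
  | .rset _ _, _, _, h, _, _, hp => h _ _ hp
  | .nput _ _ _, _, _, h, _, _, hp => ⟨hp.1, h _ _ hp.2⟩
  | .rput _ _ _, _, _, h, _, _, hp => h _ _ hp
  | .seq p q, _, _, h, _, _, hp => wp_mono (p := p) (fun _ _ => wp_mono (p := q) h) hp
  | .branch _ p q, _, _, h, _, _, hp =>
      ⟨fun hb => wp_mono (p := p) h (hp.1 hb), fun hb => wp_mono (p := q) h (hp.2 hb)⟩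
  | .loop _ p, _, _, h, _, _, ⟨k, hk⟩ =>
      ⟨k, loopIter_mono (f := wp B p) (fun h' => wp_mono (p := p) h') h k hk⟩

theorem exec_loop_of_loopIter {b : Test} {p : Program}
    (hb : ∀ {σ}, Bounded B σ → b.Fits W σ)
    (hp : ∀ {Q : State → ℕ → Prop} {σ t}, Bounded B σ → wp B p Q σ t →
      ∃ T τ, Exec W p σ T τ ∧ Q τ (t + T) ∧ Bounded B τ) {Q : State → ℕ → Prop} :
    ∀ (k : ℕ) {σ t}, Bounded B σ → loopIter b (wp B p) k Q σ t →
      ∃ T τ, Exec W (.loop b p) σ T τ ∧ Q τ (t + T) ∧ Bounded B τ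
  | 0, _, _, _, h => h.elim
  | k + 1, σ, t, hσ, h => by
      by_cases hh : b.Holds σ
      · obtain ⟨T, τ, he, hq, hτ⟩ := hp hσ (h.1 hh)
        obtain ⟨T', τ', he', hq', hτ'⟩ := exec_loop_of_loopIter hb hp k hτ hq
        exact ⟨_, τ', .loop_next (hb hσ) hh he he', by convert hq' using 1; ring, hτ'⟩
      · exact ⟨_, σ, .loop_done (hb hσ) hh, h.2 hh, hσ⟩

theorem Bounded.nset {σ : State} (h : Bounded B σ) {x v : ℕ} (hv : v < B) :
    Bounded B { σ with nreg := Function.update σ.nreg x v } := by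
  refine ⟨fun y => ?_, h.2⟩
  by_cases hy : y = x
  · subst hy; simpa using hv
  · simpa [hy] using h.1 y

theorem Bounded.nput {σ : State} (h : Bounded B σ) {a i v : ℕ} (hv : v < B) :
    Bounded B { σ with nmem := Function.update σ.nmem a (Function.update (σ.nmem a) i v) } := by
  refine ⟨h.1, fun b j => ?_⟩
  by_cases hb : b = a
  · subst hb
    by_cases hj : j = i
    · subst hj; simpa using hv
    · simpa [hj] using h.2 b j
  · simpa [hb] using h.2 b j

/-- Soundness of the predicate transformer. -/
theorem exec_of_wp (hB : 12 ≤ B) (hW : 40 * B ≤ W) : ∀ {p : Program} {Q : State → ℕ → Prop}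
    {σ : State} {t : ℕ}, p.ok = true → Bounded B σ → wp B p Q σ t →
      ∃ T τ, Exec W p σ T τ ∧ Q τ (t + T) ∧ Bounded B τ
  | .skip, Q, σ, t, _, hσ, h => ⟨1, σ, .skip σ, h, hσ⟩
  | .nset x e, Q, σ, t, ho, hσ, h => by
      simp [Program.ok] at ho
      exact ⟨_, _, .nset σ x e (e.fits hB hσ ho.1 (by nlinarith)), h.2,
        hσ.nset (e.val_lt_of_need hB hσ ho.1 h.1)⟩
  | .rset x e, Q, σ, t, ho, hσ, h => by
      simp [Program.ok] at ho
      exact ⟨_, _, .rset σ x e (e.fits hB hσ ho.1 (by nlinarith)), h, hσ⟩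
  | .nput a i e, Q, σ, t, ho, hσ, h => by
      simp [Program.ok] at ho
      exact ⟨_, _, .nput σ a i e (i.fits hB hσ ho.1.1.1 (by nlinarith))
        (e.fits hB hσ ho.1.1.2 (by nlinarith)), h.2,
        hσ.nput (e.val_lt_of_need hB hσ ho.1.1.2 h.1)⟩
  | .rput a i e, Q, σ, t, ho, hσ, h => by
      simp [Program.ok] at ho
      exact ⟨_, _, .rput σ a i e (i.fits hB hσ ho.1.1.1 (by nlinarith))
        (e.fits hB hσ ho.1.1.2 (by nlinarith)), h, hσ⟩
  | .seq p q, Q, σ, t, ho, hσ, h => by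
      simp [Program.ok] at ho
      obtain ⟨T, τ, he, hq, hτ⟩ := exec_of_wp hB hW ho.1 hσ h
      obtain ⟨T', τ', he', hq', hτ'⟩ := exec_of_wp hB hW ho.2 hτ hq
      exact ⟨_, _, .seq he he', by rwa [← add_assoc], hτ'⟩
  | .branch b p q, Q, σ, t, ho, hσ, h => by
      simp [Program.ok] at ho
      have hb := b.fits (W := W) hB hσ ho.1.1.1 (by nlinarith)
      by_cases hh : b.Holds σ
      · obtain ⟨T, τ, he, hq, hτ⟩ := exec_of_wp hB hW ho.1.2 hσ (h.1 hh)
        exact ⟨_, _, .branch_true hb hh he, by rwa [← add_assoc], hτ⟩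
      · obtain ⟨T, τ, he, hq, hτ⟩ := exec_of_wp hB hW ho.2 hσ (h.2 hh)
        exact ⟨_, _, .branch_false hb hh he, by rwa [← add_assoc], hτ⟩
  | .loop b p, Q, σ, t, ho, hσ, ⟨k, hk⟩ => by
      simp [Program.ok] at ho
      exact exec_loop_of_loopIter (fun hσ => b.fits hB hσ ho.1.1 (by nlinarith))
        (fun hσ h => exec_of_wp hB hW ho.2 hσ h) k hσ hk

/-! ### Frames -/

/-- `p` assigns to the word register `x`. -/
def Program.writesNReg (x : ℕ) : Program → Bool
  | nset y _ => y == x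
  | seq p q => p.writesNReg x || q.writesNReg x
  | branch _ p q => p.writesNReg x || q.writesNReg x
  | loop _ p => p.writesNReg x
  | _ => false

/-- `p` assigns to the real register `x`. -/
def Program.writesRReg (x : ℕ) : Program → Bool
  | rset y _ => y == x
  | seq p q => p.writesRReg x || q.writesRReg x
  | branch _ p q => p.writesRReg x || q.writesRReg x
  | loop _ p => p.writesRReg x
  | _ => false

/-- `p` assigns to the array of words `x`. -/
def Program.writesNMem (x : ℕ) : Program → Bool
  | nput y _ _ => y == x
  | seq p q => p.writesNMem x || q.writesNMem x
  | branch _ p q => p.writesNMem x || q.writesNMem x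
  | loop _ p => p.writesNMem x
  | _ => false

/-- `p` assigns to the array of reals `x`. -/
def Program.writesRMem (x : ℕ) : Program → Bool
  | rput y _ _ => y == x
  | seq p q => p.writesRMem x || q.writesRMem x
  | branch _ p q => p.writesRMem x || q.writesRMem x
  | loop _ p => p.writesRMem x
  | _ => false

/-- The states agree outside of what `p` assigns to. -/
structure Frame (p : Program) (σ τ : State) : Prop where
  nreg : ∀ x, p.writesNReg x = false → τ.nreg x = σ.nreg x
  rreg : ∀ x, p.writesRReg x = false → τ.rreg x = σ.rreg x
  nmem : ∀ x, p.writesNMem x = false → τ.nmem x = σ.nmem x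
  rmem : ∀ x, p.writesRMem x = false → τ.rmem x = σ.rmem x

theorem Frame.refl (p : Program) (σ : State) : Frame p σ σ :=
  ⟨fun _ _ => rfl, fun _ _ => rfl, fun _ _ => rfl, fun _ _ => rfl⟩

theorem Frame.trans {p : Program} {σ τ ρ : State} (h : Frame p σ τ) (h' : Frame p τ ρ) :
    Frame p σ ρ :=
  ⟨fun x hx => (h'.nreg x hx).trans (h.nreg x hx), fun x hx => (h'.rreg x hx).trans (h.rreg x hx),
    fun x hx => (h'.nmem x hx).trans (h.nmem x hx), fun x hx => (h'.rmem x hx).trans (h.rmem x hx)⟩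

/-- `p` assigns to nothing that `q` does not assign to. -/
def Program.Within (p q : Program) : Prop :=
  (∀ x, q.writesNReg x = false → p.writesNReg x = false) ∧
  (∀ x, q.writesRReg x = false → p.writesRReg x = false) ∧
  (∀ x, q.writesNMem x = false → p.writesNMem x = false) ∧
  ∀ x, q.writesRMem x = false → p.writesRMem x = false

theorem Frame.mono {p q : Program} {σ τ : State} (h : Frame p σ τ) (hpq : p.Within q) :
    Frame q σ τ :=
  ⟨fun x hx => h.nreg x (hpq.1 x hx), fun x hx => h.rreg x (hpq.2.1 x hx),
    fun x hx => h.nmem x (hpq.2.2.1 x hx), fun x hx => h.rmem x (hpq.2.2.2 x hx)⟩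

theorem loopIter_frame {b : Test} {p : Program}
    (hp : ∀ {Q : State → ℕ → Prop} {σ t}, wp B p Q σ t →
      wp B p (fun τ t' => Q τ t' ∧ Frame p σ τ ∧ t ≤ t') σ t) {Q : State → ℕ → Prop} :
    ∀ (k : ℕ) {σ t}, loopIter b (wp B p) k Q σ t →
      loopIter b (wp B p) k (fun τ t' => Q τ t' ∧ Frame p σ τ ∧ t ≤ t') σ t
  | 0, _, _, h => h
  | k + 1, σ, t, h => by
      refine ⟨fun hb => wp_mono (fun τ t' h' => ?_) (hp (h.1 hb)),
        fun hb => ⟨h.2 hb, Frame.refl _ _, by omega⟩⟩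
      refine loopIter_mono (f := wp B p) (fun h'' => wp_mono h'') (fun τ' t'' h'' => ?_) k
        (loopIter_frame hp k h'.1)
      exact ⟨h''.1, h'.2.1.trans h''.2.1, by omega⟩

theorem wp_frame : ∀ {p : Program} {Q : State → ℕ → Prop} {σ t}, wp B p Q σ t →
    wp B p (fun τ t' => Q τ t' ∧ Frame p σ τ ∧ t ≤ t') σ t
  | .skip, _, _, _, h => ⟨h, Frame.refl _ _, by omega⟩
  | .nset x e, _, _, _, h => by
      refine ⟨h.1, h.2, ⟨fun y hy => ?_, fun _ _ => rfl, fun _ _ => rfl, fun _ _ => rfl⟩, by omega⟩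
      simp [Program.writesNReg] at hy
      exact Function.update_of_ne (Ne.symm hy) _ _
  | .rset x e, _, _, _, h => by
      refine ⟨h, ⟨fun _ _ => rfl, fun y hy => ?_, fun _ _ => rfl, fun _ _ => rfl⟩, by omega⟩
      simp [Program.writesRReg] at hy
      exact Function.update_of_ne (Ne.symm hy) _ _
  | .nput x i e, _, _, _, h => by
      refine ⟨h.1, h.2, ⟨fun _ _ => rfl, fun _ _ => rfl, fun y hy => ?_, fun _ _ => rfl⟩, by omega⟩
      simp [Program.writesNMem] at hy
      exact Function.update_of_ne (Ne.symm hy) _ _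
  | .rput x i e, _, _, _, h => by
      refine ⟨h, ⟨fun _ _ => rfl, fun _ _ => rfl, fun _ _ => rfl, fun y hy => ?_⟩, by omega⟩
      simp [Program.writesRMem] at hy
      exact Function.update_of_ne (Ne.symm hy) _ _
  | .seq p q, Q, σ, t, h => by
      refine wp_mono (p := p) (fun τ t' h' => ?_) (wp_frame (p := p) h)
      refine wp_mono (p := q) (fun τ' t'' h'' => ?_) (wp_frame (p := q) h'.1)
      refine ⟨h''.1, (h'.2.1.mono ?_).trans (h''.2.1.mono ?_), by omega⟩ <;>
        simp +contextual [Program.Within, Program.writesNReg, Program.writesRReg,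
          Program.writesNMem, Program.writesRMem]
  | .branch b p q, Q, σ, t, h => by
      refine ⟨fun hb => wp_mono (p := p) (fun τ t' h' => ?_) (wp_frame (p := p) (h.1 hb)),
        fun hb => wp_mono (p := q) (fun τ t' h' => ?_) (wp_frame (p := q) (h.2 hb))⟩ <;>
      refine ⟨h'.1, h'.2.1.mono ?_, by omega⟩ <;>
        simp +contextual [Program.Within, Program.writesNReg, Program.writesRReg,
          Program.writesNMem, Program.writesRMem]
  | .loop b p, Q, σ, t, ⟨k, hk⟩ =>
      ⟨k, loopIter_mono (f := wp B p) (fun h'' => wp_mono h'')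
        (fun τ t' h' => ⟨h'.1, h'.2.1.mono ⟨fun _ => id, fun _ => id, fun _ => id, fun _ => id⟩,
          h'.2.2⟩) k (loopIter_frame (fun h => wp_frame (p := p) h) k hk)⟩

/-- Consequence rule with frame. -/
theorem wp_use {p : Program} {Q Q' : State → ℕ → Prop} {σ : State} {t : ℕ} (h : wp B p Q σ t)
    (hQ : ∀ τ t', Frame p σ τ → Q τ t' → Q' τ t') : wp B p Q' σ t :=
  wp_mono (fun τ t' h' => hQ τ t' h'.2.1 h'.1) (wp_frame h)

/-! ### Rules for loops -/

/-- A loop whose invariant bounds the time. -/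
theorem wp_loop {b : Test} {p : Program} {Q : State → ℕ → Prop} {σ : State} {t : ℕ}
    (I : State → ℕ → Prop) (T₀ : ℕ) (h0 : I σ t) (hT : ∀ σ' t', I σ' t' → t' ≤ T₀)
    (hs : ∀ σ' t', Frame p σ σ' → I σ' t' → b.Holds σ' →
      wp B p I σ' (t' + (b.cost + 1)))
    (hq : ∀ τ t', Frame p σ τ → I τ t' → ¬ b.Holds τ → Q τ (t' + (b.cost + 1))) :
    wp B (.loop b p) Q σ t := by
  -- Every round takes at least one unit of time, so the bound `T₀` on the time also bounds the
  -- number of rounds that are left.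
  have key : ∀ k σ' t', T₀ < t' + k → Frame p σ σ' → I σ' t' →
      loopIter b (wp B p) k Q σ' t' := by
    intro k
    induction k with
    | zero => intro σ' t' hk _ hI; have := hT _ _ hI; omega
    | succ k ih =>
      intro σ' t' hk hF hI
      refine ⟨fun hb => ?_, fun hb => hq _ _ hF hI hb⟩
      refine wp_mono (fun τ t'' h => ?_) (wp_frame (hs _ _ hF hI hb))
      exact ih _ _ (by omega) (hF.trans h.2.1) h.1
  exact ⟨T₀ + 1, key _ _ _ (by omega) (Frame.refl _ _) h0⟩

/-- `for x = 0, …, hi - 1`. -/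
def Program.forTo (x : ℕ) (hi : NExpr) (p : Program) : Program :=
  .seq (.nset x (.lit 0)) (.loop (.nlt (.reg x) hi) (.seq p (.nset x (.add (.reg x) (.lit 1)))))

/-- The state with the word register `x` set to `v`. -/
def State.setReg (σ : State) (x v : ℕ) : State :=
  ⟨Function.update σ.nreg x v, σ.rreg, σ.nmem, σ.rmem⟩

/-- The invariant `J j` is stated for the moment before a test, when the counter already holds `j`.
The constants are the costs of setting the counter (2), of the test (`hi.cost + 3`) and of the
increment (4). -/
theorem wp_for {x : ℕ} {hi : NExpr} {p : Program} {Q : State → ℕ → Prop} {σ : State} {t : ℕ}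
    (J : ℕ → State → ℕ → Prop) (N T₀ : ℕ) (hN : N < B) (hx : p.writesNReg x = false)
    (hhi : ∀ σ', Frame (Program.forTo x hi p) σ σ' → hi.val σ' = N)
    (h0 : J 0 (σ.setReg x 0) (t + 2))
    (hT : ∀ j σ' t', j ≤ N → J j σ' t' → t' ≤ T₀)
    (hs : ∀ j σ' t', j < N → Frame (Program.forTo x hi p) σ σ' → σ'.nreg x = j → J j σ' t' →
      wp B p (fun τ t'' => J (j + 1) (τ.setReg x (j + 1)) (t'' + 4)) σ' (t' + (hi.cost + 3)))
    (hq : ∀ τ t', Frame (Program.forTo x hi p) σ τ → J N τ t' → Q τ (t' + (hi.cost + 3))) :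
    wp B (.forTo x hi p) Q σ t := by
  have hw : ∀ y, (Program.forTo x hi p).writesNReg y = (x == y || p.writesNReg y) := by
    intro y; simp [Program.forTo, Program.writesNReg]
    cases x == y <;> simp
  have hF0 : Frame (Program.forTo x hi p) σ (σ.setReg x 0) := by
    refine ⟨fun y hy => ?_, fun _ _ => rfl, fun _ _ => rfl, fun _ _ => rfl⟩
    rw [hw] at hy
    simp at hy
    exact Function.update_of_ne (Ne.symm hy.1) _ _
  refine ⟨trivial, ?_⟩
  change wp B (.loop _ _) Q (σ.setReg x 0) (t + 2)
  have hF : ∀ σ', Frame (p.seq (.nset x (.add (.reg x) (.lit 1)))) (σ.setReg x 0) σ' →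
      Frame (Program.forTo x hi p) σ σ' := fun σ' h => hF0.trans (h.mono (by
    simp +contextual [Program.Within, Program.forTo, Program.writesNReg, Program.writesRReg,
          Program.writesNMem, Program.writesRMem]))
  refine wp_loop (fun σ' t' => σ'.nreg x ≤ N ∧ J (σ'.nreg x) σ' t') T₀ ?_ ?_ ?_ ?_
  · simpa [State.setReg] using h0
  · rintro σ' t' ⟨h, h'⟩; exact hT _ _ _ h h'
  · rintro σ' t' hf ⟨h, h'⟩ hb
    have hv := hhi _ (hF _ hf)
    simp only [Test.Holds, NExpr.val, hv] at hb
    simp only [Test.cost, NExpr.cost, wp, NExpr.Need, NExpr.val]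
    have := hs _ σ' t' hb (hF _ hf) rfl h'
    refine wp_use (p := p) (Q := fun τ t'' => J (σ'.nreg x + 1) (τ.setReg x (σ'.nreg x + 1)) (t'' + 4)) ?_ ?_
    · convert this using 1; ring
    · intro τ t'' hτ hJ
      have e := hτ.nreg x hx
      rw [e]
      refine ⟨by omega, ?_, ?_⟩
      · simp; omega
      · simpa [State.setReg] using hJ
  · rintro τ t' hf ⟨h, h'⟩ hb
    have hv := hhi _ (hF _ hf)
    simp only [Test.Holds, NExpr.val, hv, not_lt] at hb
    have e : τ.nreg x = N := le_antisymm h hb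
    rw [e] at h'
    have := hq _ _ (hF _ hf) h'
    simp only [Test.cost, NExpr.cost]
    convert this using 1; ring

end

end RealRAM

/-! ## Hollow heaps -/

namespace HollowHeap

/-- `next` links the nonzero nodes of `l` in order, starting from `p` and ending with `0`. -/
def Linked (next : ℕ → ℕ) : ℕ → List ℕ → Prop
  | p, [] => p = 0
  | p, a :: l => p = a ∧ a ≠ 0 ∧ Linked next (next a) l

theorem Linked.congr {next next' : ℕ → ℕ} : ∀ {l : List ℕ} {p : ℕ}, Linked next p l →
    (∀ x ∈ l, next' x = next x) → Linked next' p l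
  | [], _, h, _ => h
  | a :: l, p, h, h' => by
      refine ⟨h.1, h.2.1, ?_⟩
      rw [h' a (by simp)]
      exact h.2.2.congr fun x hx => h' x (by simp [hx])

theorem Linked.eq_nil {next : ℕ → ℕ} {l : List ℕ} (h : Linked next 0 l) : l = [] := by
  cases l with
  | nil => rfl
  | cons a l => exact absurd h.1.symm h.2.1

theorem Linked.exists_cons {next : ℕ → ℕ} {l : List ℕ} {p : ℕ} (h : Linked next p l)
    (hp : p ≠ 0) : ∃ l', l = p :: l' ∧ Linked next (next p) l' := by
  cases l with
  | nil => exact absurd h hp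
  | cons a l => obtain ⟨rfl, -, h⟩ := h; exact ⟨l, rfl, h⟩

/-- `r - 1, …, 0`. -/
def down (r : ℕ) : List ℕ := (List.range r).reverse

theorem down_succ (r : ℕ) : down (r + 1) = r :: down r := by
  simp [down, List.range_succ]

theorem length_down (r : ℕ) : (down r).length = r := by simp [down]

theorem mem_down {r i : ℕ} : i ∈ down r ↔ i < r := by simp [down]

theorem drop_down (r : ℕ) : (down r).drop 2 = down (r - 2) := by
  match r with
  | 0 => rfl
  | 1 => rfl
  | r + 2 => simp [down_succ]

/-- The parts of the state of a hollow heap that are not stored: `loc e` is the place of the node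
`e`, where `0` means that `e` is not in the heap, `1` stands for the list of roots, `2` for the
buckets, `3` for the list of pending roots, and `e + 3` for the list of children of `e`; `lst j`
lists the nodes in the place `j`; and `hol` is the set of hollow nodes. -/
structure Ghost where
  loc : ℕ → ℕ
  lst : ℕ → List ℕ
  hol : Finset ℕ

/-- The potential of a hollow heap. -/
def Ghost.pot (g : Ghost) : ℕ :=
  -- The weights make every step of the consolidation lose at least 1: a pending node becomes a root
  -- (3 to 2), a root enters a bucket (2 to 1), of two linked roots only the winner remains (2 + 1
  -- to 2), and a hollow root with at most two children dissolves (2 + 5 to at most 3 + 3).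
  2 * (g.lst 1).length + (g.lst 2).length + 3 * (g.lst 3).length + 5 * g.hol.card

/-- The invariant of a hollow heap with nodes in `{1, …, m}`. The node `e` belongs to the item
`hd e`, the node of the item `y` is `cur y` (`0` if `y` is not in the heap); a node of an item that
has another node is hollow. -/
structure Inv (m : ℕ) (hd cur rank child sib bkt : ℕ → ℕ) (key : ℕ → ℝ) (top pend : ℕ)
    (g : Ghost) : Prop where
  bound : ∀ e, g.loc e ≠ 0 → 1 ≤ e ∧ e ≤ m
  mem : ∀ j e, j ≠ 0 → (e ∈ g.lst j ↔ g.loc e = j)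
  nodup : ∀ j, j ≠ 0 → (g.lst j).Nodup
  roots : Linked sib top (g.lst 1)
  pending : Linked sib pend (g.lst 3)
  children : ∀ e, g.loc e ≠ 0 → Linked sib (child e) (g.lst (e + 3))
  bucket : ∀ r, bkt r ≠ 0 → g.loc (bkt r) = 2 ∧ rank (bkt r) = r
  bucket' : ∀ e, g.loc e = 2 → bkt (rank e) = e ∧ cur (hd e) = e
  parent : ∀ c e, e ≠ 0 → g.loc c = e + 3 → g.loc e ≠ 0 ∧ key e ≤ key c
  ranks : ∀ e, g.loc e ≠ 0 → (g.lst (e + 3)).map rank =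
    if cur (hd e) = e then down (rank e) else (down (rank e)).take 2
  current : ∀ y, cur y ≠ 0 → hd (cur y) = y ∧ g.loc (cur y) ≠ 0
  hollow : ∀ e, e ∈ g.hol ↔ g.loc e ≠ 0 ∧ cur (hd e) ≠ e

section
variable {m : ℕ} {hd cur rank child sib bkt : ℕ → ℕ} {key : ℕ → ℝ} {top pend : ℕ} {g : Ghost}

open Function

theorem Inv.movePending (h : Inv m hd cur rank child sib bkt key top pend g) (hp : pend ≠ 0) :
    ∃ g', Inv m hd cur rank child (update sib pend top) bkt key pend (sib pend) g' ∧
      g'.pot + 1 ≤ g.pot ∧ ∀ x, g'.loc x ≠ 0 ↔ g.loc x ≠ 0 := by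
  obtain ⟨P, hP, hl⟩ := h.pending.exists_cons hp
  have hnd := h.nodup 3 (by simp)
  rw [hP] at hnd
  have hmem : ∀ j e, j ≠ 0 → (e ∈ g.lst j ↔ g.loc e = j) := h.mem
  have hc : g.loc pend = 3 := (h.mem 3 pend (by simp)).1 (by simp [hP])
  have hfr : ∀ {l : List ℕ} {p : ℕ}, Linked sib p l → pend ∉ l →
      Linked (update sib pend top) p l := fun h1 h2 => h1.congr fun x hx =>
        update_of_ne (by rintro rfl; exact h2 hx) _ _
  have hmem' : ∀ j e, j ≠ 0 →
      (e ∈ update (update g.lst 3 P) 1 (pend :: g.lst 1) j ↔ update g.loc pend 1 e = j) := by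
    intro j e hj
    have h3 := hmem 3 e
    have hj := hmem j e hj
    simp only [update_apply]
    grind
  refine ⟨⟨update g.loc pend 1, update (update g.lst 3 P) 1 (pend :: g.lst 1), g.hol⟩,
    ⟨?_, hmem', ?_, ?_, ?_, ?_, ?_, ?_, ?_, ?_, ?_, ?_⟩, ?_, ?_⟩
  · intro e; have := h.bound e; have := h.bound pend; simp only [update_apply]; grind
  · intro j hj
    have := hmem 1 pend
    have := h.nodup j hj
    have := h.nodup 1
    simp only [update_apply]; grind
  · simp only [update_self, Linked]
    exact ⟨trivial, hp, hfr h.roots (by rw [hmem _ _ (by simp)]; omega)⟩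
  · simp only [update_apply]
    simp
    exact hfr hl (by simp at hnd; exact hnd.1)
  · intro e he
    have := h.bound e
    have := h.children e
    have h4 := hmem (e+3) pend
    simp only [update_apply] at he ⊢
    have : e ≠ 0 := by grind
    simp [this]
    exact hfr (by grind) (by grind)
  · intro r hr; have := h.bucket r hr; simp only [update_apply]; grind
  · intro e he; have := h.bucket' e; simp only [update_apply] at he; grind
  · intro c e he hce; have := h.parent c e he; simp only [update_apply] at hce ⊢; grind
  · intro e he
    have := h.ranks e
    have := h.bound e
    simp only [update_apply] at he ⊢
    have : e ≠ 0 := by grind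
    simp [this]
    grind
  · intro y hy; have := h.current y hy; simp only [update_apply]; grind
  · intro e; have := h.hollow e; simp only [update_apply]; grind
  · simp [Ghost.pot, hP]; omega
  · intro x; simp only [update_apply]; grind

/-- Removing a root makes its children pending. -/
theorem Inv.mem_remove (h : Inv m hd cur rank child sib bkt key top 0 g) {e : ℕ}
    (he : g.loc e = 1 ∨ g.loc e = 2) (j x : ℕ) (hj : j ≠ 0) :
    x ∈ (if j = 1 ∨ j = 2 then (g.lst j).erase e else if j = 3 then g.lst (e + 3) else
        if j = e + 3 then [] else g.lst j) ↔
      (if x = e then 0 else if g.loc x = e + 3 then 3 else g.loc x) = j := by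
  have := h.bound e (by omega)
  have h3 : g.lst 3 = [] := h.pending.eq_nil
  have hj' := h.mem j x hj
  have h1 := h.mem (e + 3) x
  have h2 := h.mem 3 x
  have h4 := (h.nodup j hj)
  have h5 := h.parent x e
  split_ifs <;> first | (rw [h4.mem_erase_iff]; grind) | grind

/-- A hollow node has kept at most two of its children. They become pending roots at the price of 6,
while the root and its hollowness release 7. -/
theorem Inv.popHollow (h : Inv m hd cur rank child sib bkt key top 0 g) (ht : top ≠ 0)
    (hh : cur (hd top) ≠ top) :
    ∃ g', Inv m hd cur rank child sib bkt key (sib top) (child top) g' ∧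
      g'.pot + 1 ≤ g.pot ∧ ∀ x, g'.loc x ≠ 0 → g.loc x ≠ 0 := by
  obtain ⟨L, hL, hl⟩ := h.roots.exists_cons ht
  have h3 : g.lst 3 = [] := h.pending.eq_nil
  have hloc : g.loc top = 1 := (h.mem 1 top (by simp)).1 (by simp [hL])
  have hb := h.bound top (by omega)
  refine ⟨⟨fun x => if x = top then 0 else if g.loc x = top + 3 then 3 else g.loc x,
    fun j => if j = 1 ∨ j = 2 then (g.lst j).erase top else if j = 3 then g.lst (top + 3) else
        if j = top + 3 then [] else g.lst j, g.hol.erase top⟩,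
    ⟨?_, fun j x hj => h.mem_remove (.inl hloc) j x hj, ?_, ?_, ?_, ?_, ?_, ?_, ?_, ?_, ?_, ?_⟩,
    ?_, ?_⟩
  · intro e; have := h.bound e; grind
  · intro j hj
    have h4 := h.nodup j hj
    have := h.nodup (top + 3) (by simp)
    have := h4.erase top
    grind
  · simpa [hL] using hl
  · simpa using h.children top (by omega)
  · intro e he
    have := h.children e
    have := h.bound e
    grind
  · intro r hr; have := h.bucket r hr; grind
  · intro e he; have := h.bucket' e; grind
  · intro c e he hce; have := h.parent c e he; grind
  · intro e he; have := h.ranks e; have := h.bound e; grind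
  · intro y hy; have := h.current y hy; grind
  · intro e; have := h.hollow e; simp only [Finset.mem_erase]; grind
  · have h4 := h.ranks top (by omega)
    rw [if_neg hh] at h4
    have h5 := congrArg List.length h4
    simp at h5
    have h6 : (g.lst 2).erase top = g.lst 2 :=
      List.erase_of_not_mem (by rw [h.mem _ _ (by simp)]; omega)
    have h7 : top ∈ g.hol := (h.hollow top).2 ⟨by omega, hh⟩
    have h8 := Finset.card_erase_add_one h7
    simp [Ghost.pot, hL, h3, h6]
    omega
  · intro x; grind

theorem Inv.toBucket (h : Inv m hd cur rank child sib bkt key top 0 g) (ht : top ≠ 0)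
    (hh : cur (hd top) = top) (hb : bkt (rank top) = 0) :
    ∃ g', Inv m hd cur rank child sib (update bkt (rank top) top) key (sib top) 0 g' ∧
      g'.pot + 1 ≤ g.pot ∧ ∀ x, g'.loc x ≠ 0 ↔ g.loc x ≠ 0 := by
  obtain ⟨L, hL, hl⟩ := h.roots.exists_cons ht
  have hloc : g.loc top = 1 := (h.mem 1 top (by simp)).1 (by simp [hL])
  have hbd := h.bound top (by omega)
  have hnd := h.nodup 1 (by simp)
  rw [hL] at hnd
  refine ⟨⟨update g.loc top 2, update (update g.lst 1 L) 2 (top :: g.lst 2), g.hol⟩,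
    ⟨?_, ?_, ?_, ?_, ?_, ?_, ?_, ?_, ?_, ?_, ?_, ?_⟩, ?_, ?_⟩
  · intro e; have := h.bound e; simp only [update_apply]; grind
  · intro j e hj
    have h3 := h.mem 1 e
    have hj := h.mem j e hj
    simp only [update_apply]
    grind
  · intro j hj
    have := h.mem 2 top
    have := h.nodup j hj
    have := h.nodup 2
    simp only [update_apply]; grind
  · simpa [update_apply] using hl
  · simpa [update_apply] using h.pending
  · intro e he
    have := h.children e
    have := h.bound e
    simp only [update_apply] at he ⊢; grind
  · intro r hr; have := h.bucket r; simp only [update_apply] at hr ⊢; grind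
  · intro e he; have := h.bucket' e; have := h.bound e; simp only [update_apply] at he ⊢; grind
  · intro c e he hce; have := h.parent c e he; simp only [update_apply] at hce ⊢; grind
  · intro e he; have := h.ranks e; have := h.bound e; simp only [update_apply] at he ⊢; grind
  · intro y hy; have := h.current y hy; simp only [update_apply]; grind
  · intro e; have := h.hollow e; simp only [update_apply]; grind
  · simp [Ghost.pot, hL]; omega
  · intro x; simp only [update_apply]; grind

/-- Linking two roots: the winner `w` becomes the parent of `l`. -/
theorem Inv.link (h : Inv m hd cur rank child sib bkt key top 0 g) (ht : top ≠ 0)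
    (hh : cur (hd top) = top) (hb : bkt (rank top) ≠ 0) {w l : ℕ}
    (hwl : (w = top ∧ l = bkt (rank top)) ∨ (w = bkt (rank top) ∧ l = top))
    (hkey : key w ≤ key l) :
    ∃ g', Inv m hd cur (update rank w (rank top + 1)) (update child w l)
        (update (update sib l (child w)) w (sib top)) (update bkt (rank top) 0) key w 0 g' ∧
      g'.pot + 1 ≤ g.pot ∧ (∀ x, g'.loc x ≠ 0 ↔ g.loc x ≠ 0) ∧ g'.loc w ≠ 0 := by
  obtain ⟨L, hL, hl⟩ := h.roots.exists_cons ht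
  have hloc : g.loc top = 1 := (h.mem 1 top (by simp)).1 (by simp [hL])
  have hbk := h.bucket _ hb
  have hbk' := h.bucket' _ hbk.1
  have hbd := h.bound top (by omega)
  have hbd' := h.bound (bkt (rank top)) (by omega)
  have hnd := h.nodup 1 (by simp)
  rw [hL] at hnd
  set f := bkt (rank top) with hf
  have hmf : f ∈ g.lst 2 := (h.mem 2 f (by simp)).2 hbk.1
  have hwr : rank w = rank top ∧ rank l = rank top ∧ g.loc w ≠ 0 ∧ g.loc l ≠ 0 ∧ w ≠ l ∧ w ≠ 0 ∧
      l ≠ 0 ∧ cur (hd w) = w ∧ cur (hd l) = l ∧ (g.loc w = 1 ∨ g.loc w = 2) ∧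
      (g.loc l = 1 ∨ g.loc l = 2) := by
    rcases hwl with ⟨rfl, rfl⟩ | ⟨rfl, rfl⟩ <;> grind
  have hfr : ∀ {L : List ℕ} {p : ℕ}, Linked sib p L → w ∉ L → l ∉ L →
      Linked (update (update sib l (child w)) w (sib top)) p L := fun h1 h2 h3 =>
    h1.congr fun x hx => by
      rw [update_of_ne (by rintro rfl; exact h2 hx), update_of_ne (by rintro rfl; exact h3 hx)]
  have hmem : ∀ j e, j ≠ 0 → (e ∈ g.lst j ↔ g.loc e = j) := h.mem
  refine ⟨⟨update (update g.loc l (w + 3)) w 1, fun j => if j = 1 then w :: L else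
      if j = 2 then (g.lst 2).erase f else if j = w + 3 then l :: g.lst (w + 3) else g.lst j, g.hol⟩,
    ⟨?_, ?_, ?_, ?_, ?_, ?_, ?_, ?_, ?_, ?_, ?_, ?_⟩, ?_, ?_, ?_⟩
  · intro e; have := h.bound e; simp only [update_apply]; grind
  · intro j e hj
    have h1 := hmem 1 e
    have h2 := hmem 2 e
    have h3 := hmem (w + 3) e
    have h5 := (h.nodup 2 (by simp)).mem_erase_iff (a := e) (b := f)
    have hj := hmem j e hj
    simp only [update_apply]
    grind
  · intro j hj
    have h1 := hmem 1 w
    have h3 := hmem (w + 3) l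
    have := h.nodup j hj
    have := h.nodup (w + 3)
    have := (h.nodup 2 (by simp)).erase f
    grind
  · simp only [if_true, Linked, update_self]
    have h1 := hmem 1
    refine ⟨trivial, by omega, hfr hl ?_ ?_⟩ <;> grind
  · have := h.pending.eq_nil
    have h4 : w ≠ 0 := by omega
    simp [this, Linked, h4]
  · intro e he
    have h1 := h.children e
    have hb := h.bound e
    have h2 := hmem (e + 3)
    by_cases hew : e = w
    · subst hew
      have : Linked (update (update sib l (child e)) e (sib top)) (child e) (g.lst (e + 3)) :=
        hfr (h1 (by grind)) (by grind) (by grind)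
      simp
      simp only [Linked]
      refine ⟨trivial, by omega, ?_⟩
      rw [update_of_ne (by omega), update_self]
      exact this
    · have : e ≠ 0 := by simp only [update_apply] at he; grind
      simp [hew]
      exact hfr (h1 (by simp only [update_apply] at he; grind)) (by grind) (by grind)
  · intro r hr; have := h.bucket r; simp only [update_apply] at hr ⊢; grind
  · intro e he; have := h.bucket' e; simp only [update_apply] at he ⊢; grind
  · intro c e he hce; have := h.parent c e he; simp only [update_apply] at hce ⊢; grind
  · intro e he
    have h1 := h.ranks e
    have hb := h.bound e
    have h2 := hmem (e + 3)
    have hnw : ∀ e, e ≠ 0 → w ∉ g.lst (e + 3) := by intro e he; rw [hmem _ _ (by simp)]; omega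
    have hmap : ∀ e : ℕ, e ≠ 0 → (g.lst (e + 3)).map (update rank w (rank top + 1)) =
        (g.lst (e + 3)).map rank := fun e' he' => List.map_congr_left fun x hx =>
          update_of_ne (by rintro rfl; exact hnw e' he' hx) _ _
    by_cases hew : e = w
    · subst hew
      have h5 : e ≠ 0 := by omega
      -- Both roots had the same rank r, so the loser, put in front of the children of ranks r - 1,
      -- …, 0, completes the list for rank r + 1.
      simp [hmap e h5, down_succ, h1 (by grind)]
      rw [update_of_ne (by omega)]
      grind
    · have h5 : e ≠ 0 := by simp only [update_apply] at he; grind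
      have h6 : e ≠ 0 := h5
      simp [hew, hmap e h6]
      exact h1 (by simp only [update_apply] at he; grind)
  · intro y hy; have := h.current y hy; simp only [update_apply]; grind
  · intro e; have := h.hollow e; simp only [update_apply]; grind
  · have := List.length_erase_of_mem hmf
    have := List.length_pos_of_mem hmf
    have h4 : w ≠ 0 := by omega
    simp [Ghost.pot, hL, h4]; omega
  · intro x; simp only [update_apply]; grind
  · simp

/-- Buckets hold only nodes that are not hollow, so the removed node has exactly `r` children, each
of which becomes pending at the price of 3. -/
theorem Inv.extract (h : Inv m hd cur rank child sib bkt key top 0 g) {r e : ℕ} (he : bkt r = e)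
    (he0 : e ≠ 0) :
    ∃ g', Inv m hd (update cur (hd e) 0) rank child sib (update bkt r 0) key top (child e) g' ∧
      g'.pot ≤ g.pot + 3 * r ∧ ∀ x, g'.loc x ≠ 0 → g.loc x ≠ 0 := by
  have hloc := h.bucket r (he ▸ he0)
  rw [he] at hloc
  have h3 : g.lst 3 = [] := h.pending.eq_nil
  have hb := h.bound e (by omega)
  have hb' := h.bucket' e (by omega)
  refine ⟨⟨fun x => if x = e then 0 else if g.loc x = e + 3 then 3 else g.loc x,
    fun j => if j = 1 ∨ j = 2 then (g.lst j).erase e else if j = 3 then g.lst (e + 3) else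
        if j = e + 3 then [] else g.lst j, g.hol⟩,
    ⟨?_, fun j x hj => h.mem_remove (.inr hloc.1) j x hj, ?_, ?_, ?_, ?_, ?_, ?_, ?_, ?_, ?_, ?_⟩,
    ?_, ?_⟩
  · intro e; have := h.bound e; grind
  · intro j hj
    have h4 := h.nodup j hj
    have := h.nodup (e + 3) (by simp)
    have := h4.erase e
    grind
  · have h6 : (g.lst 1).erase e = g.lst 1 :=
      List.erase_of_not_mem (by rw [h.mem _ _ (by simp)]; omega)
    simpa [h6] using h.roots
  · simpa using h.children e (by omega)
  · intro e he
    have := h.children e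
    have := h.bound e
    grind
  · intro r hr; have := h.bucket r; simp only [update_apply] at hr ⊢; grind
  · intro e he; have := h.bucket' e; simp only [update_apply] at he ⊢; grind
  · intro c e he hce; have := h.parent c e he; grind
  · intro e he; have := h.ranks e; have := h.bound e; simp only [update_apply] at he ⊢; grind
  · intro y hy; have := h.current y; simp only [update_apply] at hy ⊢; grind
  · intro x; have := h.hollow x; have := h.bound x; simp only [update_apply]; grind
  · have h4 := h.ranks e (by omega)
    rw [if_pos hb'.2] at h4
    have h5 := congrArg List.length h4
    simp [length_down] at h5
    have h6 : (g.lst 1).erase e = g.lst 1 :=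
      List.erase_of_not_mem (by rw [h.mem _ _ (by simp)]; omega)
    have h7 := List.length_erase_le (l := g.lst 2) (a := e)
    simp [Ghost.pot, h3, h6]
    omega
  · intro x; grind

theorem Inv.flush (h : Inv m hd cur rank child sib bkt key top pend g) {r e : ℕ} (he : bkt r = e)
    (he0 : e ≠ 0) :
    ∃ g', Inv m hd cur rank child (update sib e top) (update bkt r 0) key e pend g' ∧
      g'.pot ≤ g.pot + 1 ∧ ∀ x, g'.loc x ≠ 0 ↔ g.loc x ≠ 0 := by
  have hloc := h.bucket r (he ▸ he0)
  rw [he] at hloc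
  have hb := h.bound e (by omega)
  have hb' := h.bucket' e (by omega)
  have hmem : ∀ j e, j ≠ 0 → (e ∈ g.lst j ↔ g.loc e = j) := h.mem
  have hme : e ∈ g.lst 2 := (hmem 2 e (by simp)).2 hloc.1
  have hfr : ∀ {l : List ℕ} {p : ℕ}, Linked sib p l → e ∉ l →
      Linked (update sib e top) p l := fun h1 h2 => h1.congr fun x hx =>
        update_of_ne (by rintro rfl; exact h2 hx) _ _
  refine ⟨⟨update g.loc e 1, fun j => if j = 1 then e :: g.lst 1 else
      if j = 2 then (g.lst 2).erase e else g.lst j, g.hol⟩,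
    ⟨?_, ?_, ?_, ?_, ?_, ?_, ?_, ?_, ?_, ?_, ?_, ?_⟩, ?_, ?_⟩
  · intro x; have := h.bound x; simp only [update_apply]; grind
  · intro j x hj
    have h1 := hmem 1 x
    have h5 := (h.nodup 2 (by simp)).mem_erase_iff (a := x) (b := e)
    have h2 := hmem 2 x
    have hj := hmem j x hj
    simp only [update_apply]
    grind
  · intro j hj
    have := hmem 1 e
    have := h.nodup j hj
    have := h.nodup 1
    have := (h.nodup 2 (by simp)).erase e
    grind
  · simp only [if_true, Linked, update_self]
    exact ⟨trivial, by omega, hfr h.roots (by rw [hmem _ _ (by simp)]; omega)⟩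
  · simp
    exact hfr h.pending (by rw [hmem _ _ (by simp)]; omega)
  · intro x hx
    have h1 := h.children x
    have := h.bound x
    have h4 := hmem (x + 3) e
    simp only [update_apply] at hx
    have : x ≠ 0 := by grind
    simp
    exact hfr (by grind) (by grind)
  · intro r hr; have := h.bucket r; simp only [update_apply] at hr ⊢; grind
  · intro e he; have := h.bucket' e; simp only [update_apply] at he ⊢; grind
  · intro c e he hce; have := h.parent c e he; simp only [update_apply] at hce ⊢; grind
  · intro x hx
    have := h.ranks x
    have := h.bound x
    simp only [update_apply] at hx ⊢
    have : x ≠ 0 := by grind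
    simp
    grind
  · intro y hy; have := h.current y hy; simp only [update_apply]; grind
  · intro x; have := h.hollow x; simp only [update_apply]; grind
  · have := List.length_erase_of_mem hme
    have := List.length_pos_of_mem hme
    simp [Ghost.pot]; omega
  · intro x; simp only [update_apply]; grind


theorem Inv.insertNode (h : Inv m hd cur rank child sib bkt key top pend g) {e : ℕ} (k : ℝ)
    (h1 : 1 ≤ e) (hm : e ≤ m) (he : g.loc e = 0) (hc : cur (hd e) = 0) :
    ∃ g', Inv m hd (update cur (hd e) e) (update rank e 0) (update child e 0) (update sib e top)
        bkt (update key e k) e pend g' ∧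
      g'.pot ≤ g.pot + 2 ∧ (∀ x, g'.loc x ≠ 0 ↔ x = e ∨ g.loc x ≠ 0) ∧
      (g.lst 2 = [] → g'.lst 2 = []) := by
  have hmem : ∀ j e, j ≠ 0 → (e ∈ g.lst j ↔ g.loc e = j) := h.mem
  have hle : g.lst (e + 3) = [] := List.eq_nil_iff_forall_not_mem.2 fun x hx =>
    (h.parent x e (by omega) ((hmem _ _ (by simp)).1 hx)).1 he
  have hfr : ∀ {l : List ℕ} {p j : ℕ}, Linked sib p l → l = g.lst j → j ≠ 0 →
      Linked (update sib e top) p l := fun h1 h2 h3 => h1.congr fun x hx =>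
        update_of_ne (by rintro rfl; rw [h2, hmem _ _ h3] at hx; omega) _ _
  refine ⟨⟨update g.loc e 1, update g.lst 1 (e :: g.lst 1), g.hol⟩,
    ⟨?_, ?_, ?_, ?_, ?_, ?_, ?_, ?_, ?_, ?_, ?_, ?_⟩, ?_, ?_, ?_⟩
  · intro x; have := h.bound x; simp only [update_apply]; grind
  · intro j x hj
    have hj := hmem j x hj
    simp only [update_apply]
    grind
  · intro j hj
    have := hmem 1 e
    have := h.nodup j hj
    simp only [update_apply]; grind
  · simp only [update_self, Linked]
    exact ⟨trivial, by omega, hfr h.roots rfl (by simp)⟩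
  · simpa using hfr h.pending rfl (by simp)
  · intro x hx
    by_cases hxe : x = e
    · subst hxe; simp [hle, Linked]
    · have h6 : x ≠ 0 := by have := h.bound x; simp [hxe] at hx; omega
      simp [hxe] at hx ⊢
      exact hfr (h.children x hx) rfl (by simp)
  · intro r hr; have := h.bucket r hr; simp only [update_apply]; grind
  · intro x hx; have := h.bucket' x; have := h.bound x; simp only [update_apply] at hx ⊢; grind
  · intro c x hx hcx; have := h.parent c x hx; simp only [update_apply] at hcx ⊢; grind
  · intro x hx
    have hmap : (g.lst (x + 3)).map (update rank e 0) = (g.lst (x + 3)).map rank :=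
      List.map_congr_left fun y hy => update_of_ne
        (by rintro rfl; rw [hmem _ _ (by simp)] at hy; omega) _ _
    by_cases hxe : x = e
    · subst hxe; simp [hle, down]
    · simp [hxe] at hx
      have h7 := h.bound x hx
      have h8 := h.ranks x hx
      simp only [update_apply] at hmap ⊢
      grind
  · intro y hy; have := h.current y; simp only [update_apply] at hy ⊢; grind
  · intro x; have := h.hollow x; have := h.bound x; simp only [update_apply]; grind
  · simp [Ghost.pot]; omega
  · intro x; simp only [update_apply]; grind
  · simp

/-- The new node `e` takes over all children of the old node `c` except the first two, whose ranks
are the largest; `c` becomes hollow. The heap order survives because `k ≤ key c`, and the ranks fit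
by `drop_down`. The buckets have to be empty since they may not contain hollow nodes. The increase 7
is 2 for a root plus 5 for a hollow node. `sib₁` and `q` leave open how the list of children was
cut. -/
theorem Inv.decrease_aux (h : Inv m hd cur rank child sib bkt key top pend g) {e c : ℕ} {k : ℝ}
    (h1 : 1 ≤ e) (hm : e ≤ m) (he : g.loc e = 0) (hc : cur (hd e) = c) (hc0 : c ≠ 0)
    (hk : k ≤ key c) (hbk : g.lst 2 = []) {sib₁ : ℕ → ℕ} {q : ℕ}
    (hl1 : Linked sib₁ (child c) ((g.lst (c + 3)).take 2))
    (hl2 : Linked sib₁ q ((g.lst (c + 3)).drop 2))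
    (hs : ∀ x, x ∉ g.lst (c + 3) → sib₁ x = sib x) :
    ∃ g', Inv m hd (update cur (hd e) e) (update rank e (rank c - 2)) (update child e q)
        (update sib₁ e top) bkt (update key e k) e pend g' ∧
      g'.pot ≤ g.pot + 7 ∧ (∀ x, g'.loc x ≠ 0 ↔ x = e ∨ g.loc x ≠ 0) ∧ g'.lst 2 = [] := by
  have hmem : ∀ j e, j ≠ 0 → (e ∈ g.lst j ↔ g.loc e = j) := h.mem
  have hle : g.lst (e + 3) = [] := List.eq_nil_iff_forall_not_mem.2 fun x hx =>
    (h.parent x e (by omega) ((hmem _ _ (by simp)).1 hx)).1 he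
  have hcc := h.current (hd e) (hc ▸ hc0)
  rw [hc] at hcc
  have hce : c ≠ e := by rintro rfl; exact hcc.2 he
  have hbc := h.bound c hcc.2
  have hndc := h.nodup (c + 3) (by simp)
  have htd := List.take_append_drop 2 (g.lst (c + 3))
  have hmtd : ∀ x, x ∈ g.lst (c + 3) ↔
      x ∈ (g.lst (c + 3)).take 2 ∨ x ∈ (g.lst (c + 3)).drop 2 := fun x => by
    rw [← List.mem_append, htd]
  have hdis : ∀ x, x ∈ (g.lst (c + 3)).take 2 → x ∉ (g.lst (c + 3)).drop 2 := by
    rw [← htd] at hndc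
    intro x hx hx'
    exact (List.nodup_append.1 hndc).2.2 x hx x hx' rfl
  have hn1 : ((g.lst (c + 3)).take 2).Nodup := hndc.sublist (List.take_sublist _ _)
  have hn2 : ((g.lst (c + 3)).drop 2).Nodup := hndc.sublist (List.drop_sublist _ _)
  have hfe : ∀ {l : List ℕ} {p : ℕ}, Linked sib₁ p l → e ∉ l →
      Linked (update sib₁ e top) p l := fun h1 h2 => h1.congr fun x hx =>
        update_of_ne (by rintro rfl; exact h2 hx) _ _
  have hfr : ∀ {l : List ℕ} {p j : ℕ}, Linked sib p l → l = g.lst j → j ≠ 0 → j ≠ c + 3 →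
      Linked (update sib₁ e top) p l := fun h1 h2 h3 h4 => by
    refine hfe (h1.congr fun x hx => hs x ?_) ?_
    · rw [h2, hmem _ _ h3] at hx
      rw [hmem _ _ (by simp)]; omega
    · rw [h2, hmem _ _ h3]; omega
  have hec : e ∉ g.lst (c + 3) := by rw [hmem _ _ (by simp)]; omega
  have hhol : c ∉ g.hol := by rw [h.hollow, hcc.1, hc]; simp
  refine ⟨⟨fun x => if x = e then 1 else if x ∈ (g.lst (c + 3)).drop 2 then e + 3 else g.loc x,
    fun j => if j = 1 then e :: g.lst 1 else if j = c + 3 then (g.lst (c + 3)).take 2 else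
      if j = e + 3 then (g.lst (c + 3)).drop 2 else g.lst j, insert c g.hol⟩,
    ⟨?_, ?_, ?_, ?_, ?_, ?_, ?_, ?_, ?_, ?_, ?_, ?_⟩, ?_, ?_, ?_⟩
  · intro x; have := h.bound x; have := hmem (c + 3) x; grind
  · intro j x hj
    have h3 := hmem (c + 3) x
    have h4 := hmem (e + 3) x
    have h5 := hmtd x
    have h6 := hdis x
    have hj := hmem j x hj
    grind
  · intro j hj
    have := hmem 1 e
    have := h.nodup j hj
    have := h.nodup 1
    grind
  · simp only [if_true, Linked, update_self]
    exact ⟨trivial, by omega, hfr h.roots rfl (by simp) (by omega)⟩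
  · have h3 : 3 ≠ e + 3 := by omega
    have h4 : 3 ≠ c + 3 := by omega
    simp only [h3, h4, if_false]
    simpa using hfr h.pending rfl (by simp) h4
  · intro x hx
    by_cases hxe : x = e
    · subst hxe
      simp [Ne.symm hce]
      exact hfe hl2 fun h' => hec ((hmtd _).2 (.inr h'))
    · by_cases hxc : x = c
      · subst hxc
        simp [hxe]
        exact hfe hl1 fun h' => hec ((hmtd _).2 (.inl h'))
      · have h7 : g.loc x ≠ 0 := by have := hmtd x; have := hmem (c + 3) x; grind
        have h6 := h.bound x h7
        simp [hxe, hxc]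
        exact hfr (h.children x h7) rfl (by simp) (by omega)
  · intro r hr
    have h3 := h.bucket r hr
    rw [← hmem _ _ (by simp), hbk] at h3
    simp at h3
  · intro x hx
    have h4 := hmem 2 x
    rw [hbk] at h4
    grind
  · intro x y hy hxy
    have h3 := h.parent x y hy
    have h4 := h.parent x c hc0
    have h5 := hmem (c + 3) x
    have h6 := hmem (e + 3) x
    have h7 := hmtd x
    have h8 := hmtd y
    have h9 := hmem (c + 3) y
    simp only [update_apply]
    grind
  · intro x hx
    have hmap : ∀ l : List ℕ, e ∉ l → l.map (update rank e (rank c - 2)) = l.map rank :=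
      fun l hl => List.map_congr_left fun y hy => update_of_ne (by rintro rfl; exact hl hy) _ _
    have hrc := h.ranks c hcc.2
    rw [if_pos (by rw [hcc.1, hc])] at hrc
    by_cases hxe : x = e
    · subst hxe
      simp [Ne.symm hce]
      rw [hmap _ hec, hrc]
      exact drop_down _
    · by_cases hxc : x = c
      · subst hxc
        simp [hxe, hcc.1, Ne.symm hce]
        rw [hmap _ hec, hrc]
      · have h7 : g.loc x ≠ 0 := by have := hmtd x; have := hmem (c + 3) x; grind
        have h6 := h.bound x h7
        have h8 := h.ranks x h7
        have h9 : x ≠ 0 := by omega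
        simp [hxe, hxc]
        rw [hmap _ (by rw [hmem _ _ (by simp)]; omega), h8]
        simp only [update_apply]
        grind
  · intro y hy
    have h3 := h.current y
    have h4 := hmtd (cur y)
    have h5 := hmem (c + 3) (cur y)
    simp only [update_apply] at hy ⊢; grind
  · intro x
    have h3 := h.hollow x
    have h4 := hmtd x
    have h5 := hmem (c + 3) x
    simp only [update_apply, Finset.mem_insert]; grind
  · have h3 : 3 ≠ e + 3 := by omega
    have h4 : 3 ≠ c + 3 := by omega
    have h7 : e ≠ 0 := by omega
    simp [Ghost.pot, Finset.card_insert_of_notMem hhol, hc0, h7]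
    omega
  · intro x; have := hmtd x; have := hmem (c + 3) x; grind
  · simpa using hbk

/-- A node of rank less than 2 has no children beyond the first two, so no list is cut and the new
node gets rank 0. -/
theorem Inv.decrease_small (h : Inv m hd cur rank child sib bkt key top pend g) {e c : ℕ} {k : ℝ}
    (h1 : 1 ≤ e) (hm : e ≤ m) (he : g.loc e = 0) (hc : cur (hd e) = c) (hc0 : c ≠ 0)
    (hk : k ≤ key c) (hbk : g.lst 2 = []) (hr : rank c < 2) :
    ∃ g', Inv m hd (update cur (hd e) e) (update rank e 0) (update child e 0)
        (update sib e top) bkt (update key e k) e pend g' ∧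
      g'.pot ≤ g.pot + 7 ∧ (∀ x, g'.loc x ≠ 0 ↔ x = e ∨ g.loc x ≠ 0) ∧ g'.lst 2 = [] := by
  have hcc := h.current (hd e) (hc ▸ hc0)
  rw [hc] at hcc
  have hrc := h.ranks c hcc.2
  rw [if_pos (by rw [hcc.1, hc])] at hrc
  have h3 := congrArg List.length hrc
  rw [List.length_map, length_down] at h3
  have h4 := h.decrease_aux (sib₁ := sib) (q := 0) h1 hm he hc hc0 hk hbk
    (by rw [List.take_of_length_le (by omega)]; exact h.children c hcc.2)
    (by rw [List.drop_of_length_le (by omega)]; rfl) (fun _ _ => rfl)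
  rwa [show rank c - 2 = 0 by omega] at h4

theorem Inv.decrease_large (h : Inv m hd cur rank child sib bkt key top pend g) {e c : ℕ} {k : ℝ}
    (h1 : 1 ≤ e) (hm : e ≤ m) (he : g.loc e = 0) (hc : cur (hd e) = c) (hc0 : c ≠ 0)
    (hk : k ≤ key c) (hbk : g.lst 2 = []) (hr : 2 ≤ rank c) :
    ∃ g', Inv m hd (update cur (hd e) e) (update rank e (rank c - 2))
        (update child e (sib (sib (child c))))
        (update (update sib (sib (child c)) 0) e top) bkt (update key e k) e pend g' ∧
      g'.pot ≤ g.pot + 7 ∧ (∀ x, g'.loc x ≠ 0 ↔ x = e ∨ g.loc x ≠ 0) ∧ g'.lst 2 = [] := by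
  have hcc := h.current (hd e) (hc ▸ hc0)
  rw [hc] at hcc
  have hrc := h.ranks c hcc.2
  rw [if_pos (by rw [hcc.1, hc])] at hrc
  have h3 := congrArg List.length hrc
  rw [List.length_map, length_down] at h3
  have h4 := h.children c hcc.2
  have hnd := h.nodup (c + 3) (by simp)
  match hl : g.lst (c + 3), h3 with
  | [], h3 => simp at h3; omega
  | [_], h3 => simp at h3; omega
  | a :: b :: l, _ =>
    rw [hl] at h4 hnd
    obtain ⟨ha, ha0, hb, hb0, h5⟩ := h4
    rw [ha, hb]
    simp at hnd
    refine h.decrease_aux (sib₁ := update sib b 0) (q := sib b) h1 hm he hc hc0 hk hbk ?_ ?_ ?_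
    · rw [hl]
      refine ⟨ha, ha0, ?_⟩
      rw [update_of_ne (by tauto)]
      exact ⟨hb, hb0, by simp [Linked]⟩
    · rw [hl]
      exact h5.congr fun x hx => update_of_ne (by rintro rfl; tauto) _ _
    · intro x hx
      rw [hl] at hx
      exact update_of_ne (by rintro rfl; simp at hx) _ _

theorem Inv.rank_lt (h : Inv m hd cur rank child sib bkt key top pend g) {c e : ℕ} (he : e ≠ 0)
    (hc : g.loc c = e + 3) : rank c < rank e := by
  have h1 := h.ranks e (h.parent c e he hc).1
  have h2 : rank c ∈ (g.lst (e + 3)).map rank :=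
    List.mem_map_of_mem ((h.mem _ _ (by simp)).2 hc)
  rw [h1] at h2
  split_ifs at h2
  · exact mem_down.1 h2
  · exact mem_down.1 (List.mem_of_mem_take h2)

/-- Every node of rank at least `2` has a child and another child that are smaller by `1` and `2`
in rank. -/
theorem Inv.exists_children (h : Inv m hd cur rank child sib bkt key top pend g) {e : ℕ}
    (he : g.loc e ≠ 0) : (1 ≤ rank e → ∃ a, g.loc a = e + 3 ∧ rank a = rank e - 1) ∧
      (2 ≤ rank e → ∃ a, g.loc a = e + 3 ∧ rank a = rank e - 2) := by
  have h1 := h.ranks e he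
  have h2 : ∀ i, i < 2 → i < rank e → ∃ a, g.loc a = e + 3 ∧ rank a = rank e - 1 - i := by
    intro i hi hr
    have h3 : rank e - 1 - i ∈ (g.lst (e + 3)).map rank := by
      rw [h1]
      have : ∃ r, rank e = r + 1 := ⟨rank e - 1, by omega⟩
      obtain ⟨r, hr'⟩ := this
      rw [hr'] at hr ⊢
      have : i = 0 ∨ (i = 1 ∧ ∃ r', r = r' + 1) := by
        rcases r with _ | r
        · omega
        · by_cases i = 0
          · omega
          · exact .inr ⟨by omega, r, rfl⟩
      rcases this with rfl | ⟨rfl, r', rfl⟩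
      · split_ifs <;> simp [down_succ]
      · split_ifs <;> simp [down_succ]
    obtain ⟨a, ha, hr⟩ := List.mem_map.1 h3
    exact ⟨a, (h.mem _ _ (by simp)).1 ha, hr⟩
  refine ⟨fun hr => by simpa using h2 0 (by simp) (by omega), fun hr => ?_⟩
  obtain ⟨a, ha, ha'⟩ := h2 1 (by simp) (by omega)
  exact ⟨a, ha, by omega⟩

/-- A node of rank r + 2 has a child of rank r, and its child of rank r + 1 has a child of rank r in
turn. Both determine the node, and they never coincide, since their parents have ranks r + 2 and r +
1. This also covers hollow nodes, which is why two children are left to them. -/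
theorem Inv.two_mul_card_le (h : Inv m hd cur rank child sib bkt key top pend g) (r : ℕ) :
    2 * {e ∈ Finset.Icc 1 m | g.loc e ≠ 0 ∧ rank e = r + 2}.card ≤
      {e ∈ Finset.Icc 1 m | g.loc e ≠ 0 ∧ rank e = r}.card := by
  classical
  set S := {e ∈ Finset.Icc 1 m | g.loc e ≠ 0 ∧ rank e = r + 2} with hS
  have hex : ∀ e, ∃ a b, e ∈ S → g.loc a = e + 3 ∧ rank a = r ∧
      (∃ a', g.loc b = a' + 3 ∧ a' ≠ 0 ∧ g.loc a' = e + 3 ∧ rank a' = r + 1) ∧ rank b = r := by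
    intro e
    by_cases he : e ∈ S
    · rw [hS] at he
      simp at he
      obtain ⟨a, ha, har⟩ := (h.exists_children he.2.1).2 (by omega)
      obtain ⟨a', ha', har'⟩ := (h.exists_children he.2.1).1 (by omega)
      obtain ⟨b, hb, hbr⟩ := (h.exists_children (e := a') (by omega)).1 (by omega)
      have := h.bound a' (by omega)
      exact ⟨a, b, fun _ => ⟨ha, by omega, ⟨a', hb, by omega, ha', by omega⟩, by omega⟩⟩
    · exact ⟨0, 0, fun h => absurd h he⟩
  choose f f' hf using hex
  have h1 : S.card = (S.image f).card := by
    rw [Finset.card_image_of_injOn]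
    intro x hx y hy hxy
    have h1 := hf x hx
    have h2 := hf y hy
    rw [hxy] at h1
    omega
  have h2 : S.card = (S.image f').card := by
    rw [Finset.card_image_of_injOn]
    intro x hx y hy hxy
    obtain ⟨-, -, ⟨a, h1⟩, -⟩ := hf x hx
    obtain ⟨-, -, ⟨b, h2⟩, -⟩ := hf y hy
    rw [hxy] at h1
    have : a = b := by omega
    subst this
    omega
  have h3 : Disjoint (S.image f) (S.image f') := by
    rw [Finset.disjoint_left]
    intro z hz hz'
    obtain ⟨x, hx, rfl⟩ := Finset.mem_image.1 hz
    obtain ⟨y, hy, hxy⟩ := Finset.mem_image.1 hz'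
    obtain ⟨h1, -⟩ := hf x hx
    obtain ⟨-, -, ⟨b, h2⟩, -⟩ := hf y hy
    rw [hxy] at h2
    have : x = b := by omega
    subst this
    rw [hS] at hx
    simp at hx
    omega
  have h4 : (S.image f ∪ S.image f').card ≤
      {e ∈ Finset.Icc 1 m | g.loc e ≠ 0 ∧ rank e = r}.card := by
    apply Finset.card_le_card
    intro z hz
    simp only [Finset.mem_union, Finset.mem_image] at hz
    simp only [Finset.mem_filter, Finset.mem_Icc]
    rcases hz with ⟨x, hx, rfl⟩ | ⟨x, hx, rfl⟩
    · have h1 := hf x hx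
      exact ⟨h.bound _ (by omega), by omega, by omega⟩
    · obtain ⟨-, -, ⟨b, h1⟩, h2⟩ := hf x hx
      exact ⟨h.bound _ (by omega), by omega, by omega⟩
  rw [Finset.card_union_of_disjoint h3] at h4
  omega

/-- Halving repeatedly, one node of rank ρ forces at least 2 ^ ⌊ρ / 2⌋ nodes of rank 0 or 1, and
there are at most `m` nodes. -/
theorem Inv.rank_le (h : Inv m hd cur rank child sib bkt key top pend g) {e : ℕ}
    (he : g.loc e ≠ 0) : rank e ≤ 2 * Nat.log 2 m + 1 := by
  have key : ∀ i r, r + 2 * i = rank e →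
      2 ^ i ≤ {e ∈ Finset.Icc 1 m | g.loc e ≠ 0 ∧ rank e = r}.card := by
    intro i
    induction i with
    | zero =>
      intro r hr
      have hb := h.bound e he
      apply Finset.card_pos.2
      exact ⟨e, by simp; exact ⟨hb, he, by omega⟩⟩
    | succ i ih =>
      intro r hr
      have h1 := ih (r + 2) (by omega)
      have h2 := h.two_mul_card_le r
      rw [pow_succ]; omega
  have h1 := key (rank e / 2) (rank e % 2) (Nat.mod_add_div _ _)
  have h2 : {e' ∈ Finset.Icc 1 m | g.loc e' ≠ 0 ∧ rank e' = rank e % 2}.card ≤ m := by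
    simpa using Finset.card_filter_le (Finset.Icc 1 m) _
  have hb := h.bound e he
  have := Nat.le_log_of_pow_le (b := 2) (by norm_num) (h1.trans h2)
  omega

/-- When all roots are in buckets, the buckets hold a minimum. -/
theorem Inv.exists_bucket_le (h : Inv m hd cur rank child sib bkt key 0 0 g) {x : ℕ}
    (hx : g.loc x ≠ 0) : ∃ b, g.loc b = 2 ∧ key b ≤ key x := by
  have h1 : g.lst 1 = [] := h.roots.eq_nil
  have h3 : g.lst 3 = [] := h.pending.eq_nil
  -- Climb from `x` to its ancestors: keys do not increase, while ranks increase strictly and are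
  -- bounded, so a root is reached, and all roots are in buckets.
  induction hd : 2 * Nat.log 2 m + 1 - rank x using Nat.strong_induction_on generalizing x with
  | _ d ih =>
    have hm := h.mem (g.loc x) x hx
    by_cases h2 : g.loc x = 2
    · exact ⟨x, h2, le_rfl⟩
    · have h4 : g.loc x ≠ 1 := fun h' => by rw [h', h1] at hm; simp at hm
      have h5 : g.loc x ≠ 3 := fun h' => by rw [h', h3] at hm; simp at hm
      obtain ⟨e, he⟩ : ∃ e, g.loc x = e + 3 := ⟨g.loc x - 3, by omega⟩
      have he0 : e ≠ 0 := by omega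
      have h6 := h.parent x e he0 he
      have h7 := h.rank_lt he0 he
      have h8 := h.rank_le h6.1
      obtain ⟨b, hb, hk⟩ := ih _ (by omega) h6.1 rfl
      exact ⟨b, hb, hk.trans h6.2⟩

end

end HollowHeap

/-! ## Dijkstra's algorithm: the program -/

namespace RealRAM

open NExpr Test Program in
/-- Relaxes the edge in register 11, whose tail is the vertex in register 10. -/
def relax : Program :=
  -- Edges are numbered from 1 so that 0 can mean "none"; the number of an edge also names the heap
  -- node that its relaxation may create. Arrays of words: 8 tails, 9 heads, 10 next edge with the
  -- same tail, 11 first edge of a vertex, 12 heap node of a vertex, 13 finished or not, 14 ranks,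
  -- 15 first children, 16 next siblings, 17 buckets. Arrays of reals: 0 weights (with index shifted
  -- by 1), 2 potentials, 3 distances, 4 keys. Registers 14 and 15 hold the first root and the first
  -- pending node, register 16 a bound for the ranks.
  (nset 12 (.get 9 (.reg 11))).seq <|
  branch (.neq (.get 13 (.reg 12)) (.lit 0))
    ((rset 0 (.sub (.add (.get 3 (.reg 10)) (.get 0 (.sub (.reg 11) (.lit 1))))
        (.get 2 (.reg 12)))).seq <|
      (nset 13 (.get 12 (.reg 12))).seq <|
      branch (.and (.neg (.neq (.reg 13) (.lit 0))) (.neg (.rlt (.reg 0) (.get 4 (.reg 13)))))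
        skip
        ((branch (.and (.neg (.neq (.reg 13) (.lit 0))) (.neg (.nlt (.get 14 (.reg 13)) (.lit 2))))
          ((nput 14 (.reg 11) (.sub (.get 14 (.reg 13)) (.lit 2))).seq <|
            (nset 17 (.get 16 (.get 15 (.reg 13)))).seq <|
            (nput 15 (.reg 11) (.get 16 (.reg 17))).seq <|
            (nput 16 (.reg 17) (.lit 0)))
          ((nput 14 (.reg 11) (.lit 0)).seq <|
            (nput 15 (.reg 11) (.lit 0)))).seq <|
          (rput 4 (.reg 11) (.reg 0)).seq <|
          (nput 16 (.reg 11) (.reg 14)).seq <|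
          (nset 14 (.reg 11)).seq <|
          nput 12 (.reg 12) (.reg 11)))
    skip

open Program in
/-- Relaxes all edges that leave the vertex in register 10. -/
def relaxAll : Program :=
  (nset 11 (.get 11 (.reg 10))).seq <|
  loop (.neg (.neq (.reg 11) (.lit 0))) (relax.seq (nset 11 (.get 10 (.reg 11))))

open Program in
/-- Moves a pending node to the list of roots, or deals with the first root. -/
def consolidateStep : Program :=
  branch (.neg (.neq (.reg 15) (.lit 0)))
    ((nset 13 (.reg 15)).seq <|
      (nset 15 (.get 16 (.reg 13))).seq <|
      (nput 16 (.reg 13) (.reg 14)).seq <|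
      nset 14 (.reg 13))
    ((nset 17 (.reg 14)).seq <|
      (nset 14 (.get 16 (.reg 17))).seq <|
      branch (.neq (.get 12 (.get 9 (.reg 17))) (.reg 17))
        ((nset 18 (.get 14 (.reg 17))).seq <|
          (nset 19 (.get 17 (.reg 18))).seq <|
          branch (.neq (.reg 19) (.lit 0))
            (nput 17 (.reg 18) (.reg 17))
            ((nput 17 (.reg 18) (.lit 0)).seq <|
              (branch (.rlt (.get 4 (.reg 19)) (.get 4 (.reg 17)))
                ((nset 13 (.reg 17)).seq <| (nset 17 (.reg 19)).seq <| nset 19 (.reg 13))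
                skip).seq <|
              (nput 16 (.reg 19) (.get 15 (.reg 17))).seq <|
              (nput 15 (.reg 17) (.reg 19)).seq <|
              (nput 14 (.reg 17) (.add (.reg 18) (.lit 1))).seq <|
              (nput 16 (.reg 17) (.reg 14)).seq <|
              (nset 14 (.reg 17)).seq <|
              branch (.nlt (.reg 16) (.add (.reg 18) (.lit 1)))
                (nset 16 (.add (.reg 18) (.lit 1))) skip))
        (nset 15 (.get 15 (.reg 17))))

open Program in
/-- Links roots until all roots are in buckets. -/
def consolidate : Program :=
  loop (.neg (.and (.neq (.reg 14) (.lit 0)) (.neq (.reg 15) (.lit 0)))) consolidateStep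

open Program in
/-- Finds a minimum among the buckets. -/
def scan : Program :=
  (nset 20 (.lit 0)).seq <|
  forTo 22 (.add (.reg 16) (.lit 1)) <|
    (nset 17 (.get 17 (.reg 22))).seq <|
    branch (.and (.neg (.neq (.reg 17) (.lit 0)))
        (.neg (.and (.neg (.neq (.reg 20) (.lit 0)))
          (.neg (.rlt (.get 4 (.reg 17)) (.get 4 (.reg 20)))))))
      (nset 20 (.reg 17)) skip

open Program in
/-- Moves the contents of the buckets to the list of roots. -/
def flush : Program :=
  forTo 22 (.add (.reg 16) (.lit 1)) <|
    (nset 17 (.get 17 (.reg 22))).seq <|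
    branch (.neq (.reg 17) (.lit 0)) skip
      ((nput 17 (.reg 22) (.lit 0)).seq <|
        (nput 16 (.reg 17) (.reg 14)).seq <|
        nset 14 (.reg 17))

open Program in
/-- Finishes the head of the node in register 20. -/
def finish : Program :=
  (nset 10 (.get 9 (.reg 20))).seq <|
  (rput 3 (.reg 10) (.add (.get 3 (.get 8 (.reg 20))) (.get 0 (.sub (.reg 20) (.lit 1))))).seq <|
  (nput 13 (.reg 10) (.lit 1)).seq <|
  (nput 12 (.reg 10) (.lit 0)).seq <|
  (nput 17 (.get 14 (.reg 20)) (.lit 0)).seq <|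
  nset 15 (.get 15 (.reg 20))

open Program in
/-- One round of Dijkstra's algorithm. -/
def round : Program :=
  consolidate.seq <| scan.seq <|
  branch (.neq (.reg 20) (.lit 0)) (nset 21 (.lit 0)) (finish.seq <| flush.seq relaxAll)

open Program in
/-- Finishes the sources, which are the vertices whose entry in array 7 is in register 3. -/
def startSources : Program :=
  forTo 23 (.reg 0) <|
    branch (.neq (.get 7 (.reg 23)) (.reg 3))
      ((nset 10 (.reg 23)).seq <|
        (rput 3 (.reg 10) .zero).seq <|
        (nput 13 (.reg 10) (.lit 1)).seq relaxAll)
      skip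

open Program in
/-- Dijkstra's algorithm. -/
def dijkstra : Program :=
  (nset 14 (.lit 0)).seq <| (nset 15 (.lit 0)).seq <| (nset 16 (.lit 0)).seq <|
  startSources.seq <| (nset 21 (.lit 1)).seq <|
  loop (.neq (.reg 21) (.lit 1)) round

end RealRAM

/-! ## Dijkstra's algorithm: the invariant of the search -/

/-- A problem for Dijkstra's algorithm: vertices are below `n`, edges are in `{1, …, m}`, those
that satisfy `ok` may be used. -/
structure SearchProblem where
  n : ℕ
  m : ℕ
  tail : ℕ → ℕ
  head : ℕ → ℕ
  ok : ℕ → Prop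
  wt : ℕ → ℝ
  pot : ℕ → ℝ
  src : ℕ → Prop

namespace SearchProblem

variable (I : SearchProblem)

/-- `e` is an edge that may be used. -/
def Edge (e : ℕ) : Prop := 1 ≤ e ∧ e ≤ I.m ∧ I.ok e

/-- There is a walk of the given length from a source. -/
inductive Reach : ℕ → ℝ → Prop
  | src (v : ℕ) : v < I.n → I.src v → Reach v 0
  | step (e : ℕ) (d : ℝ) : Reach (I.tail e) d → I.Edge e → Reach (I.head e) (d + I.wt e)

/-- The reduced weights of edges that do not leave sources are nonnegative. -/
def Feasible : Prop :=
  -- Edges that leave sources may have any weight: all sources are finished before any other vertex,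
  -- so these edges only provide the initial keys.
  ∀ e, I.Edge e → ¬ I.src (I.tail e) → 0 ≤ I.wt e + I.pot (I.tail e) - I.pot (I.head e)

/-- Edges stay among the vertices and do not enter sources. -/
def WellFormed : Prop :=
  ∀ e, I.Edge e → I.tail e < I.n ∧ I.head e < I.n ∧ ¬ I.src (I.head e)

/-- The invariant of the search: the vertices with `done v = 1` are finished, `key (cur y)` is the
key of the unfinished vertex `y`, the edges in `rel` have been relaxed. -/
structure Search (done cur : ℕ → ℕ) (D key : ℕ → ℝ) (alive : ℕ → Prop) (rel : Finset ℕ) :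
    Prop where
  rel_mem : ∀ e ∈ rel, I.Edge e ∧ done (I.tail e) = 1
  alive_rel : ∀ e, alive e → e ∈ rel ∧ key e = D (I.tail e) + I.wt e - I.pot (I.head e)
  not_done : ∀ y, cur y ≠ 0 → done y = 0 ∧ I.head (cur y) = y ∧ alive (cur y)
  -- Feasibility is needed only for the optimality of the distances. Without it the search still
  -- finds the reachable vertices, in the same time, even if there are negative cycles.
  closed : ∀ e ∈ rel,
    (done (I.head e) = 1 ∧ (I.Feasible → D (I.head e) ≤ D (I.tail e) + I.wt e)) ∨
    (cur (I.head e) ≠ 0 ∧ key (cur (I.head e)) ≤ D (I.tail e) + I.wt e - I.pot (I.head e))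
  mono : I.Feasible → ∀ v y, v < I.n → done v = 1 → ¬ I.src v → cur y ≠ 0 →
    D v - I.pot v ≤ key (cur y)
  sound : ∀ v, v < I.n → done v = 1 → I.Reach v (D v)
  zero_or_one : ∀ v, v < I.n → done v = 0 ∨ done v = 1

variable {I} {done cur : ℕ → ℕ} {D key : ℕ → ℝ} {alive : ℕ → Prop} {rel : Finset ℕ}

open Function

theorem Search.mono_alive (h : I.Search done cur D key alive rel) {alive' : ℕ → Prop}
    (h1 : ∀ e, alive' e → alive e) (h2 : ∀ y, cur y ≠ 0 → alive' (cur y)) :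
    I.Search done cur D key alive' rel :=
  { h with
    alive_rel := fun e he => h.alive_rel e (h1 e he)
    not_done := fun y hy => ⟨(h.not_done y hy).1, (h.not_done y hy).2.1, h2 y hy⟩ }

/-- What is known about the vertex `x` while its edges are relaxed. -/
def Front (I : SearchProblem) (done : ℕ → ℕ) (D : ℕ → ℝ) (x : ℕ) : Prop :=
  I.Feasible → ∀ e, I.Edge e → I.tail e = x → ∀ v, v < I.n → done v = 1 → ¬ I.src v →
    D v - I.pot v ≤ D x + I.wt e - I.pot (I.head e)

/-- A finished head needs no update: `Front` says that its reduced distance is at most the key that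
the edge would offer. -/
theorem Search.relax_done (hw : I.WellFormed) (h : I.Search done cur D key alive rel) {e : ℕ}
    (he : I.Edge e) (ht : done (I.tail e) = 1) (hf : I.Front done D (I.tail e))
    (hd : done (I.head e) = 1) : I.Search done cur D key alive (insert e rel) :=
  { h with
    rel_mem := by
      intro e' he'
      rcases Finset.mem_insert.1 he' with rfl | he'
      exacts [⟨he, ht⟩, h.rel_mem e' he']
    alive_rel := fun e' he' => ⟨Finset.mem_insert_of_mem (h.alive_rel e' he').1,
      (h.alive_rel e' he').2⟩
    closed := by
      intro e' he'
      rcases Finset.mem_insert.1 he' with rfl | he'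
      · refine .inl ⟨hd, fun hF => ?_⟩
        have := hf hF e' he rfl _ (hw e' he).2.1 hd (hw e' he).2.2
        linarith
      · exact h.closed e' he' }

theorem Search.relax_larger (h : I.Search done cur D key alive rel) {e : ℕ}
    (he : I.Edge e) (ht : done (I.tail e) = 1) (hc : cur (I.head e) ≠ 0)
    (hk : key (cur (I.head e)) ≤ D (I.tail e) + I.wt e - I.pot (I.head e)) :
    I.Search done cur D key alive (insert e rel) :=
  { h with
    rel_mem := by
      intro e' he'
      rcases Finset.mem_insert.1 he' with rfl | he'
      exacts [⟨he, ht⟩, h.rel_mem e' he']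
    alive_rel := fun e' he' => ⟨Finset.mem_insert_of_mem (h.alive_rel e' he').1,
      (h.alive_rel e' he').2⟩
    closed := by
      intro e' he'
      rcases Finset.mem_insert.1 he' with rfl | he'
      · exact .inr ⟨hc, hk⟩
      · exact h.closed e' he' }

theorem Search.relax_smaller (h : I.Search done cur D key alive rel) {e : ℕ}
    (he : I.Edge e) (hr : e ∉ rel) (ht : done (I.tail e) = 1) (hf : I.Front done D (I.tail e))
    (hd : done (I.head e) = 0) {k : ℝ} (hk : k = D (I.tail e) + I.wt e - I.pot (I.head e))
    (hc : cur (I.head e) ≠ 0 → k ≤ key (cur (I.head e))) {alive' : ℕ → Prop}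
    (ha : ∀ x, alive' x ↔ x = e ∨ alive x) :
    I.Search done (update cur (I.head e) e) D (update key e k) alive' (insert e rel) := by
  -- The node `e` is fresh because nodes in the heap come from edges relaxed earlier, so setting its
  -- key affects no other node.
  have hne : ∀ x, alive x → x ≠ e := by rintro x hx rfl; exact hr (h.alive_rel x hx).1
  have he0 : e ≠ 0 := by have := he.1; omega
  have hcur : ∀ y, cur y ≠ 0 → update key e k (cur y) = key (cur y) := fun y hy =>
    update_of_ne (hne _ (h.not_done y hy).2.2) _ _
  refine ⟨?_, ?_, ?_, ?_, ?_, h.sound, h.zero_or_one⟩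
  · intro e' he'
    rcases Finset.mem_insert.1 he' with rfl | he'
    exacts [⟨he, ht⟩, h.rel_mem e' he']
  · intro e' he'
    rcases (ha e').1 he' with rfl | he'
    · exact ⟨Finset.mem_insert_self _ _, by simpa using hk⟩
    · rw [update_of_ne (hne e' he')]
      exact ⟨Finset.mem_insert_of_mem (h.alive_rel e' he').1, (h.alive_rel e' he').2⟩
  · intro y hy
    by_cases hye : y = I.head e
    · subst hye; simp [hd, ha]
    · rw [update_of_ne hye] at hy ⊢
      have := h.not_done y hy
      exact ⟨this.1, this.2.1, (ha _).2 (.inr this.2.2)⟩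
  · intro e' he'
    by_cases hh : I.head e' = I.head e
    · refine .inr ?_
      rw [hh]
      simp only [update_self]
      refine ⟨he0, ?_⟩
      rcases Finset.mem_insert.1 he' with rfl | he'
      · exact hk.le
      · rcases h.closed e' he' with h1 | h1
        · rw [hh, hd] at h1; simp at h1
        · rw [hh] at h1; exact (hc h1.1).trans h1.2
    · have he'' : e' ∈ rel := by
        rcases Finset.mem_insert.1 he' with rfl | he'
        exacts [absurd rfl hh, he']
      rw [update_of_ne hh]
      rcases h.closed e' he'' with h1 | h1
      · exact .inl h1
      · exact .inr ⟨h1.1, by rw [hcur _ h1.1]; exact h1.2⟩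
  · intro hF v y hv hvd hvs hy
    by_cases hye : y = I.head e
    · subst hye
      simp only [update_self, hk]
      exact hf hF e he rfl v hv hvd hvs
    · rw [update_of_ne hye] at hy ⊢
      rw [hcur y hy]
      exact h.mono hF v y hv hvd hvs hy

/-- Finishing a vertex with minimum key. -/
theorem Search.finish (hw : I.WellFormed) (h : I.Search done cur D key alive rel) {b y : ℕ}
    (hb : cur y = b) (hb0 : b ≠ 0) (hmin : ∀ y, cur y ≠ 0 → key b ≤ key (cur y))
    {alive' : ℕ → Prop} (ha : ∀ e, alive' e → alive e)
    (ha' : ∀ x, x ≠ y → cur x ≠ 0 → alive' (cur x)) :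
    I.Search (update done y 1) (update cur y 0) (update D y (D (I.tail b) + I.wt b)) key alive'
        rel ∧
      I.Front (update done y 1) (update D y (D (I.tail b) + I.wt b)) y ∧ y < I.n ∧ done y = 0 ∧
      ¬ I.src y ∧ ∀ e ∈ rel, I.tail e ≠ y := by
  obtain ⟨hd, hy, hal⟩ := h.not_done y (hb ▸ hb0)
  rw [hb] at hy hal
  obtain ⟨hbr, hbk⟩ := h.alive_rel b hal
  obtain ⟨hbe, hbt⟩ := h.rel_mem b hbr
  have hwb := hw b hbe
  rw [hy] at hwb
  have hty : ∀ e ∈ rel, I.tail e ≠ y := fun e he he' => by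
    have := (h.rel_mem e he).2
    rw [he', hd] at this
    simp at this
  have hD : ∀ v, done v = 1 → update D y (D (I.tail b) + I.wt b) v = D v := fun v hv =>
    update_of_ne (by rintro rfl; omega) _ _
  have hD' : ∀ e ∈ rel, update D y (D (I.tail b) + I.wt b) (I.tail e) = D (I.tail e) := fun e he =>
    hD _ (h.rel_mem e he).2
  -- Vertices finish in the order of their reduced distances: earlier ones were at most every key in
  -- the heap, and `y` has the key of `b` exactly.
  have hmono : I.Feasible → ∀ v, v < I.n → update done y 1 v = 1 → ¬ I.src v →
      update D y (D (I.tail b) + I.wt b) v - I.pot v ≤ key b := by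
    intro hF v hv hvd hvs
    by_cases hvy : v = y
    · subst hvy; simp [hbk, hy]
    · rw [update_of_ne hvy] at hvd ⊢
      have := h.mono hF v y hv hvd hvs (hb ▸ hb0)
      rwa [hb] at this
  refine ⟨⟨?_, ?_, ?_, ?_, ?_, ?_, ?_⟩, ?_, hwb.2.1, hd, hwb.2.2, hty⟩
  · intro e he
    have := h.rel_mem e he
    rw [update_of_ne (hty e he)]
    exact this
  · intro e he
    have := h.alive_rel e (ha e he)
    rw [hD' e this.1]
    exact this
  · intro z hz
    have hzy : z ≠ y := by rintro rfl; simp at hz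
    rw [update_of_ne hzy] at hz ⊢
    rw [update_of_ne hzy]
    have := h.not_done z hz
    exact ⟨this.1, this.2.1, ha' z hzy hz⟩
  · intro e he
    rw [hD' e he]
    by_cases hey : I.head e = y
    · refine .inl ⟨by simp [hey], fun _ => ?_⟩
      rcases h.closed e he with h1 | h1
      · rw [hey, hd] at h1; simp at h1
      · have h2 := h1.2
        rw [hey, hb, hbk, hy] at h2
        rw [hey, update_self]
        linarith
    · rw [update_of_ne hey, update_of_ne hey, update_of_ne hey]
      exact h.closed e he
  · intro hF v z hv hvd hvs hz
    have hzy : z ≠ y := by rintro rfl; simp at hz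
    rw [update_of_ne hzy] at hz ⊢
    exact (hmono hF v hv hvd hvs).trans (hmin z hz)
  · intro v hv hvd
    by_cases hvy : v = y
    · subst hvy
      rw [update_self]
      have := Reach.step b _ (h.sound _ hwb.1 hbt) hbe
      rwa [hy] at this
    · rw [update_of_ne hvy] at hvd ⊢
      exact h.sound v hv hvd
  · intro v hv
    by_cases hvy : v = y
    · subst hvy; simp
    · rw [update_of_ne hvy]; exact h.zero_or_one v hv
  -- An edge out of `y` has nonnegative reduced weight, so the key that it offers is at least the
  -- reduced distance of `y`, which is the largest so far.
  · intro hF e he hey v hv hvd hvs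
    have h1 := hmono hF v hv hvd hvs
    have h2 := hF e he (hey ▸ hwb.2.2)
    rw [hey] at h2
    rw [hbk, hy] at h1
    rw [update_self]
    linarith

/-- Finishing a source. -/
theorem Search.source (hw : I.WellFormed) (h : I.Search done cur D key alive rel) {x : ℕ}
    (hx : x < I.n) (hs : I.src x) (hd : done x = 0)
    (hsrc : ∀ v, v < I.n → done v = 1 → I.src v) :
    I.Search (update done x 1) cur (update D x 0) key alive rel ∧
      I.Front (update done x 1) (update D x 0) x ∧ (∀ e ∈ rel, I.tail e ≠ x) ∧
      ∀ v, v < I.n → update done x 1 v = 1 → I.src v := by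
  have hty : ∀ e ∈ rel, I.tail e ≠ x := fun e he he' => by
    have := (h.rel_mem e he).2
    rw [he', hd] at this
    simp at this
  have hhy : ∀ e ∈ rel, I.head e ≠ x := fun e he he' =>
    (hw e (h.rel_mem e he).1).2.2 (he' ▸ hs)
  have hsrc' : ∀ v, v < I.n → update done x 1 v = 1 → I.src v := by
    intro v hv hvd
    by_cases hvx : v = x
    · subst hvx; exact hs
    · rw [update_of_ne hvx] at hvd; exact hsrc v hv hvd
  refine ⟨⟨?_, ?_, ?_, ?_, ?_, ?_, ?_⟩, ?_, hty, hsrc'⟩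
  · intro e he
    rw [update_of_ne (hty e he)]
    exact h.rel_mem e he
  · intro e he
    have := h.alive_rel e he
    rw [update_of_ne (hty e this.1)]
    exact this
  · intro z hz
    have := h.not_done z hz
    have h2 := hhy _ (h.alive_rel _ this.2.2).1
    rw [this.2.1] at h2
    rw [update_of_ne h2]
    exact this
  · intro e he
    rw [update_of_ne (hty e he), update_of_ne (hhy e he), update_of_ne (hhy e he)]
    exact h.closed e he
  · intro _ v _ hv hvd hvs
    exact absurd (hsrc' v hv hvd) hvs
  · intro v hv hvd
    by_cases hvx : v = x
    · subst hvx
      rw [update_self]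
      exact .src v hv hs
    · rw [update_of_ne hvx] at hvd ⊢
      exact h.sound v hv hvd
  · intro v hv
    by_cases hvx : v = x
    · subst hvx; simp
    · rw [update_of_ne hvx]; exact h.zero_or_one v hv
  · intro _ e he hey v hv hvd hvs
    exact absurd (hsrc' v hv hvd) hvs

end SearchProblem

/-! ## Dijkstra's algorithm: verification of the program -/

namespace RealRAM

open HollowHeap Function

section dijkstra

attribute [local simp] wp NExpr.val NExpr.Need NExpr.cost RExpr.val RExpr.cost Test.Holds Test.cost
  State.setReg

theorem frame_nset (σ : State) (x : ℕ) (e : NExpr) (v : ℕ) :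
    Frame (.nset x e) σ ⟨update σ.nreg x v, σ.rreg, σ.nmem, σ.rmem⟩ := by
  refine ⟨fun y hy => ?_, fun _ _ => rfl, fun _ _ => rfl, fun _ _ => rfl⟩
  simp [Program.writesNReg] at hy
  exact update_of_ne (Ne.symm hy) _ _

/-- The state stores a hollow heap. -/
structure StoresHeap (m : ℕ) (σ : State) (g : Ghost) : Prop where
  inv : HollowHeap.Inv m (σ.nmem 9) (σ.nmem 12) (σ.nmem 14) (σ.nmem 15) (σ.nmem 16) (σ.nmem 17)
    (σ.rmem 4) (σ.nreg 14) (σ.nreg 15) g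
  rank_le : ∀ x, g.loc x ≠ 0 → σ.nmem 14 x ≤ σ.nreg 16
  reg_le : σ.nreg 16 ≤ 2 * Nat.log 2 m + 1

theorem StoresHeap.of_frame {m : ℕ} {σ τ : State} {g : Ghost} {p : Program}
    (h : StoresHeap m σ g) (hF : Frame p σ τ)
    (h1 : (p.writesNMem 9 || p.writesNMem 12 || p.writesNMem 14 || p.writesNMem 15 ||
      p.writesNMem 16 || p.writesNMem 17 || p.writesRMem 4 || p.writesNReg 14 || p.writesNReg 15 ||
      p.writesNReg 16) = false) : StoresHeap m τ g := by
  simp only [Bool.or_eq_false_iff] at h1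
  obtain ⟨⟨⟨⟨⟨⟨⟨⟨⟨h1, h2⟩, h3⟩, h4⟩, h5⟩, h6⟩, h7⟩, h8⟩, h9⟩, h10⟩ := h1
  obtain ⟨a, b, c⟩ := h
  constructor
  · rwa [hF.nmem 9 h1, hF.nmem 12 h2, hF.nmem 14 h3, hF.nmem 15 h4, hF.nmem 16 h5, hF.nmem 17 h6,
      hF.rmem 4 h7, hF.nreg 14 h8, hF.nreg 15 h9]
  · rwa [hF.nmem 14 h3, hF.nreg 16 h10]
  · rwa [hF.nreg 16 h10]

theorem wp_consolidateStep {B m : ℕ} (hB : 2 * m + 4 ≤ B) {σ : State} {g : Ghost} {t : ℕ}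
    (h : StoresHeap m σ g) (hne : ¬ (σ.nreg 14 = 0 ∧ σ.nreg 15 = 0)) :
    wp B consolidateStep (fun τ t' => ∃ g', StoresHeap m τ g' ∧
      (∀ x, g'.loc x ≠ 0 → g.loc x ≠ 0) ∧ g'.pot + 1 ≤ g.pot ∧ t' ≤ t + 80) σ t := by
  have hlog : Nat.log 2 m ≤ m := Nat.log_le_self 2 m
  obtain ⟨hi, hr, hm⟩ := h
  simp [consolidateStep]
  refine ⟨fun h15 => ?_, fun h15 => ?_⟩
  · obtain ⟨g', h1, h2, h3⟩ := hi.movePending h15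
    exact ⟨g', ⟨by simpa using h1, by simpa [h3] using hr, by simpa using hm⟩,
      fun x hx => (h3 x).1 hx, h2⟩
  have h14 : σ.nreg 14 ≠ 0 := fun h => hne ⟨h, h15⟩
  rw [h15] at hi
  obtain ⟨L, hL, -⟩ := hi.roots.exists_cons h14
  have hal : g.loc (σ.nreg 14) ≠ 0 := by
    rw [(hi.mem 1 _ (by simp)).1 (by rw [hL]; simp)]; simp
  have hra := hi.rank_le hal
  refine ⟨fun hf => ⟨fun hb => ?_, fun hb => ⟨fun hk => ?_, fun hk => ?_⟩⟩, fun hf => ?_⟩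
  · obtain ⟨g', h1, h2, h3⟩ := hi.toBucket h14 hf hb
    exact ⟨g', ⟨by simpa [h15] using h1, by simpa [h3] using hr, by simpa using hm⟩,
      fun x hx => (h3 x).1 hx, h2⟩
  · obtain ⟨g', h1, h2, h3, h4⟩ := hi.link h14 hf hb (.inr ⟨rfl, rfl⟩) hk.le
    have h5 := h1.rank_le h4
    rw [update_self] at h5
    refine ⟨by omega, fun hm' => ⟨by omega, g', ⟨by simpa [h15] using h1, ?_, by simpa using h5⟩,
      fun x hx => (h3 x).1 hx, h2⟩, fun hm' => ⟨g', ⟨by simpa [h15] using h1, ?_, by simpa using hm⟩,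
      fun x hx => (h3 x).1 hx, h2⟩⟩
    all_goals
      intro x hx
      have := hr x ((h3 x).1 hx)
      simp [update_apply]
      split_ifs <;> omega
  · obtain ⟨g', h1, h2, h3, h4⟩ := hi.link h14 hf hb (.inl ⟨rfl, rfl⟩) hk
    have h5 := h1.rank_le h4
    rw [update_self] at h5
    refine ⟨by omega, fun hm' => ⟨by omega, g', ⟨by simpa [h15] using h1, ?_, by simpa using h5⟩,
      fun x hx => (h3 x).1 hx, h2⟩, fun hm' => ⟨g', ⟨by simpa [h15] using h1, ?_, by simpa using hm⟩,
      fun x hx => (h3 x).1 hx, h2⟩⟩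
    all_goals
      intro x hx
      have := hr x ((h3 x).1 hx)
      simp [update_apply]
      split_ifs <;> omega
  · obtain ⟨g', h1, h2, h3⟩ := hi.popHollow h14 hf
    exact ⟨g', ⟨by simpa using h1, fun x hx => by simpa using hr x (h3 x hx), by simpa using hm⟩,
      h3, h2⟩

/-- Each step takes less than 100 operations including the test and lowers the potential, so the
time plus 100 times the potential does not increase. -/
theorem wp_consolidate {B m : ℕ} (hB : 2 * m + 4 ≤ B) {σ : State} {g : Ghost} {t : ℕ}
    (h : StoresHeap m σ g) :
    wp B consolidate (fun τ t' => ∃ g', StoresHeap m τ g' ∧ τ.nreg 14 = 0 ∧ τ.nreg 15 = 0 ∧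
      (∀ x, g'.loc x ≠ 0 → g.loc x ≠ 0) ∧ t' + 100 * g'.pot ≤ t + 100 * g.pot + 20) σ t := by
  refine wp_loop (fun σ' t' => ∃ g', StoresHeap m σ' g' ∧ (∀ x, g'.loc x ≠ 0 → g.loc x ≠ 0) ∧
    t' + 100 * g'.pot ≤ t + 100 * g.pot) (t + 100 * g.pot) ⟨g, h, fun _ => id, le_rfl⟩ ?_ ?_ ?_
  · rintro σ' t' ⟨g', -, -, h'⟩; omega
  · rintro σ' t' - ⟨g', h1, h2, h3⟩ hb
    refine wp_mono ?_ (wp_consolidateStep hB h1 (by simpa using hb))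
    rintro τ t'' ⟨g'', h4, h5, h6, h7⟩
    simp at h7
    exact ⟨g'', h4, fun x hx => h2 x (h5 x hx), by omega⟩
  · rintro τ t' - ⟨g', h1, h2, h3⟩ hb
    simp at hb
    refine ⟨g', h1, hb.1, hb.2, h2, ?_⟩
    simp
    omega

theorem wp_scan {B m : ℕ} (hB : 2 * m + 4 ≤ B) {σ : State} {g : Ghost} {t : ℕ}
    (h : StoresHeap m σ g) :
    wp B scan (fun τ t' => ((τ.nreg 20 = 0 ∧ ∀ r, σ.nmem 17 r = 0) ∨
      (τ.nreg 20 ≠ 0 ∧ (∃ r, σ.nmem 17 r = τ.nreg 20) ∧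
        ∀ r, σ.nmem 17 r ≠ 0 → σ.rmem 4 (τ.nreg 20) ≤ σ.rmem 4 (σ.nmem 17 r))) ∧
      t' ≤ t + 60 * (σ.nreg 16 + 2)) σ t := by
  have hlog : Nat.log 2 m ≤ m := Nat.log_le_self 2 m
  have hreg := h.reg_le
  refine ⟨trivial, ?_⟩
  refine wp_for (fun j σ' t' => ((σ'.nreg 20 = 0 ∧ ∀ r < j, σ.nmem 17 r = 0) ∨
      (σ'.nreg 20 ≠ 0 ∧ (∃ r, σ.nmem 17 r = σ'.nreg 20) ∧
        ∀ r < j, σ.nmem 17 r ≠ 0 → σ.rmem 4 (σ'.nreg 20) ≤ σ.rmem 4 (σ.nmem 17 r))) ∧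
      t' ≤ t + 10 + 60 * j) (σ.nreg 16 + 1) (t + 10 + 60 * (σ.nreg 16 + 1)) (by omega) rfl
      ?_ ?_ ?_ ?_ ?_
  · intro σ' hF
    simp [hF.nreg 16 rfl]
  · simp
  · rintro j σ' t' hj ⟨-, h⟩; omega
  · rintro j σ' t' hj hF hx ⟨h1, h2⟩
    have e17 := hF.nmem 17 rfl
    have e4 := hF.rmem 4 rfl
    simp at e17 e4
    simp [hx, e17, e4]
    have hsplit : ∀ P : ℕ → Prop, (∀ r < j, P r) → P j → ∀ r ≤ j, P r := fun P h h' r hr => by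
      rcases Nat.lt_or_eq_of_le hr with hr | rfl
      exacts [h r hr, h']
    refine ⟨fun hb hc => ⟨?_, by omega⟩, fun hb => ⟨?_, by omega⟩⟩
    · refine .inr ⟨hb, hsplit _ (fun r hr hr0 => ?_) fun _ => le_rfl⟩
      rcases h1 with h1 | h1
      · exact absurd (h1.2 r hr) hr0
      · exact (hc h1.1).le.trans (h1.2.2 r hr hr0)
    · rcases h1 with h1 | h1
      · refine .inl ⟨h1.1, hsplit _ h1.2 ?_⟩
        by_contra h0
        exact (hb h0).1 h1.1
      · exact .inr ⟨h1.1, h1.2.1, hsplit _ h1.2.2 fun h0 => (hb h0).2⟩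
  · rintro τ t' - ⟨h1, h2⟩
    -- A bucket in use holds a node of that rank, so all buckets beyond the bound in register 16 are
    -- empty and need not be scanned.
    have hlt : ∀ r, σ.nmem 17 r ≠ 0 → r < σ.nreg 16 + 1 := fun r hr => by
      obtain ⟨h3, h4⟩ := h.inv.bucket r hr
      have := h.rank_le (σ.nmem 17 r) (by omega)
      omega
    simp
    refine ⟨?_, by omega⟩
    rcases h1 with h1 | h1
    · refine .inl ⟨h1.1, fun r => ?_⟩
      by_contra hr
      exact hr (h1.2 r (hlt r hr))
    · exact .inr ⟨h1.1, h1.2.1, fun r hr => h1.2.2 r (hlt r hr) hr⟩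

theorem wp_flush {B m : ℕ} (hB : 2 * m + 4 ≤ B) {σ : State} {g : Ghost} {t : ℕ}
    (h : StoresHeap m σ g) :
    wp B flush (fun τ t' => ∃ g', StoresHeap m τ g' ∧ g'.lst 2 = [] ∧
      (∀ x, g'.loc x ≠ 0 ↔ g.loc x ≠ 0) ∧ g'.pot ≤ g.pot + (σ.nreg 16 + 1) ∧
      t' ≤ t + 60 * (σ.nreg 16 + 2)) σ t := by
  have hlog : Nat.log 2 m ≤ m := Nat.log_le_self 2 m
  have hreg := h.reg_le
  refine wp_for (fun j σ' t' => ∃ g', StoresHeap m σ' g' ∧ (∀ r < j, σ'.nmem 17 r = 0) ∧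
      (∀ x, g'.loc x ≠ 0 ↔ g.loc x ≠ 0) ∧ g'.pot ≤ g.pot + j ∧
      t' ≤ t + 10 + 60 * j) (σ.nreg 16 + 1) (t + 10 + 60 * (σ.nreg 16 + 1)) (by omega) rfl
      ?_ ?_ ?_ ?_ ?_
  · intro σ' hF
    simp [hF.nreg 16 rfl]
  · refine ⟨g, ⟨by simpa using h.inv, by simpa using h.rank_le, by simpa using h.reg_le⟩, ?_⟩
    simp
  · rintro j σ' t' hj ⟨_, -, -, -, -, h⟩; omega
  · rintro j σ' t' hj hF hx ⟨g', h1, h2, h3, h4, h5⟩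
    simp [hx]
    refine ⟨fun hb => ⟨g', ⟨by simpa using h1.inv, by simpa using h1.rank_le,
      by simpa using h1.reg_le⟩, ?_, fun x => by simpa using h3 x, by omega, by omega⟩,
      fun hb => ?_⟩
    · intro r hr
      rcases Nat.lt_or_eq_of_le hr with hr | rfl
      exacts [h2 r hr, hb]
    · obtain ⟨g'', h6, h7, h8⟩ := h1.inv.flush rfl hb
      refine ⟨g'', ⟨by simpa using h6, fun x hx => by simpa using h1.rank_le x ((h8 x).1 hx),
        by simpa using h1.reg_le⟩, ?_, fun x => by simpa using (h8 x).trans (h3 x),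
        by omega, by omega⟩
      intro r hr
      simp only [update_apply]
      split_ifs with hrj
      · rfl
      · exact h2 r (by omega)
  · rintro τ t' hF ⟨g', h1, h2, h3, h4, h5⟩
    refine ⟨g', h1, ?_, h3, h4, by simp; omega⟩
    rw [List.eq_nil_iff_forall_not_mem]
    intro x hx
    rw [h1.inv.mem _ _ (by simp)] at hx
    have h6 := (h1.inv.bucket' x hx).1
    have h7 := h1.rank_le x (by omega)
    rw [hF.nreg 16 rfl] at h7
    rw [h2 _ (by omega)] at h6
    have := h1.inv.bound x (by omega)
    omega

/-- The state stores the search problem, with the lists `adj x` of the edges that leave `x`. -/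
structure StoresProblem (I : SearchProblem) (adj : ℕ → List ℕ) (σ : State) : Prop where
  n : σ.nreg 0 = I.n
  tail : σ.nmem 8 = I.tail
  head : σ.nmem 9 = I.head
  wt : ∀ e, σ.rmem 0 (e - 1) = I.wt e
  pot : σ.rmem 2 = I.pot
  linked : ∀ x < I.n, Linked (σ.nmem 10) (σ.nmem 11 x) (adj x)
  nodup : ∀ x < I.n, (adj x).Nodup
  mem : ∀ x < I.n, ∀ e, e ∈ adj x ↔ I.Edge e ∧ I.tail e = x
  wf : I.WellFormed

theorem StoresProblem.of_frame {I : SearchProblem} {adj : ℕ → List ℕ} {σ τ : State} {p : Program}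
    (h : StoresProblem I adj σ) (hF : Frame p σ τ)
    (h1 : (p.writesNReg 0 || p.writesNMem 8 || p.writesNMem 9 || p.writesRMem 0 ||
      p.writesRMem 2 || p.writesNMem 10 || p.writesNMem 11) = false) : StoresProblem I adj τ := by
  simp only [Bool.or_eq_false_iff] at h1
  obtain ⟨⟨⟨⟨⟨⟨h1, h2⟩, h3⟩, h4⟩, h5⟩, h6⟩, h7⟩ := h1
  have a := hF.nreg 0 h1
  have b := hF.nmem 8 h2
  have c := hF.nmem 9 h3
  have d := hF.rmem 0 h4
  have e := hF.rmem 2 h5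
  have f := hF.nmem 10 h6
  have i := hF.nmem 11 h7
  exact ⟨a ▸ h.n, b ▸ h.tail, c ▸ h.head, d ▸ h.wt, e ▸ h.pot, f ▸ i ▸ h.linked, h.nodup, h.mem,
    h.wf⟩

/-- The state stores the heap and the search. -/
structure StoresSearch (I : SearchProblem) (σ : State) (g : Ghost) (rel : Finset ℕ) : Prop where
  heap : StoresHeap I.m σ g
  search : I.Search (σ.nmem 13) (σ.nmem 12) (σ.rmem 3) (σ.rmem 4) (fun e => g.loc e ≠ 0) rel

theorem StoresSearch.of_frame {I : SearchProblem} {σ τ : State} {p : Program} {g : Ghost}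
    {rel : Finset ℕ} (h : StoresSearch I σ g rel) (hF : Frame p σ τ)
    (h1 : (p.writesNMem 9 || p.writesNMem 12 || p.writesNMem 14 || p.writesNMem 15 ||
      p.writesNMem 16 || p.writesNMem 17 || p.writesRMem 4 || p.writesNReg 14 || p.writesNReg 15 ||
      p.writesNReg 16) = false) (h2 : (p.writesNMem 13 || p.writesRMem 3) = false) :
    StoresSearch I τ g rel := by
  refine ⟨h.heap.of_frame hF h1, ?_⟩
  simp only [Bool.or_eq_false_iff] at h1 h2
  obtain ⟨⟨⟨⟨⟨⟨⟨⟨⟨-, h3⟩, -⟩, -⟩, -⟩, -⟩, h7⟩, -⟩, -⟩, -⟩ := h1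
  rw [hF.nmem 13 h2.1, hF.rmem 3 h2.2, hF.nmem 12 h3, hF.rmem 4 h7]
  exact h.search

theorem card_rel_le {I : SearchProblem} {σ : State} {g : Ghost} {rel : Finset ℕ}
    (h : StoresSearch I σ g rel) : rel.card ≤ I.m := by
  have : rel ⊆ Finset.Icc 1 I.m := fun e he => by
    have := (h.search.rel_mem e he).1
    simp
    exact ⟨this.1, this.2.1⟩
  simpa using Finset.card_le_card this

theorem wp_relax {B : ℕ} {I : SearchProblem} {adj : ℕ → List ℕ} {σ : State} {g : Ghost}
    {rel : Finset ℕ} {t e : ℕ} (hP : StoresProblem I adj σ) (hS : StoresSearch I σ g rel)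
    (h2 : g.lst 2 = []) (he : σ.nreg 11 = e) (hedge : I.Edge e) (hr : e ∉ rel)
    (hx : σ.nreg 10 = I.tail e) (hd : σ.nmem 13 (I.tail e) = 1)
    (hf : I.Front (σ.nmem 13) (σ.rmem 3) (I.tail e)) :
    wp B relax (fun τ t' => ∃ g', StoresSearch I τ g' (insert e rel) ∧ g'.lst 2 = [] ∧
      g'.pot ≤ g.pot + 7 ∧ t' ≤ t + 100) σ t := by
  have hw := hP.wf e hedge
  obtain ⟨⟨hi, hrk, hm⟩, hS⟩ := hS
  have he0 : g.loc e = 0 := by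
    by_contra h
    exact hr (hS.alive_rel e h).1
  have h9 : σ.nmem 9 e = I.head e := by rw [hP.head]
  have hk : σ.rmem 3 (I.tail e) + σ.rmem 0 (e - 1) - σ.rmem 2 (I.head e) =
      σ.rmem 3 (I.tail e) + I.wt e - I.pot (I.head e) := by rw [hP.wt, hP.pot]
  simp [relax, he, hx, h9, hk]
  set k := σ.rmem 3 (I.tail e) + I.wt e - I.pot (I.head e) with hkdef
  -- The cases: the head has a key that is no larger; its key decreases and its node has rank at
  -- least 2; it has no node yet, or one of smaller rank; it is finished already.
  refine ⟨fun hd0 => ⟨fun hc hkc => ?_, fun hc => ⟨fun hc0 hr2 => ?_, fun hc' => ?_⟩⟩, fun hd1 => ?_⟩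
  · refine ⟨g, ⟨⟨by simpa using hi, by simpa using hrk, by simpa using hm⟩, ?_⟩, h2, by omega⟩
    simpa using hS.relax_larger hedge hd hc hkc
  · obtain ⟨g', h3, h4, h5, h6⟩ := hi.decrease_large hedge.1 hedge.2.1 he0 (by rw [h9]) hc0
      (hc hc0).le h2 hr2
    rw [h9] at h3
    refine ⟨g', ⟨⟨by simpa [update_comm] using h3, ?_, by simpa using hm⟩, ?_⟩, h6, by omega⟩
    · intro x hx
      have h7 := hrk x
      have h8 := hrk _ (hi.current _ hc0).2
      simp [update_apply]
      rcases (h5 x).1 hx with rfl | h5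
      · simp; omega
      · split_ifs
        · omega
        · exact h7 h5
    · simpa using hS.relax_smaller hedge hr hd hf hd0 hkdef (fun _ => (hc hc0).le) h5
  · by_cases hc0 : σ.nmem 12 (I.head e) = 0
    · obtain ⟨g', h3, h4, h5, h6⟩ := hi.insertNode k hedge.1 hedge.2.1 he0 (by rw [h9, hc0])
      rw [h9] at h3
      refine ⟨g', ⟨⟨by simpa using h3, ?_, by simpa using hm⟩, ?_⟩, h6 h2, by omega⟩
      · intro x hx
        have h7 := hrk x
        simp [update_apply]
        rcases (h5 x).1 hx with rfl | h5
        · simp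
        · split_ifs
          · omega
          · exact h7 h5
      · simpa using hS.relax_smaller hedge hr hd hf hd0 hkdef (fun h => absurd hc0 h) h5
    · obtain ⟨g', h3, h4, h5, h6⟩ := hi.decrease_small hedge.1 hedge.2.1 he0 (by rw [h9]) hc0
        (hc hc0).le h2 (Nat.lt_succ_of_le (hc' hc0))
      rw [h9] at h3
      refine ⟨g', ⟨⟨by simpa using h3, ?_, by simpa using hm⟩, ?_⟩, h6, by omega⟩
      · intro x hx
        have h7 := hrk x
        simp [update_apply]
        rcases (h5 x).1 hx with rfl | h5
        · simp
        · split_ifs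
          · omega
          · exact h7 h5
      · simpa using hS.relax_smaller hedge hr hd hf hd0 hkdef (fun _ => (hc hc0).le) h5
  · refine ⟨g, ⟨⟨by simpa using hi, by simpa using hrk, by simpa using hm⟩, ?_⟩, h2, by omega⟩
    have := (hS.zero_or_one _ hw.2.1).resolve_left hd1
    simpa using hS.relax_done hP.wf hedge hd hf this

/-- A relaxation takes about 100 operations and adds at most 7 to the potential, which counts
100-fold; 1000 per edge covers both. No edge is relaxed twice, so charging through `rel.card` costs
at most 1000 m in a whole search. -/
theorem wp_relaxAll {B : ℕ} {I : SearchProblem} {adj : ℕ → List ℕ} {σ : State} {g : Ghost}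
    {rel : Finset ℕ} {t x : ℕ} (hP : StoresProblem I adj σ) (hS : StoresSearch I σ g rel)
    (h2 : g.lst 2 = []) (hx : σ.nreg 10 = x) (hxn : x < I.n) (hd : σ.nmem 13 x = 1)
    (hf : I.Front (σ.nmem 13) (σ.rmem 3) x) (hr : ∀ e ∈ rel, I.tail e ≠ x) :
    wp B relaxAll (fun τ t' => ∃ g' rel', StoresSearch I τ g' rel' ∧ g'.lst 2 = [] ∧
      (∀ e ∈ rel, e ∈ rel') ∧ (∀ e, I.Edge e → I.tail e = x → e ∈ rel') ∧
      t' + 100 * g'.pot + 1000 * rel.card ≤ t + 100 * g.pot + 1000 * rel'.card + 20) σ t := by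
  refine ⟨trivial, ?_⟩
  have hF0 := frame_nset σ 11 (.get 11 (.reg 10)) (NExpr.val σ (.get 11 (.reg 10)))
  refine wp_loop (fun σ' t' => ∃ g' rel' l, StoresSearch I σ' g' rel' ∧ g'.lst 2 = [] ∧
      (∀ e ∈ rel, e ∈ rel') ∧ (∀ e, I.Edge e → I.tail e = x → e ∈ rel' ∨ e ∈ l) ∧
      Linked (σ'.nmem 10) (σ'.nreg 11) l ∧ l.Nodup ∧ (∀ e ∈ l, e ∈ adj x ∧ e ∉ rel') ∧
      t' + 100 * g'.pot + 1000 * rel.card ≤ t + 100 * g.pot + 1000 * rel'.card + 10)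
      (t + 100 * g.pot + 1000 * I.m + 10) ?_ ?_ ?_ ?_
  · refine ⟨g, rel, adj x, ⟨⟨by simpa using hS.heap.inv, by simpa using hS.heap.rank_le,
      by simpa using hS.heap.reg_le⟩, by simpa using hS.search⟩, h2, fun _ => id,
      fun e h h' => .inr ((hP.mem x hxn e).2 ⟨h, h'⟩), by simpa [hx] using hP.linked x hxn,
      hP.nodup x hxn, fun e he => ⟨he, fun h => hr e h ((hP.mem x hxn e).1 he).2⟩, by simp; omega⟩
  · rintro σ' t' ⟨g', rel', l, h1, -, -, -, -, -, -, h8⟩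
    have := card_rel_le h1
    omega
  · rintro σ' t' hF ⟨g', rel', l, h1, h2, h3, h4, h5, h6, h7, h8⟩ hb
    simp at hb
    obtain ⟨l', rfl, h9⟩ := h5.exists_cons hb
    have h10 := h7 _ (List.mem_cons_self)
    have h11 := (hP.mem x hxn _).1 h10.1
    have e13 := (hF.nmem 13 rfl).trans (hF0.nmem 13 rfl)
    have e3 := (hF.rmem 3 rfl).trans (hF0.rmem 3 rfl)
    have e10 := (hF.nreg 10 rfl).trans (hF0.nreg 10 rfl)
    have hP' : StoresProblem I adj σ' := (hP.of_frame hF0 rfl).of_frame hF rfl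
    refine wp_use (p := relax) (wp_relax hP' h1 h2 rfl h11.1 h10.2 (by rw [e10, hx, h11.2])
      (by rw [e13, h11.2, hd]) (by rw [e13, e3, h11.2]; exact hf)) ?_
    rintro τ t'' hFτ ⟨g'', h12, h13, h14, h15⟩
    have e11 := hFτ.nreg 11 rfl
    have e10 := hFτ.nmem 10 rfl
    have hF1 : Frame (.nset 11 (.get 10 (.reg 11))) τ _ :=
      frame_nset τ 11 (.get 10 (.reg 11)) (NExpr.val τ (.get 10 (.reg 11)))
    refine ⟨trivial, g'', insert (σ'.nreg 11) rel', l', h12.of_frame hF1 rfl rfl, h13,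
      fun e he => Finset.mem_insert_of_mem (h3 e he), fun e h h' => ?_, ?_, ?_, fun e he => ?_, ?_⟩
    · rcases h4 e h h' with h16 | h16
      · exact .inl (Finset.mem_insert_of_mem h16)
      · rcases List.mem_cons.1 h16 with rfl | h16
        · exact .inl (Finset.mem_insert_self _ _)
        · exact .inr h16
    · simpa [e11, e10] using h9
    · exact h6.of_cons
    · have := h7 e (List.mem_cons_of_mem _ he)
      refine ⟨this.1, fun h => ?_⟩
      rcases Finset.mem_insert.1 h with rfl | h
      · exact (List.nodup_cons.1 h6).1 he
      · exact this.2 h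
    · rw [Finset.card_insert_of_notMem h10.2]
      simp at h15 ⊢
      omega
  · rintro τ t' hF ⟨g', rel', l, h1, h2, h3, h4, h5, h6, h7, h8⟩ hb
    simp at hb
    rw [hb] at h5
    have := h5.eq_nil
    subst this
    refine ⟨g', rel', h1, h2, h3, fun e h h' => (h4 e h h').resolve_right (by simp), ?_⟩
    simp
    omega

/-- The state between two rounds: all edges that leave finished vertices have been relaxed. -/
structure BetweenRounds (I : SearchProblem) (adj : ℕ → List ℕ) (σ : State) (g : Ghost)
    (rel : Finset ℕ) : Prop where
  problem : StoresProblem I adj σ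
  search : StoresSearch I σ g rel
  lst : g.lst 2 = []
  relaxed : ∀ e, I.Edge e → σ.nmem 13 (I.tail e) = 1 → e ∈ rel

/-- The number of finished vertices. -/
def finished (n : ℕ) (done : ℕ → ℕ) : ℕ := {v ∈ Finset.range n | done v = 1}.card

theorem finished_le (n : ℕ) (done : ℕ → ℕ) : finished n done ≤ n := by
  simpa [finished] using Finset.card_filter_le (Finset.range n) fun v => done v = 1

theorem finished_update {n : ℕ} {done : ℕ → ℕ} {y : ℕ} (hy : y < n) (h : done y = 0) :
    finished n (update done y 1) = finished n done + 1 := by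
  have : {v ∈ Finset.range n | update done y 1 v = 1} =
      insert y {v ∈ Finset.range n | done v = 1} := by
    ext v
    by_cases hv : v = y
    · subst hv; simp [hy]
    · simp [hv]
  rw [finished, this, Finset.card_insert_of_notMem (by simp [h]), finished]

theorem StoresHeap.lst_two {m : ℕ} {σ : State} {g : Ghost} (h : StoresHeap m σ g)
    (hb : ∀ r, σ.nmem 17 r = 0) : ∀ x, g.loc x ≠ 2 := by
  intro x hx
  have h6 := (h.inv.bucket' x hx).1
  rw [hb] at h6
  have := h.inv.bound x (by omega)
  omega

/-- Consolidation and relaxations are paid for by the heap potential and by the relaxed edges. What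
remains is proportional to the bound for the ranks, hence logarithmic: scanning and flushing the
buckets, and the potential of the children of the extracted node and of the flushed nodes. -/
theorem wp_round {B : ℕ} {I : SearchProblem} {adj : ℕ → List ℕ} (hB : 2 * I.m + 4 ≤ B) {σ : State}
    {g : Ghost} {rel : Finset ℕ} {t : ℕ} (h : BetweenRounds I adj σ g rel) (hgo : σ.nreg 21 = 1) :
    wp B round (fun τ t' => ∃ g' rel', BetweenRounds I adj τ g' rel' ∧
      ((τ.nreg 21 = 0 ∧ (∀ y, τ.nmem 12 y = 0) ∧ (∀ r, τ.nmem 17 r = 0) ∧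
        finished I.n (τ.nmem 13) = finished I.n (σ.nmem 13)) ∨
        (τ.nreg 21 = 1 ∧ finished I.n (τ.nmem 13) = finished I.n (σ.nmem 13) + 1)) ∧
      (∀ v, I.src v → σ.nmem 13 v = 1 ∧ σ.rmem 3 v = 0 → τ.nmem 13 v = 1 ∧ τ.rmem 3 v = 0) ∧
      t' + 100 * g'.pot + 1000 * rel.card ≤ t + 100 * g.pot + 1000 * rel'.card +
        1000 * (2 * Nat.log 2 I.m + 3)) σ t := by
  refine wp_use (p := consolidate) (wp_consolidate hB h.search.heap) ?_
  rintro σ₁ t₁ hF₁ ⟨g₁, a1, a2, a3, a4, a5⟩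
  refine wp_use (p := scan) (wp_scan hB a1) ?_
  rintro σ₂ t₂ hF₂ ⟨b1, b2⟩
  have hreg := a1.reg_le
  have hP₂ : StoresProblem I adj σ₂ := (h.problem.of_frame hF₁ rfl).of_frame hF₂ rfl
  have hH₂ : StoresHeap I.m σ₂ g₁ := a1.of_frame hF₂ rfl
  have hal : ∀ y, σ₂.nmem 12 y ≠ 0 → g₁.loc (σ₂.nmem 12 y) ≠ 0 := fun y hy =>
    (hH₂.inv.current y hy).2
  have hS₂ : StoresSearch I σ₂ g₁ rel := by
    refine ⟨hH₂, ?_⟩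
    have := h.search.search
    rw [← hF₁.nmem 13 rfl, ← hF₁.nmem 12 rfl, ← hF₁.rmem 3 rfl, ← hF₁.rmem 4 rfl,
      ← hF₂.nmem 13 rfl, ← hF₂.nmem 12 rfl, ← hF₂.rmem 3 rfl, ← hF₂.rmem 4 rfl] at this
    exact this.mono_alive a4 hal
  have e13 : σ₂.nmem 13 = σ.nmem 13 := (hF₂.nmem 13 rfl).trans (hF₁.nmem 13 rfl)
  have e3 : σ₂.rmem 3 = σ.rmem 3 := (hF₂.rmem 3 rfl).trans (hF₁.rmem 3 rfl)
  have e21 : σ₂.nreg 21 = 1 := ((hF₂.nreg 21 rfl).trans (hF₁.nreg 21 rfl)).trans hgo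
  have h14 : σ₂.nreg 14 = 0 := (hF₂.nreg 14 rfl).trans a2
  have h15 : σ₂.nreg 15 = 0 := (hF₂.nreg 15 rfl).trans a3
  have e16 : σ₂.nreg 16 = σ₁.nreg 16 := hF₂.nreg 16 rfl
  rw [← hF₂.nmem 17 rfl, ← hF₂.rmem 4 rfl] at b1
  have hi := hH₂.inv
  rw [h14, h15] at hi
  refine ⟨fun hb => ?_, fun hb => ?_⟩
  · -- the heap is empty
    change σ₂.nreg 20 = 0 at hb
    have hz := (b1.resolve_right fun h => h.1 hb).2
    -- After consolidation a nonempty heap would have a node in a bucket.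
    have hno : ∀ x, g₁.loc x = 0 := fun x => by
      by_contra hx
      obtain ⟨b, hb2, -⟩ := hi.exists_bucket_le hx
      exact hH₂.lst_two hz b hb2
    have hF₃ := frame_nset σ₂ 21 (.lit 0) (NExpr.val σ₂ (.lit 0))
    refine ⟨trivial, g₁, rel, ⟨hP₂.of_frame hF₃ rfl, hS₂.of_frame hF₃ rfl rfl, ?_, ?_⟩,
      .inl ⟨by simp, fun y => ?_, hz, by simp [e13]⟩, ?_, ?_⟩
    · rw [List.eq_nil_iff_forall_not_mem]
      intro x hx
      rw [hi.mem _ _ (by simp), hno] at hx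
      simp at hx
    · intro e he het
      exact h.relaxed e he (by simpa [e13] using het)
    · by_contra hy
      exact hal y hy (hno _)
    · simp [e13, e3]
    · simp
      omega
  · change ¬ σ₂.nreg 20 = 0 at hb
    obtain ⟨-, ⟨r, hr⟩, hmin⟩ := b1.resolve_left fun h => hb h.1
    have hbk := hi.bucket r (by rw [hr]; exact hb)
    rw [hr] at hbk
    have hbc := hi.bucket' _ hbk.1
    have hrr := hbk.2
    obtain ⟨g₃, c1, c2, c3⟩ := hi.extract hr hb
    -- The scan compares only the nodes in buckets; every other node has a key at least that of one
    -- of them.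
    have hmin' : ∀ y, σ₂.nmem 12 y ≠ 0 → σ₂.rmem 4 (σ₂.nreg 20) ≤ σ₂.rmem 4 (σ₂.nmem 12 y) := by
      intro y hy
      obtain ⟨b, hb2, hbk⟩ := hi.exists_bucket_le (hal y hy)
      have h6 := hi.bucket' b hb2
      have h7 := hi.bound b (by omega)
      have h8 := hmin (σ₂.nmem 14 b) (by rw [h6.1]; omega)
      rw [h6.1] at h8
      exact h8.trans hbk
    have hrle := hH₂.rank_le _ (by omega : g₁.loc (σ₂.nreg 20) ≠ 0)
    obtain ⟨d1, d2, d3, d4, d5, d6⟩ := hS₂.search.finish (alive' := fun x => g₃.loc x ≠ 0) hP₂.wf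
      hbc.2 hb hmin' c3 (fun x hx hx0 => by
        have := c1.current x (by rwa [update_of_ne hx])
        rw [update_of_ne hx] at this
        exact this.2)
    set y := σ₂.nmem 9 (σ₂.nreg 20) with hy
    have hP₃ : wp B finish (fun τ t' => StoresProblem I adj τ ∧ StoresSearch I τ g₃ rel ∧
        τ.nmem 13 = update (σ₂.nmem 13) y 1 ∧ (∀ v, v ≠ y → τ.rmem 3 v = σ₂.rmem 3 v) ∧
        τ.nreg 10 = y ∧ τ.nreg 21 = 1 ∧ τ.nreg 16 = σ₂.nreg 16 ∧
        I.Front (τ.nmem 13) (τ.rmem 3) y ∧ t' ≤ t₂ + 60) σ₂ (t₂ + 4) := by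
      refine wp_use (Q := fun τ t' => StoresSearch I τ g₃ rel ∧
        τ.nmem 13 = update (σ₂.nmem 13) y 1 ∧ (∀ v, v ≠ y → τ.rmem 3 v = σ₂.rmem 3 v) ∧
        τ.nreg 10 = y ∧ I.Front (τ.nmem 13) (τ.rmem 3) y ∧ t' ≤ t₂ + 60) ?_ ?_
      · have hwt := hP₂.wt (σ₂.nreg 20)
        have ht : σ₂.nmem 8 (σ₂.nreg 20) = I.tail (σ₂.nreg 20) := by rw [hP₂.tail]
        simp [finish, hrr, ht, hwt, ← hy]
        refine ⟨⟨⟨by simpa [h14] using c1, ?_, by simpa using hH₂.reg_le⟩, by simpa using d1⟩, ?_, d2⟩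
        · intro x hx
          simpa using hH₂.rank_le x (c3 x hx)
        · intro v hv; simp [hv]
      · rintro τ t' hF ⟨e1, e2, e4, e5, e6, e7⟩
        exact ⟨hP₂.of_frame hF rfl, e1, e2, e4, e5, (hF.nreg 21 rfl).trans e21,
          hF.nreg 16 rfl, e6, e7⟩
    refine wp_use (p := finish) hP₃ ?_
    rintro σ₃ t₃ - ⟨f1, f2, f3, f4, f5, f6, f7, f8, f9⟩
    refine wp_use (p := flush) (wp_flush hB f2.heap) ?_
    rintro σ₄ t₄ hF₄ ⟨g₄, k1, k2, k3, k4, k5⟩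
    have e13' : σ₄.nmem 13 = σ₃.nmem 13 := hF₄.nmem 13 rfl
    have e3' : σ₄.rmem 3 = σ₃.rmem 3 := hF₄.rmem 3 rfl
    have hS₄ : StoresSearch I σ₄ g₄ rel := by
      refine ⟨k1, ?_⟩
      rw [e13', e3', hF₄.nmem 12 rfl, hF₄.rmem 4 rfl]
      exact f2.search.mono_alive (fun e => (k3 e).1)
        fun z hz => (k3 _).2 (f2.search.not_done z hz).2.2
    refine wp_use (p := relaxAll) (wp_relaxAll (x := y) (f1.of_frame hF₄ rfl) hS₄ k2
      (by rw [hF₄.nreg 10 rfl, f5]) d3 (by rw [e13', f3]; simp) (by rw [e13', e3']; exact f8) d6) ?_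
    rintro τ t' hF₅ ⟨g₅, rel', l1, l2, l3, l4, l5⟩
    have e13'' : τ.nmem 13 = update (σ.nmem 13) y 1 := by
      rw [hF₅.nmem 13 rfl, e13', f3, e13]
    have e3'' : τ.rmem 3 = σ₃.rmem 3 := (hF₅.rmem 3 rfl).trans e3'
    rw [e13] at d4
    refine ⟨g₅, rel', ⟨(f1.of_frame hF₄ rfl).of_frame hF₅ rfl, l1, l2, ?_⟩, .inr ⟨?_, ?_⟩, ?_, ?_⟩
    · intro e he het
      by_cases hey : I.tail e = y
      · exact l4 e he hey
      · rw [e13'', update_of_ne hey] at het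
        exact l3 e (h.relaxed e he het)
    · rw [hF₅.nreg 21 rfl, hF₄.nreg 21 rfl, f6]
    · rw [e13'', finished_update d3 d4]
    · intro v hv ⟨h1, h2⟩
      have hvy : v ≠ y := by rintro rfl; exact d5 hv
      rw [e13'', e3'', update_of_ne hvy, f4 v hvy, e3]
      exact ⟨h1, h2⟩
    · omega

end dijkstra

end RealRAM


/-! ### The outcome and the running time of a complete search -/

namespace SearchProblem

/-- `done` marks the vertices that can be reached from a source, and `D` holds their distances
if the problem is feasible. -/
structure Solved (I : SearchProblem) (done : ℕ → ℕ) (D : ℕ → ℝ) : Prop where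
  zero_or_one : ∀ v, v < I.n → done v = 0 ∨ done v = 1
  src : ∀ v, v < I.n → I.src v → done v = 1 ∧ D v = 0
  closed : ∀ e, I.Edge e → done (I.tail e) = 1 →
    done (I.head e) = 1 ∧ (I.Feasible → D (I.head e) ≤ D (I.tail e) + I.wt e)
  sound : ∀ v, v < I.n → done v = 1 → I.Reach v (D v)

end SearchProblem

namespace RealRAM

open HollowHeap Function

section dijkstra

attribute [local simp] wp NExpr.val NExpr.Need NExpr.cost RExpr.val RExpr.cost Test.Holds Test.cost
  State.setReg

theorem BetweenRounds.of_frame {I : SearchProblem} {adj : ℕ → List ℕ} {σ τ : State} {g : Ghost}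
    {rel : Finset ℕ} {p : Program} (h : BetweenRounds I adj σ g rel) (hF : Frame p σ τ)
    (h1 : (p.writesNReg 0 || p.writesNMem 8 || p.writesNMem 9 || p.writesRMem 0 ||
      p.writesRMem 2 || p.writesNMem 10 || p.writesNMem 11) = false)
    (h2 : (p.writesNMem 9 || p.writesNMem 12 || p.writesNMem 14 || p.writesNMem 15 ||
      p.writesNMem 16 || p.writesNMem 17 || p.writesRMem 4 || p.writesNReg 14 || p.writesNReg 15 ||
      p.writesNReg 16) = false) (h3 : (p.writesNMem 13 || p.writesRMem 3) = false) :
    BetweenRounds I adj τ g rel := by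
  refine ⟨h.problem.of_frame hF h1, h.search.of_frame hF h2 h3, h.lst, fun e he het => ?_⟩
  rw [Bool.or_eq_false_iff] at h3
  rw [hF.nmem 13 h3.1] at het
  exact h.relaxed e he het

/-- As long as only sources are finished, which the loop invariant records, `Front` and the
monotonicity of distances hold vacuously, whatever the weights of the edges leaving sources. -/
theorem wp_startSources {B : ℕ} {I : SearchProblem} {adj : ℕ → List ℕ} (hBn : I.n < B) {σ : State}
    {t : ℕ} (hP : StoresProblem I adj σ)
    (hsrc : ∀ v < I.n, (I.src v ↔ σ.nmem 7 v = σ.nreg 3)) (hdone : ∀ v < I.n, σ.nmem 13 v = 0)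
    (hcur : ∀ y, σ.nmem 12 y = 0) (hbkt : ∀ r, σ.nmem 17 r = 0)
    (h14 : σ.nreg 14 = 0) (h15 : σ.nreg 15 = 0) (h16 : σ.nreg 16 = 0) :
    wp B startSources (fun τ t' => ∃ g rel, BetweenRounds I adj τ g rel ∧
      (∀ v < I.n, I.src v → τ.nmem 13 v = 1 ∧ τ.rmem 3 v = 0) ∧
      t' + 100 * g.pot ≤ t + 10 + 1000 * rel.card + 70 * I.n) σ t := by
  refine wp_for (fun j σ' t' => ∃ g rel, BetweenRounds I adj σ' g rel ∧
    (∀ v < I.n, σ'.nmem 13 v = 1 → I.src v ∧ v < j) ∧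
    (∀ v < j, I.src v → σ'.nmem 13 v = 1 ∧ σ'.rmem 3 v = 0) ∧
    t' + 100 * g.pot ≤ t + 2 + 1000 * rel.card + 70 * j) I.n
    (t + 2 + 1000 * I.m + 70 * I.n) hBn rfl ?_ ?_ ?_ ?_ ?_
  · intro σ' hF
    exact (hF.nreg 0 rfl).trans hP.n
  · have hF0 := frame_nset σ 23 (.lit 0) 0
    refine ⟨⟨fun _ => 0, fun _ => [], ∅⟩, ∅, ⟨hP.of_frame hF0 rfl, ⟨⟨?_, ?_, ?_⟩, ?_⟩, rfl, ?_⟩, ?_,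
      ?_, ?_⟩
    · constructor <;> simp [Linked, hcur, hbkt, h14, h15]
      intros; omega
    · simp
    · simp [h16]
    · constructor <;> simp [hcur]
      · intro v hv h1; simp [hdone v hv] at h1
      · intro v hv; simp [hdone v hv]
    · intro e he h1
      simp [hdone _ (hP.wf e he).1] at h1
    · intro v hv h1
      simp [hdone v hv] at h1
    · simp
    · simp [Ghost.pot]
  · rintro j σ' t' hj ⟨g, rel, h1, -, -, h4⟩
    have := card_rel_le h1.search
    have : 70 * j ≤ 70 * I.n := by omega
    omega
  · rintro j σ' t' hj hF hx ⟨g, rel, h1, h2, h3, h4⟩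
    have e7 : σ'.nmem 7 = σ.nmem 7 := hF.nmem 7 rfl
    have er3 : σ'.nreg 3 = σ.nreg 3 := hF.nreg 3 rfl
    have hsj := hsrc j hj
    refine ⟨fun hb => ?_, fun hb => ?_⟩
    · simp [hx, e7, er3] at hb
      have hs := hsj.2 hb
      have hd0 : σ'.nmem 13 j = 0 := by
        rcases h1.search.search.zero_or_one j hj with h | h
        · exact h
        · have := (h2 j hj h).2; omega
      obtain ⟨d1, d2, d3, d4⟩ := h1.search.search.source hP.wf hj hs hd0 fun v hv h => (h2 v hv h).1
      set p : Program := (Program.nset 10 (.reg 23)).seq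
        ((Program.rput 3 (.reg 10) .zero).seq (.nput 13 (.reg 10) (.lit 1))) with hp
      have hp1 : wp B p (fun τ t'' => τ.nreg 10 = j ∧ StoresSearch I τ g rel ∧
          StoresProblem I adj τ ∧ τ.nmem 13 = update (σ'.nmem 13) j 1 ∧
          τ.rmem 3 = update (σ'.rmem 3) j 0 ∧ t'' ≤ t' + 18) σ' (t' + 9) := by
        refine wp_use (Q := fun τ t'' => τ.nreg 10 = j ∧ StoresSearch I τ g rel ∧
          τ.nmem 13 = update (σ'.nmem 13) j 1 ∧
          τ.rmem 3 = update (σ'.rmem 3) j 0 ∧ t'' ≤ t' + 18) ?_ ?_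
        · have a1 := h1.search.heap.inv
          have a2 := h1.search.heap.rank_le
          have a3 := h1.search.heap.reg_le
          simp [hp, hx]
          exact ⟨⟨by simpa using a1, by simpa using a2, by simpa using a3⟩, by simpa using d1⟩
        · rintro τ t'' hτ ⟨f1, f2, f3, f4, f5⟩
          exact ⟨f1, f2, h1.problem.of_frame hτ rfl, f3, f4, f5⟩
      change wp B p (wp B relaxAll _) σ' (t' + 9)
      refine wp_mono ?_ hp1
      rintro τ t'' ⟨f1, f2, f3, f4, f5, f6⟩
      refine wp_use (p := relaxAll) (wp_relaxAll (x := j) f3 f2 h1.lst f1 hj (by rw [f4]; simp)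
        (by rw [f4, f5]; exact d2) d3) ?_
      rintro ρ t₃ hρ ⟨g', rel', k1, k2, k3, k4, k5⟩
      have hF1 := frame_nset ρ 23 (.lit 0) (j + 1)
      have e13 : ρ.nmem 13 = update (σ'.nmem 13) j 1 := (hρ.nmem 13 rfl).trans f4
      have e3 : ρ.rmem 3 = update (σ'.rmem 3) j 0 := (hρ.rmem 3 rfl).trans f5
      refine ⟨g', rel', BetweenRounds.of_frame ⟨f3.of_frame hρ rfl, k1, k2, ?_⟩ hF1 rfl rfl rfl,
        ?_, ?_, ?_⟩
      · intro e he het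
        by_cases hej : I.tail e = j
        · exact k4 e he hej
        · rw [e13, update_of_ne hej] at het
          exact k3 e (h1.relaxed e he het)
      · intro v hv hv1
        change ρ.nmem 13 v = 1 at hv1
        rw [e13] at hv1
        refine ⟨d4 v hv hv1, ?_⟩
        by_cases hvj : v = j
        · omega
        · rw [update_of_ne hvj] at hv1
          have := (h2 v hv hv1).2
          omega
      · intro v hv hvs
        change ρ.nmem 13 v = 1 ∧ ρ.rmem 3 v = 0
        rw [e13, e3]
        by_cases hvj : v = j
        · subst hvj; simp
        · rw [update_of_ne hvj, update_of_ne hvj]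
          exact h3 v (by omega) hvs
      · omega
    · simp [hx, e7, er3] at hb
      have hF1 := frame_nset σ' 23 (.lit 0) (j + 1)
      refine ⟨g, rel, h1.of_frame hF1 rfl rfl rfl, fun v hv h => ?_, fun v hv hvs => ?_, ?_⟩
      · have := h2 v hv h
        exact ⟨this.1, by omega⟩
      · rcases Nat.lt_or_eq_of_le (Nat.lt_succ_iff.1 hv) with h | rfl
        · exact h3 v h hvs
        · exact absurd (hsj.1 hvs) hb
      · simp; omega
  · rintro τ t' - ⟨g, rel, h1, h2, h3, h4⟩
    exact ⟨g, rel, h1, h3, by simp; omega⟩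

theorem wp_dijkstra {B : ℕ} {I : SearchProblem} {adj : ℕ → List ℕ} (hBn : I.n < B)
    (hBm : 2 * I.m + 4 ≤ B) {σ : State} {t : ℕ} (hP : StoresProblem I adj σ)
    (hsrc : ∀ v < I.n, (I.src v ↔ σ.nmem 7 v = σ.nreg 3)) (hdone : ∀ v < I.n, σ.nmem 13 v = 0)
    (hcur : ∀ y, σ.nmem 12 y = 0) (hbkt : ∀ r, σ.nmem 17 r = 0) :
    wp B dijkstra (fun τ t' => I.Solved (τ.nmem 13) (τ.rmem 3) ∧ (∀ y, τ.nmem 12 y = 0) ∧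
      (∀ r, τ.nmem 17 r = 0) ∧
      t' ≤ t + 4000 * (I.m + (I.n + 1) * (Nat.log 2 I.m + 1))) σ t := by
  refine ⟨trivial, trivial, trivial, ?_⟩
  have f1 := frame_nset σ 14 (.lit 0) 0
  have f2 := frame_nset ⟨update σ.nreg 14 0, σ.rreg, σ.nmem, σ.rmem⟩ 15 (.lit 0) 0
  have f3 := frame_nset ⟨update (update σ.nreg 14 0) 15 0, σ.rreg, σ.nmem, σ.rmem⟩ 16 (.lit 0) 0
  have hP1 := ((hP.of_frame f1 rfl).of_frame f2 rfl).of_frame f3 rfl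
  refine wp_use (p := startSources) (wp_startSources hBn hP1 (by simpa using hsrc) hdone hcur hbkt
    (by simp) (by simp) (by simp)) ?_
  rintro σ₁ t₁ - ⟨g, rel, h1, h2, h3⟩
  refine ⟨trivial, ?_⟩
  -- The price of a round. A round finishes a vertex or clears register 21, and it is charged to
  -- `finished` or to `1 - nreg 21` in the invariant, so at most `I.n + 1` rounds are charged.
  set X := 1000 * (2 * Nat.log 2 I.m + 3) + 10 with hX
  have f4 := frame_nset σ₁ 21 (.lit 1) 1
  simp at h3
  refine wp_loop (fun σ' t' => ∃ g rel, BetweenRounds I adj σ' g rel ∧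
    (∀ v < I.n, I.src v → σ'.nmem 13 v = 1 ∧ σ'.rmem 3 v = 0) ∧
    (σ'.nreg 21 = 1 ∨ (σ'.nreg 21 = 0 ∧ (∀ y, σ'.nmem 12 y = 0) ∧ ∀ r, σ'.nmem 17 r = 0)) ∧
    t' + 100 * g.pot ≤ t + 50 + 70 * I.n + 1000 * rel.card +
      X * (finished I.n (σ'.nmem 13) + (1 - σ'.nreg 21)))
    (t + 50 + 70 * I.n + 1000 * I.m + X * (I.n + 1)) ?_ ?_ ?_ ?_
  · refine ⟨g, rel, h1.of_frame f4 rfl rfl rfl, h2, .inl (by simp), ?_⟩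
    simp
    omega
  · rintro σ' t' ⟨g, rel, a1, a2, a3, a4⟩
    have b1 := card_rel_le a1.search
    have b2 := finished_le I.n (σ'.nmem 13)
    have : X * (finished I.n (σ'.nmem 13) + (1 - σ'.nreg 21)) ≤ X * (I.n + 1) :=
      Nat.mul_le_mul_left _ (by omega)
    omega
  · rintro σ' t' hF ⟨g, rel, a1, a2, a3, a4⟩ hb
    simp at hb
    refine wp_use (p := round) (wp_round hBm a1 hb) ?_
    rintro τ t'' - ⟨g', rel', c1, c2, c3, c4⟩
    refine ⟨g', rel', c1, fun v hv hvs => c3 v hvs (a2 v hv hvs), ?_, ?_⟩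
    · rcases c2 with c2 | c2
      · exact .inr ⟨c2.1, c2.2.1, c2.2.2.1⟩
      · exact .inl c2.1
    · simp at c4
      have : X * (finished I.n (τ.nmem 13) + (1 - τ.nreg 21)) =
          X * (finished I.n (σ'.nmem 13) + (1 - σ'.nreg 21)) + X := by
        rw [hb]
        rcases c2 with c2 | c2
        · rw [c2.1, c2.2.2.2]; ring
        · rw [c2.1, c2.2]; ring
      omega
  · rintro τ t' hF ⟨g, rel, a1, a2, a3, a4⟩ hb
    simp at hb
    have a3 := a3.resolve_left hb
    have b1 := card_rel_le a1.search
    have b2 := finished_le I.n (τ.nmem 13)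
    have hS := a1.search.search
    refine ⟨⟨hS.zero_or_one, a2, fun e he het => ?_, hS.sound⟩, a3.2.1, a3.2.2, ?_⟩
    · rcases hS.closed e (a1.relaxed e he het) with h | h
      · exact h
      · exact absurd (a3.2.1 _) h.1
    · have : X * (finished I.n (τ.nmem 13) + (1 - τ.nreg 21)) ≤ X * (I.n + 1) :=
        Nat.mul_le_mul_left _ (by omega)
      have h5 : X * (I.n + 1) + 100 * (I.n + 1) ≤ 4000 * ((I.n + 1) * (Nat.log 2 I.m + 1)) := by
        rw [hX]; nlinarith [Nat.zero_le (I.n * Nat.log 2 I.m)]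
      simp
      rw [Nat.mul_add]
      omega

end dijkstra

end RealRAM


/-! ### Searches from all vertices of one level -/

namespace SearchProblem

theorem Reach.congr {I I' : SearchProblem} (hn : I.n = I'.n)
    (hs : ∀ v, v < I.n → I.src v → I'.src v)
    (he : ∀ e, I.Edge e → I'.Edge e ∧ I.tail e = I'.tail e ∧ I.head e = I'.head e ∧
      I.wt e = I'.wt e) {v : ℕ} {d : ℝ} (h : I.Reach v d) : I'.Reach v d := by
  induction h with
  | src v hv hsv => exact .src v (hn ▸ hv) (hs v hv hsv)
  | step e d _ hE ih =>
    obtain ⟨h1, h2, h3, h4⟩ := he e hE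
    rw [h2] at ih
    rw [h3, h4]
    exact .step e d ih h1

theorem Solved.congr {I I' : SearchProblem} {done : ℕ → ℕ} {D : ℕ → ℝ} (h : I.Solved done D)
    (hn : I.n = I'.n) (hs : ∀ v, v < I.n → (I.src v ↔ I'.src v))
    (he : ∀ e, I.Edge e ↔ I'.Edge e)
    (he' : ∀ e, I.Edge e → I.tail e = I'.tail e ∧ I.head e = I'.head e ∧ I.wt e = I'.wt e)
    (hw : I.WellFormed) (hp : ∀ v, v < I.n → I.pot v = I'.pot v) : I'.Solved done D := by
  refine ⟨hn ▸ h.zero_or_one, fun v hv hsv => ?_, fun e hE het => ?_, fun v hv hd => ?_⟩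
  · rw [← hn] at hv
    exact h.src v hv ((hs v hv).2 hsv)
  · have hE' := (he e).2 hE
    obtain ⟨h1, h2, h3⟩ := he' e hE'
    have h4 := h.closed e hE' (h1 ▸ het)
    rw [← h1, ← h2, ← h3]
    refine ⟨h4.1, fun hF => h4.2 fun f hf hfs => ?_⟩
    obtain ⟨h5, h6, h7⟩ := he' f hf
    have h8 := hF f ((he f).1 hf) (by rw [← h5, ← hs _ (hw f hf).1]; exact hfs)
    rw [← h5, ← h6, ← h7, ← hp _ (hw f hf).1, ← hp _ (hw f hf).2.1] at h8
    exact h8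
  · rw [← hn] at hv
    exact (h.sound v hv hd).congr hn (fun v hv => (hs v hv).1)
      fun e hE => ⟨(he e).1 hE, he' e hE⟩

end SearchProblem

namespace RealRAM

open HollowHeap Function

open Program in
/-- Prepares a search: the arrays `a` and `b` hold the tails and the heads of the edges, potentials
are negated if `s` holds. -/
def load (a b : ℕ) (s : Bool) : Program :=
  (forTo 22 (.reg 0) <|
    (nput 11 (.reg 22) (.lit 0)).seq <|
    (nput 13 (.reg 22) (.lit 0)).seq <|
    -- A potential that is feasible for a graph becomes feasible for the reversed graph when it is
    -- negated.
    rput 2 (.reg 22) (if s then .sub .zero (.get 5 (.reg 22)) else .get 5 (.reg 22))).seq <|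
  forTo 22 (.reg 1) <|
    (nset 17 (.add (.reg 22) (.lit 1))).seq <|
    (nput 8 (.reg 17) (.get a (.reg 22))).seq <|
    (nput 9 (.reg 17) (.get b (.reg 22))).seq <|
    branch (.and (.neq (.get 6 (.reg 17)) (.lit 1))
        (.and (.neg (.nlt (.get 7 (.get 8 (.reg 17))) (.reg 3)))
          (.nlt (.reg 3) (.get 7 (.get 9 (.reg 17))))))
      ((nput 10 (.reg 17) (.get 11 (.get 8 (.reg 17)))).seq <|
        nput 11 (.get 8 (.reg 17)) (.reg 17))
      skip

/-- The search from all vertices of level `d`, in the graph of the good edges between vertices of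
levels at least `d`. -/
def levelProblem (n m : ℕ) (tail head good lv : ℕ → ℕ) (wt pot : ℕ → ℝ) (d : ℕ) :
    SearchProblem where
  n := n
  m := m
  tail := tail
  head := head
  -- Heads are strictly deeper, so that no edge enters a source. Nothing is lost in the absence of
  -- negative cycles, as returning to the source cannot shorten a walk.
  ok e := good e = 1 ∧ d ≤ lv (tail e) ∧ d < lv (head e)
  wt := wt
  pot := pot
  src v := lv v = d

/-- A search. -/
def search (a b : ℕ) (s : Bool) : Program := (load a b s).seq dijkstra

section search

attribute [local simp] wp NExpr.val NExpr.Need NExpr.cost RExpr.val RExpr.cost Test.Holds Test.cost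
  State.setReg

/-- The stored problem is built from the contents of the arrays, which are controlled only on the
edges and the vertices. It therefore agrees with `levelProblem` only there, and `Solved.congr` has
to make the passage afterwards. -/
theorem wp_load {B n m a b d : ℕ} {s : Bool} {T H good lv : ℕ → ℕ} {w p : ℕ → ℝ}
    (hBn : n < B) (hBm : m + 1 < B) (ha : a < 2) (hb : b < 2) {σ : State} {t : ℕ}
    (hn : σ.nreg 0 = n) (hm : σ.nreg 1 = m) (hd : σ.nreg 3 = d)
    (hT : ∀ e, σ.nmem a (e - 1) = T e) (hH : ∀ e, σ.nmem b (e - 1) = H e)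
    (hw : ∀ e, σ.rmem 0 (e - 1) = w e) (hgood : σ.nmem 6 = good) (hlv : σ.nmem 7 = lv)
    (hp : ∀ v, (if s then - σ.rmem 5 v else σ.rmem 5 v) = p v)
    (hwf : (levelProblem n m T H good lv w p d).WellFormed)
    (hTn : ∀ e, 1 ≤ e → e ≤ m → T e < n) :
    wp B (load a b s) (fun τ t' => ∃ I adj, StoresProblem I adj τ ∧ I.n = n ∧ I.m = m ∧
      (∀ v, I.src v ↔ (levelProblem n m T H good lv w p d).src v) ∧
      (∀ e, I.Edge e ↔ (levelProblem n m T H good lv w p d).Edge e) ∧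
      (∀ e, I.Edge e → I.tail e = T e ∧ I.head e = H e ∧ I.wt e = w e) ∧
      (∀ v, v < n → I.pot v = p v) ∧ (∀ v < n, τ.nmem 13 v = 0) ∧ t' ≤ t + 60 * (n + m + 1)) σ t := by
  set L := levelProblem n m T H good lv w p d with hL
  have hb8 : b ≠ 8 := by omega
  refine wp_for (fun j σ' t' => (∀ v < j, σ'.nmem 11 v = 0 ∧ σ'.nmem 13 v = 0 ∧ σ'.rmem 2 v = p v) ∧
    t' ≤ t + 2 + 30 * j) n (t + 2 + 30 * n) hBn rfl ?_ ?_ ?_ ?_ ?_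
  · intro σ' hF
    exact (hF.nreg 0 rfl).trans hn
  · simp
  · rintro j σ' t' hj ⟨-, h⟩; omega
  · rintro j σ' t' hj hF hx ⟨h1, h2⟩
    have e5 : σ'.rmem 5 = σ.rmem 5 := hF.rmem 5 rfl
    have hpj := hp j
    have hv : RExpr.val ⟨σ'.nreg, σ'.rreg, update (update σ'.nmem 11 (update (σ'.nmem 11) j 0)) 13
        (update (σ'.nmem 13) j 0), σ'.rmem⟩ (if s = true then RExpr.zero.sub (RExpr.get 5 (NExpr.reg 22))
            else RExpr.get 5 (NExpr.reg 22)) = p j := by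
      rw [← hpj]; split_ifs <;> simp [e5, hx]
    have hc : (if s = true then RExpr.zero.sub (RExpr.get 5 (NExpr.reg 22))
            else RExpr.get 5 (NExpr.reg 22)).cost ≤ 4 := by
      split_ifs <;> simp
    simp [hx, hv]
    refine ⟨fun v hv => ?_, by omega⟩
    by_cases hvj : v = j
    · subst hvj; simp
    · simp [hvj]
      exact h1 v (by omega)
  rintro σ₁ t₁ hF₁ ⟨g1, g2⟩
  simp only [NExpr.cost]
  refine wp_for (fun j σ' t' => ∃ adj : ℕ → List ℕ,
      (∀ e, 1 ≤ e → e ≤ j → σ'.nmem 8 e = T e ∧ σ'.nmem 9 e = H e) ∧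
      (∀ x < n, Linked (σ'.nmem 10) (σ'.nmem 11 x) (adj x) ∧ (adj x).Nodup ∧
        ∀ e, e ∈ adj x ↔ 1 ≤ e ∧ e ≤ j ∧ L.ok e ∧ T e = x) ∧
      t' ≤ t + 10 + 30 * n + 50 * j) m (t + 10 + 30 * n + 50 * m) (by omega) rfl ?_ ?_ ?_ ?_ ?_
  · intro σ' hF
    exact (hF.nreg 1 rfl).trans ((hF₁.nreg 1 rfl).trans hm)
  · refine ⟨fun _ => [], ?_, ?_, ?_⟩
    · intro e h h'; omega
    · intro x hx
      refine ⟨?_, by simp, fun e => ?_⟩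
      · simpa [Linked] using (g1 x hx).1
      · simp; intros; omega
    · omega
  · rintro j σ' t' hj ⟨_, -, -, h⟩; omega
  · rintro j σ' t' hj hF hx ⟨adj, h1, h2, h3⟩
    have e6 : σ'.nmem 6 = good := (hF.nmem 6 rfl).trans ((hF₁.nmem 6 rfl).trans hgood)
    have e7 : σ'.nmem 7 = lv := (hF.nmem 7 rfl).trans ((hF₁.nmem 7 rfl).trans hlv)
    have er3 : σ'.nreg 3 = d := (hF.nreg 3 rfl).trans ((hF₁.nreg 3 rfl).trans hd)
    have ea : σ'.nmem a j = T (j + 1) := by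
      rw [hF.nmem a (by simp [Program.forTo, Program.writesNMem]; omega),
        hF₁.nmem a (by simp [Program.forTo, Program.writesNMem]; omega), ← hT]
      rfl
    have eb : σ'.nmem b j = H (j + 1) := by
      rw [hF.nmem b (by simp [Program.forTo, Program.writesNMem]; omega),
        hF₁.nmem b (by simp [Program.forTo, Program.writesNMem]; omega), ← hH]
      rfl
    simp [hx, e6, e7, er3, ea, eb, hb8]
    have hnew : ∀ e, 1 ≤ e → e ≤ j + 1 → update (σ'.nmem 8) (j + 1) (T (j + 1)) e = T e ∧
        update (σ'.nmem 9) (j + 1) (H (j + 1)) e = H e := by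
      intro e he he'
      by_cases hej : e = j + 1
      · subst hej; simp
      · simp [hej]
        exact h1 e he (by omega)
    refine ⟨by omega, fun k1 k2 k3 => ?_, fun hno => ?_⟩
    · have hok : L.ok (j + 1) := ⟨k1, k2, k3⟩
      have hTj := hTn (j + 1) (by omega) (by omega)
      refine ⟨hnew, ⟨update adj (T (j + 1)) ((j + 1) :: adj (T (j + 1))), ?_⟩, by omega⟩
      intro x hx
      obtain ⟨l1, l2, l3⟩ := h2 x hx
      have hnot : j + 1 ∉ adj x := fun h => by have := (l3 _).1 h; omega
      have hcongr : Linked (update (σ'.nmem 10) (j + 1) (σ'.nmem 11 (T (j + 1)))) (σ'.nmem 11 x)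
          (adj x) := l1.congr fun y hy => update_of_ne (by rintro rfl; exact hnot hy) _ _
      by_cases hxT : x = T (j + 1)
      · subst hxT
        simp only [update_self, Linked]
        refine ⟨⟨trivial, by omega, hcongr⟩, List.nodup_cons.2 ⟨hnot, l2⟩, fun e => ?_⟩
        rw [List.mem_cons, l3]
        constructor
        · rintro (rfl | h)
          · exact ⟨by omega, le_rfl, hok, rfl⟩
          · exact ⟨h.1, by omega, h.2.2⟩
        · rintro ⟨h4, h5, h6⟩
          by_cases h7 : e = j + 1
          · exact .inl h7
          · exact .inr ⟨h4, by omega, h6⟩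
      · rw [update_of_ne hxT, update_of_ne hxT]
        refine ⟨hcongr, l2, fun e => ?_⟩
        rw [l3]
        constructor
        · rintro h; exact ⟨h.1, by omega, h.2.2⟩
        · rintro ⟨h4, h5, h6⟩
          refine ⟨h4, ?_, h6⟩
          have : e ≠ j + 1 := by rintro rfl; exact hxT h6.2.symm
          omega
    · have hok : ¬ L.ok (j + 1) := fun h => (hno h.1 h.2.1).not_gt h.2.2
      refine ⟨hnew, ⟨adj, ?_⟩, by omega⟩
      intro x hx
      obtain ⟨l1, l2, l3⟩ := h2 x hx
      refine ⟨l1, l2, fun e => ?_⟩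
      rw [l3]
      constructor
      · rintro h; exact ⟨h.1, by omega, h.2.2⟩
      · rintro ⟨h4, h5, h6⟩
        refine ⟨h4, ?_, h6⟩
        have : e ≠ j + 1 := by rintro rfl; exact hok h6.1
        omega
  · rintro τ t' hF ⟨adj, h1, h2, h3⟩
    have hedge : ∀ e, L.Edge e → τ.nmem 8 e = T e ∧ τ.nmem 9 e = H e := fun e he => h1 e he.1 he.2.1
    have e2 : τ.rmem 2 = σ₁.rmem 2 := hF.rmem 2 rfl
    refine ⟨⟨n, m, τ.nmem 8, τ.nmem 9, L.ok, w, τ.rmem 2, L.src⟩, adj,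
      ⟨(hF.nreg 0 rfl).trans ((hF₁.nreg 0 rfl).trans hn), rfl, rfl, ?_, rfl, fun x hx => (h2 x hx).1,
        fun x hx => (h2 x hx).2.1, ?_, ?_⟩, rfl, rfl, fun _ => Iff.rfl, fun _ => Iff.rfl, ?_, ?_, ?_, ?_⟩
    · intro e
      rw [hF.rmem 0 rfl, hF₁.rmem 0 rfl, hw]
    · intro x hx e
      rw [(h2 x hx).2.2]
      constructor
      · rintro ⟨h4, h5, h6, h7⟩
        exact ⟨⟨h4, h5, h6⟩, by rw [← h7]; exact (h1 e h4 h5).1⟩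
      · rintro ⟨⟨h4, h5, h6⟩, h7⟩
        exact ⟨h4, h5, h6, by rw [← h7]; exact (h1 e h4 h5).1.symm⟩
    · intro e he
      have h5 := hwf e he
      have h6 := hedge e he
      change τ.nmem 8 e < n ∧ τ.nmem 9 e < n ∧ ¬ L.src (τ.nmem 9 e)
      rw [h6.1, h6.2]
      exact h5
    · intro e he
      exact ⟨(hedge e he).1, (hedge e he).2, rfl⟩
    · intro v hv
      change τ.rmem 2 v = p v
      rw [e2]
      exact (g1 v hv).2.2
    · intro v hv
      rw [hF.nmem 13 rfl]
      exact (g1 v hv).2.1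
    · simp
      omega

theorem wp_search {B n m a b d : ℕ} {s : Bool} {T H good lv : ℕ → ℕ} {w p : ℕ → ℝ}
    (hBn : n < B) (hBm : 2 * m + 4 ≤ B) (ha : a < 2) (hb : b < 2) {σ : State} {t : ℕ}
    (hn : σ.nreg 0 = n) (hm : σ.nreg 1 = m) (hd : σ.nreg 3 = d)
    (hT : ∀ e, σ.nmem a (e - 1) = T e) (hH : ∀ e, σ.nmem b (e - 1) = H e)
    (hw : ∀ e, σ.rmem 0 (e - 1) = w e) (hgood : σ.nmem 6 = good) (hlv : σ.nmem 7 = lv)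
    (hp : ∀ v, (if s then - σ.rmem 5 v else σ.rmem 5 v) = p v)
    (hTn : ∀ e, 1 ≤ e → e ≤ m → T e < n) (hHn : ∀ e, 1 ≤ e → e ≤ m → H e < n)
    (hcur : ∀ y, σ.nmem 12 y = 0) (hbkt : ∀ r, σ.nmem 17 r = 0) :
    wp B (search a b s) (fun τ t' =>
      (levelProblem n m T H good lv w p d).Solved (τ.nmem 13) (τ.rmem 3) ∧
      (∀ y, τ.nmem 12 y = 0) ∧ (∀ r, τ.nmem 17 r = 0) ∧
      t' ≤ t + 5000 * (m + (n + 1) * (Nat.log 2 m + 1))) σ t := by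
  have hwf : (levelProblem n m T H good lv w p d).WellFormed := fun e he =>
    ⟨hTn e he.1 he.2.1, hHn e he.1 he.2.1, fun h => by
      have h1 : d < lv (H e) := he.2.2.2.2
      have h2 : lv (H e) = d := h
      omega⟩
  refine wp_use (p := load a b s) (wp_load hBn (by omega) ha hb hn hm hd hT hH hw hgood hlv hp hwf
    hTn) ?_
  rintro τ t' hF ⟨I, adj, hP, rfl, rfl, hs, hE, hE', hpot, hdone, ht⟩
  refine wp_mono ?_ (wp_dijkstra hBn hBm hP ?_ hdone ?_ ?_)
  · rintro ρ t'' ⟨h1, h2, h3, h4⟩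
    refine ⟨h1.congr rfl (fun v _ => hs v) hE hE' hP.wf hpot, h2, h3, ?_⟩
    have : I.n + 1 ≤ (I.n + 1) * (Nat.log 2 I.m + 1) := Nat.le_mul_of_pos_right _ (by omega)
    generalize (I.n + 1) * (Nat.log 2 I.m + 1) = y at h4 this ⊢
    omega
  · intro v hv
    rw [hs, hF.nmem 7 rfl, hF.nreg 3 rfl, hlv, hd]
    rfl
  · rw [hF.nmem 12 rfl]; exact hcur
  · rw [hF.nmem 17 rfl]; exact hbkt

end search

end RealRAM


/-! ## Weighted walks and detours -/

/-- `Wk E x y L`: there is a walk from `x` to `y` of length `L`, where `E x y c` says that there is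
an edge from `x` to `y` of weight `c`. -/
inductive Wk {V : Type*} (E : V → V → ℝ → Prop) : V → V → ℝ → Prop
  | nil (x : V) : Wk E x x 0
  | cons {x y z : V} {c L : ℝ} : E x y c → Wk E y z L → Wk E x z (c + L)

namespace Wk

variable {V : Type*} {E E' : V → V → ℝ → Prop} {x y z : V} {c L L' : ℝ}

theorem mono (hE : ∀ x y c, E x y c → E' x y c) (h : Wk E x y L) : Wk E' x y L := by
  induction h with
  | nil x => exact .nil x
  | cons e _ ih => exact .cons (hE _ _ _ e) ih

theorem trans (h : Wk E x y L) (h' : Wk E y z L') : Wk E x z (L + L') := by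
  induction h with
  | nil x => simpa using h'
  | cons e _ ih => rw [add_assoc]; exact .cons e (ih h')

theorem single (h : E x y c) : Wk E x y c := by
  simpa using Wk.cons h (.nil y)

theorem snoc (h : Wk E x y L) (e : E y z c) : Wk E x z (L + c) := h.trans (.single e)

theorem reverse (h : Wk E x y L) : Wk (fun a b c => E b a c) y x L := by
  induction h with
  | nil x => exact .nil x
  | cons e _ ih => rw [add_comm]; exact ih.snoc e

theorem cast (h : Wk E x y L) (e : L = L') : Wk E x y L' := e ▸ h

/-- A walk is trivial or both of its ends are ends of edges. -/
theorem trivial_or (h : Wk E x y L) : (x = y ∧ L = 0) ∨ (∃ u c, E x u c) ∧ ∃ u c, E u y c := by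
  induction h with
  | nil x => exact .inl ⟨rfl, rfl⟩
  | cons e h ih =>
    refine .inr ⟨⟨_, _, e⟩, ?_⟩
    rcases ih with ⟨rfl, -⟩ | ⟨-, h'⟩
    · exact ⟨_, _, e⟩
    · exact h'

/-- A walk passes through a vertex where a given function on the vertices is minimal. -/
theorem exists_min (f : V → ℕ) (h : Wk E x y L) : ∃ u d L₁ L₂, f u = d ∧ L = L₁ + L₂ ∧
    Wk (fun a b c => E a b c ∧ d ≤ f a ∧ d ≤ f b) x u L₁ ∧
    Wk (fun a b c => E a b c ∧ d ≤ f a ∧ d ≤ f b) u y L₂ ∧ d ≤ f x ∧ d ≤ f y := by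
  induction h with
  | nil x => exact ⟨x, _, 0, 0, rfl, by simp, .nil x, .nil x, le_rfl, le_rfl⟩
  | @cons x y z c L e h ih =>
    obtain ⟨u, d, L₁, L₂, hu, rfl, h1, h2, h3, h4⟩ := ih
    by_cases hd : d ≤ f x
    · exact ⟨u, d, c + L₁, L₂, hu, by ring, .cons ⟨e, hd, h3⟩ h1, h2, hd, h4⟩
    · have hm : ∀ a b c, (E a b c ∧ d ≤ f a ∧ d ≤ f b) → (E a b c ∧ f x ≤ f a ∧ f x ≤ f b) :=
        fun a b c h => ⟨h.1, by omega, by omega⟩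
      exact ⟨x, f x, 0, c + (L₁ + L₂), rfl, by ring, .nil x,
        .cons ⟨e, le_rfl, by omega⟩ ((h1.mono hm).trans (h2.mono hm)), le_rfl, by omega⟩

/-- If the lengths of the walks from `x` to `y` are bounded below, then there is no negative cycle
on these walks. -/
theorem cycle_nonneg {C a b : ℝ} (h : Wk E z z c) (hC : ∀ L, Wk E x y L → C ≤ L) (ha : Wk E x z a)
    (hb : Wk E z y b) : 0 ≤ c := by
  have hk : ∀ k : ℕ, Wk E z z (k * c) := by
    intro k
    induction k with
    | zero => simpa using Wk.nil z
    | succ k ih => exact (ih.trans h).cast (by push_cast; ring)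
  by_contra hc
  push Not at hc
  -- So many rounds through a negative cycle would bring the length of the walk below `C`.
  obtain ⟨k, hk'⟩ := exists_nat_gt ((a + b - C) / (-c))
  have h1 := hC _ ((ha.trans (hk k)).trans hb)
  rw [div_lt_iff₀ (by linarith)] at hk'
  nlinarith

end Wk

/-- `P 0, …, P ℓ` is a shortest path with respect to the edges `E`, and `pre j` is the length of
its part up to `P j`. -/
structure ShortestPath {V : Type*} (E : V → V → ℝ → Prop) (P : ℕ → V) (ℓ : ℕ) (pre : ℕ → ℝ) :
    Prop where
  pre_zero : pre 0 = 0
  step : ∀ j < ℓ, ∃ c, E (P j) (P (j + 1)) c ∧ pre (j + 1) = pre j + c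
  weight_unique : ∀ x y c c', E x y c → E x y c' → c = c'
  le_length : ∀ L, Wk E (P 0) (P ℓ) L → pre ℓ ≤ L
  inj : ∀ i j, i ≤ ℓ → j ≤ ℓ → P i = P j → i = j

namespace ShortestPath

variable {V : Type*} {E : V → V → ℝ → Prop} {P : ℕ → V} {ℓ : ℕ} {pre : ℕ → ℝ}

/-- `x` lies on a walk from `P 0` to `P ℓ`. -/
def Relevant (E : V → V → ℝ → Prop) (P : ℕ → V) (ℓ : ℕ) (x : V) : Prop :=
  (∃ L, Wk E (P 0) x L) ∧ ∃ L, Wk E x (P ℓ) L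

/-- The edges that may be used by detours. -/
def Detour (E : V → V → ℝ → Prop) (P : ℕ → V) (ℓ : ℕ) (x y : V) (c : ℝ) : Prop :=
  -- Relevance of the ends excludes negative cycles, which may well exist elsewhere in the graph.
  -- All edges of the path are forbidden, so the same detours serve for every `i`.
  E x y c ∧ Relevant E P ℓ x ∧ Relevant E P ℓ y ∧ ∀ j < ℓ, ¬ (x = P j ∧ y = P (j + 1))

/-- The edges other than the `i`-th edge of the path. -/
def Avoid (E : V → V → ℝ → Prop) (P : ℕ → V) (i : ℕ) (x y : V) (c : ℝ) : Prop :=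
  E x y c ∧ ¬ (x = P i ∧ y = P (i + 1))

theorem Detour.toE {x y : V} {c : ℝ} (h : Detour E P ℓ x y c) : E x y c := h.1

/-- Keeping track of the tails of the edges shows later, by injectivity of `P`, that initial and
final parts of the path avoid a given edge between them. -/
theorem walk_part (hP : ShortestPath E P ℓ pre) {i : ℕ} : ∀ {j : ℕ}, i ≤ j → j ≤ ℓ →
    Wk (fun x y c => E x y c ∧ ∃ k, i ≤ k ∧ k < j ∧ x = P k) (P i) (P j) (pre j - pre i) := by
  intro j hij
  induction j, hij using Nat.le_induction with
  | base => intro _; simpa using Wk.nil (P i)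
  | succ j hij ih =>
    intro hj
    obtain ⟨c, hc, hc'⟩ := hP.step j (by omega)
    have := ((ih (by omega)).mono (E' := fun x y c => E x y c ∧ ∃ k, i ≤ k ∧ k < j + 1 ∧ x = P k)
      (fun x y c h => ⟨h.1, by obtain ⟨k, h1, h2, h3⟩ := h.2; exact ⟨k, h1, by omega, h3⟩⟩)).snoc
      ⟨hc, j, hij, by omega, rfl⟩
    exact this.cast (by rw [hc']; ring)

theorem walk (hP : ShortestPath E P ℓ pre) {i j : ℕ} (hij : i ≤ j) (hj : j ≤ ℓ) :
    Wk E (P i) (P j) (pre j - pre i) := (hP.walk_part hij hj).mono fun _ _ _ h => h.1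

theorem pre_le (hP : ShortestPath E P ℓ pre) {j : ℕ} (hj : j ≤ ℓ) {L : ℝ}
    (h : Wk E (P 0) (P j) L) : pre j ≤ L := by
  have := hP.le_length _ (h.trans (hP.walk hj le_rfl))
  linarith

theorem suf_le (hP : ShortestPath E P ℓ pre) {j : ℕ} (hj : j ≤ ℓ) {L : ℝ}
    (h : Wk E (P j) (P ℓ) L) : pre ℓ - pre j ≤ L := by
  have := hP.le_length _ ((hP.walk (Nat.zero_le j) hj).trans h)
  rw [hP.pre_zero] at this
  linarith

theorem cycle_nonneg (hP : ShortestPath E P ℓ pre) {x : V} (hx : Relevant E P ℓ x) {c : ℝ}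
    (h : Wk E x x c) : 0 ≤ c := by
  obtain ⟨⟨a, ha⟩, b, hb⟩ := hx
  exact h.cycle_nonneg hP.le_length ha hb

/-- The walk is followed while a detour from some `P a₀`, a₀ ≤ i, to the current vertex `x` is
maintained. If `x` is on the path beyond the missing edge, the rest is exchanged for the final part
of the path. If the next edge is an edge of the path, it lies before the missing one, and the detour
restarts at its head, since the initial part of the path up to `x` is at most as long as what was
traversed. Any other edge extends the detour. -/
theorem exists_detour_of_walk (hP : ShortestPath E P ℓ pre) {i : ℕ} (hi : i < ℓ) {x z : V} {L : ℝ}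
    (h : Wk (Avoid E P i) x z L) (hz : z = P ℓ) :
    ∀ {a₀ : ℕ} {L₀ : ℝ}, a₀ ≤ i → Wk (Detour E P ℓ) (P a₀) x L₀ →
    ∃ a b L', a ≤ i ∧ i < b ∧ b ≤ ℓ ∧ Wk (Detour E P ℓ) (P a) (P b) L' ∧
      pre a + L' + (pre ℓ - pre b) ≤ pre a₀ + L₀ + L := by
  induction h with
  | nil x =>
    subst hz
    intro a₀ L₀ ha h0
    exact ⟨a₀, ℓ, L₀, ha, hi, le_rfl, h0, by linarith⟩
  | @cons x y z c L e h ih =>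
    subst hz
    intro a₀ L₀ ha h0
    have h0' := h0.mono fun _ _ _ => Detour.toE
    have h' : Wk E y (P ℓ) L := h.mono fun _ _ _ h => h.1
    have hpre : Wk E (P 0) x (pre a₀ + L₀) := by
      have := (hP.walk (Nat.zero_le a₀) (by omega)).trans h0'
      rwa [hP.pre_zero, sub_zero] at this
    by_cases hb : ∃ b, i < b ∧ b ≤ ℓ ∧ x = P b
    · obtain ⟨b, h1, h2, rfl⟩ := hb
      have := hP.suf_le h2 (.cons e.1 h')
      exact ⟨a₀, b, L₀, ha, h1, h2, h0, by linarith⟩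
    by_cases hj : ∃ j, j < ℓ ∧ x = P j ∧ y = P (j + 1)
    · obtain ⟨j, hj, rfl, rfl⟩ := hj
      have hji : j < i := by
        by_contra hji
        rcases Nat.lt_or_ge i j with h1 | h1
        · exact hb ⟨j, h1, hj.le, rfl⟩
        · obtain rfl : j = i := by omega
          exact e.2 ⟨rfl, rfl⟩
      obtain ⟨a, b, L', h1, h2, h3, h4, h5⟩ := ih rfl (a₀ := j + 1) (L₀ := 0) (by omega) (.nil _)
      refine ⟨a, b, L', h1, h2, h3, h4, ?_⟩
      obtain ⟨c', hc', hc''⟩ := hP.step j hj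
      obtain rfl := hP.weight_unique _ _ _ _ e.1 hc'
      have := hP.pre_le hj.le hpre
      linarith
    · have hd : Detour E P ℓ x y c := by
        refine ⟨e.1, ⟨⟨_, hpre⟩, _, .cons e.1 h'⟩, ⟨⟨_, hpre.snoc e.1⟩, _, h'⟩, fun j hj' h => ?_⟩
        exact hj ⟨j, hj', h⟩
      obtain ⟨a, b, L', h1, h2, h3, h4, h5⟩ := ih rfl ha (h0.snoc hd)
      exact ⟨a, b, L', h1, h2, h3, h4, by linarith⟩

/-- A walk that avoids an edge of the path is at least as long as one that leaves the path only
once. -/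
theorem exists_detour (hP : ShortestPath E P ℓ pre) {i : ℕ} (hi : i < ℓ) {L : ℝ}
    (h : Wk (Avoid E P i) (P 0) (P ℓ) L) :
    ∃ a b L', a ≤ i ∧ i < b ∧ b ≤ ℓ ∧ Wk (Detour E P ℓ) (P a) (P b) L' ∧
      pre a + L' + (pre ℓ - pre b) ≤ L := by
  obtain ⟨a, b, L', h1, h2, h3, h4, h5⟩ := hP.exists_detour_of_walk hi h rfl (Nat.zero_le i) (.nil _)
  refine ⟨a, b, L', h1, h2, h3, h4, ?_⟩
  rw [hP.pre_zero] at h5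
  linarith

theorem walk_of_detour (hP : ShortestPath E P ℓ pre) {i a b : ℕ} (hi : i < ℓ) (ha : a ≤ i)
    (hb : i < b) (hb' : b ≤ ℓ) {L : ℝ} (h : Wk (Detour E P ℓ) (P a) (P b) L) :
    Wk (Avoid E P i) (P 0) (P ℓ) (pre a + L + (pre ℓ - pre b)) := by
  have h1 := (hP.walk_part (Nat.zero_le a) (by omega)).mono (E' := Avoid E P i) (by
    rintro x y c ⟨h, k, -, hk, rfl⟩
    refine ⟨h, fun h' => ?_⟩
    have := hP.inj _ _ (by omega) (by omega) h'.1
    omega)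
  have h2 := (hP.walk_part hb' le_rfl).mono (E' := Avoid E P i) (by
    rintro x y c ⟨h, k, hk, hk', rfl⟩
    refine ⟨h, fun h' => ?_⟩
    have := hP.inj _ _ (by omega) (by omega) h'.1
    omega)
  have h3 := h.mono (E' := Avoid E P i) (fun x y c h => ⟨h.1, h.2.2.2 i hi⟩)
  exact ((h1.trans h3).trans h2).cast (by rw [hP.pre_zero]; ring)

end ShortestPath

/-! ## Levels of an elimination forest -/

/-- `dep` is the depth and `par` the parent in a forest on `{0, …, n - 1}`, where `n` is the parent
of the roots. -/
structure Forest (n : ℕ) (par dep : ℕ → ℕ) : Prop where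
  -- The sentinel `n` has depth 0 and the roots depth 1, so that the depth increases by 1 at roots
  -- as well.
  dep_n : dep n = 0
  par_le : ∀ v < n, par v ≤ n
  dep_par : ∀ v < n, dep v = dep (par v) + 1

namespace Forest

variable {n : ℕ} {par dep : ℕ → ℕ}

/-- The ancestor at depth `d`. -/
def top (par dep : ℕ → ℕ) (d v : ℕ) : ℕ := par^[dep v - d] v

/-- One of two vertices is an ancestor of the other. -/
def Comparable (par dep : ℕ → ℕ) (x y : ℕ) : Prop :=
  ∃ j, (par^[j] x = y ∧ dep x = dep y + j) ∨ (par^[j] y = x ∧ dep y = dep x + j)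

theorem Comparable.symm {x y : ℕ} (h : Comparable par dep x y) : Comparable par dep y x :=
  h.imp fun _ => Or.symm

theorem iterate (hf : Forest n par dep) {v : ℕ} (hv : v < n) : ∀ {j : ℕ}, j < dep v →
    par^[j] v < n ∧ dep (par^[j] v) = dep v - j
  | 0, _ => ⟨hv, rfl⟩
  | j + 1, hj => by
      obtain ⟨h1, h2⟩ := hf.iterate hv (j := j) (by omega)
      rw [Function.iterate_succ_apply']
      have h3 := hf.dep_par _ h1
      have h4 := hf.par_le _ h1
      refine ⟨lt_of_le_of_ne h4 fun h => ?_, by omega⟩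
      rw [h, hf.dep_n] at h3
      omega

theorem dep_pos (hf : Forest n par dep) {v : ℕ} (hv : v < n) : 1 ≤ dep v := by
  rw [hf.dep_par v hv]; omega

theorem top_lt (hf : Forest n par dep) {v d : ℕ} (hv : v < n) (hd : 1 ≤ d) :
    top par dep d v < n := (hf.iterate hv (by have := hf.dep_pos hv; omega)).1

theorem dep_top (hf : Forest n par dep) {v d : ℕ} (hv : v < n) (hd : 1 ≤ d) (h : d ≤ dep v) :
    dep (top par dep d v) = d := by
  rw [top, (hf.iterate hv (by omega)).2]; omega

theorem top_self {v d : ℕ} (h : dep v = d) : top par dep d v = v := by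
  simp [top, h]

theorem top_succ {v d : ℕ} (h : d < dep v) : top par dep d v = par (top par dep (d + 1) v) := by
  rw [top, top, ← Function.iterate_succ_apply' par]
  congr 1; omega

/-- The way up from the deeper of the two vertices passes through the other. -/
theorem Comparable.top_eq {x y d : ℕ} (h : Comparable par dep x y) (hx : d ≤ dep x)
    (hy : d ≤ dep y) : top par dep d x = top par dep d y := by
  rcases h with ⟨j, ⟨h1, h2⟩ | ⟨h1, h2⟩⟩
  · rw [top, top, ← h1, ← Function.iterate_add_apply, h1]
    congr 1; omega
  · rw [top, top, ← h1, ← Function.iterate_add_apply, h1]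
    congr 1; omega

end Forest


open RealRAM

/-- The edges with the numbers `1, …, m` for which `good` is `1`. -/
def ListedEdge (m : ℕ) (T H good : ℕ → ℕ) (w : ℕ → ℝ) (x y : ℕ) (c : ℝ) : Prop :=
  ∃ e, 1 ≤ e ∧ e ≤ m ∧ good e = 1 ∧ T e = x ∧ H e = y ∧ w e = c

/-- A graph with listed edges and an elimination forest, without negative cycles. -/
structure Elimination (n m : ℕ) (T H par dep good : ℕ → ℕ) (w : ℕ → ℝ) : Prop where
  forest : Forest n par dep
  tail_lt : ∀ e, 1 ≤ e → e ≤ m → T e < n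
  head_lt : ∀ e, 1 ≤ e → e ≤ m → H e < n
  comparable : ∀ e, 1 ≤ e → e ≤ m → Forest.Comparable par dep (T e) (H e)
  cycle_nonneg : ∀ x c, Wk (ListedEdge m T H good w) x x c → 0 ≤ c

namespace Elimination

variable {n m d : ℕ} {T H par dep good : ℕ → ℕ} {w p : ℕ → ℝ}

theorem swap (h : Elimination n m T H par dep good w) : Elimination n m H T par dep good w := by
  refine ⟨h.forest, h.head_lt, h.tail_lt, fun e h1 h2 => (h.comparable e h1 h2).symm,
    fun x c hc => h.cycle_nonneg x c (hc.reverse.mono ?_)⟩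
  rintro x y c ⟨e, h1, h2, h3, h4, h5, h6⟩
  exact ⟨e, h1, h2, h3, h5, h4, h6⟩

/-- The good edges between vertices of depth at least `d`. -/
def LevelEdge (m : ℕ) (T H dep good : ℕ → ℕ) (w : ℕ → ℝ) (d x y : ℕ) (c : ℝ) : Prop :=
  ListedEdge m T H good w x y c ∧ d ≤ dep x ∧ d ≤ dep y

/-- Every edge joins comparable vertices, so a walk at depth at least `d` cannot leave the tree
below one vertex of depth `d`. This makes a search from all of level `d` a collection of independent
searches from one source each. -/
theorem top_eq_of_walk (h : Elimination n m T H par dep good w) {x y : ℕ} {L : ℝ}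
    (hw : Wk (LevelEdge m T H dep good w d) x y L) :
    Forest.top par dep d x = Forest.top par dep d y := by
  induction hw with
  | nil x => rfl
  | cons e _ ih =>
    obtain ⟨⟨e, h1, h2, h3, rfl, rfl, rfl⟩, h4, h5⟩ := e
    rw [← ih]
    exact (h.comparable e h1 h2).top_eq h4 h5

/-- A potential is feasible for the good edges between vertices of depth greater than `d`. -/
def FeasibleAbove (m : ℕ) (T H dep good : ℕ → ℕ) (w p : ℕ → ℝ) (d : ℕ) : Prop :=
  ∀ e, 1 ≤ e → e ≤ m → good e = 1 → d < dep (T e) → d < dep (H e) → p (H e) ≤ p (T e) + w e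

theorem FeasibleAbove.feasible (hp : FeasibleAbove m T H dep good w p d) :
    (levelProblem n m T H good dep w p d).Feasible := by
  rintro e ⟨h1, h2, h3, h4, h5⟩ h6
  have h7 : dep (T e) ≠ d := h6
  have := hp e h1 h2 h3 (lt_of_le_of_ne h4 h7.symm) h5
  change 0 ≤ w e + p (T e) - p (H e)
  linarith

theorem FeasibleAbove.feasible_swap (hp : FeasibleAbove m T H dep good w p d) :
    (levelProblem n m H T good dep w (fun v => - p v) d).Feasible := by
  rintro e ⟨h1, h2, h3, h4, h5⟩ h6
  have h7 : dep (H e) ≠ d := h6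
  have := hp e h1 h2 h3 h5 (lt_of_le_of_ne h4 h7.symm)
  change 0 ≤ w e + -p (H e) - -p (T e)
  linarith

section search

variable {done : ℕ → ℕ} {D : ℕ → ℝ}

/-- The search ignores edges into level `d`. If the walk uses such an edge, it returns to `u`, the
only vertex of that level in its tree, and has closed a cycle of nonnegative length, so starting
afresh from `u` with distance 0 is no loss. -/
theorem le_of_walk_aux (h : Elimination n m T H par dep good w)
    (hS : (levelProblem n m T H good dep w p d).Solved done D)
    (hF : (levelProblem n m T H good dep w p d).Feasible) {u x y : ℕ} {L : ℝ} (hu : dep u = d)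
    (hw : Wk (LevelEdge m T H dep good w d) x y L) :
    ∀ {L₀ : ℝ}, Wk (LevelEdge m T H dep good w d) u x L₀ → done x = 1 → D x ≤ L₀ →
      done y = 1 ∧ D y ≤ L₀ + L := by
  induction hw with
  | nil x => intro L₀ _ h1 h2; exact ⟨h1, by linarith⟩
  | cons e _ ih =>
    intro L₀ h0 h1 h2
    have h0' := h0.snoc e
    obtain ⟨⟨e, e1, e2, e3, rfl, rfl, rfl⟩, e4, e5⟩ := e
    rw [← add_assoc]
    rcases e5.lt_or_eq with h5 | h5
    · obtain ⟨h6, h7⟩ := hS.closed e ⟨e1, e2, e3, e4, h5⟩ h1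
      have h8 : D (H e) ≤ D (T e) + w e := h7 hF
      exact ih h0' h6 (by linarith)
    · obtain ⟨h6, h7⟩ := hS.src _ (h.head_lt e e1 e2) h5.symm
      have h8 := h.top_eq_of_walk h0'
      rw [Forest.top_self hu, Forest.top_self h5.symm] at h8
      subst h8
      have := h.cycle_nonneg _ _ (h0'.mono fun _ _ _ h => h.1)
      exact ih h0' h6 (by linarith)

/-- The computed distances are at most the lengths of walks. -/
theorem le_of_walk (h : Elimination n m T H par dep good w)
    (hS : (levelProblem n m T H good dep w p d).Solved done D)
    (hF : (levelProblem n m T H good dep w p d).Feasible) {u y : ℕ} {L : ℝ} (hun : u < n)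
    (hu : dep u = d) (hw : Wk (LevelEdge m T H dep good w d) u y L) : done y = 1 ∧ D y ≤ L := by
  obtain ⟨h1, h2⟩ := hS.src _ hun hu
  simpa using h.le_of_walk_aux hS hF hu hw (.nil u) h1 h2.le

theorem walk_of_reach {y : ℕ} {L : ℝ}
    (hr : (levelProblem n m T H good dep w p d).Reach y L) :
    d ≤ dep y ∧ ∃ u, dep u = d ∧ Wk (LevelEdge m T H dep good w d) u y L := by
  induction hr with
  | src v hv hs =>
    have hs' : dep v = d := hs
    exact ⟨hs'.ge, v, hs, .nil v⟩
  | step e L _ hE ih =>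
    obtain ⟨h1, u, hu, h2⟩ := ih
    obtain ⟨e1, e2, e3, e4, e5⟩ := hE
    exact ⟨e5.le, u, hu, h2.snoc ⟨⟨e, e1, e2, e3, rfl, rfl, rfl⟩, e4, e5.le⟩⟩

/-- The computed distances are lengths of walks. -/
theorem walk_of_done (h : Elimination n m T H par dep good w)
    (hS : (levelProblem n m T H good dep w p d).Solved done D) {y : ℕ} (hy : y < n)
    (hd : done y = 1) : d ≤ dep y ∧
      Wk (LevelEdge m T H dep good w d) (Forest.top par dep d y) y (D y) := by
  obtain ⟨h1, u, hu, h2⟩ := walk_of_reach (hS.sound y hy hd)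
  have h3 := h.top_eq_of_walk h2
  rw [Forest.top_self hu] at h3
  subst h3
  exact ⟨h1, h2⟩

/-- The potentials for the next level. -/
theorem feasibleAbove_step (h : Elimination n m T H par dep good w) (hd : 1 ≤ d)
    (hp : FeasibleAbove m T H dep good w p d)
    (hS : (levelProblem n m T H good dep w p d).Solved done D) {p' : ℕ → ℝ}
    (h0 : ∀ e, 1 ≤ e → e ≤ m → good e = 1 → dep (H e) = d → d < dep (T e) →
      p' (H e) ≤ p (T e) + w e)
    (h1 : ∀ v < n, d < dep v → p' v ≤ p v ∧
      (done v = 1 → p' v ≤ p' (Forest.top par dep d v) + D v) ∧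
      (p' v = p v ∨ done v = 1 ∧ p' v = p' (Forest.top par dep d v) + D v)) :
    FeasibleAbove m T H dep good w p' (d - 1) := by
  intro e e1 e2 e3 e4 e5
  have hT := h.tail_lt e e1 e2
  have hH := h.head_lt e e1 e2
  have e4' : d ≤ dep (T e) := by omega
  have e5' : d ≤ dep (H e) := by omega
  have htop := (h.comparable e e1 e2).top_eq e4' e5'
  have hE : LevelEdge m T H dep good w d (T e) (H e) (w e) :=
    ⟨⟨e, e1, e2, e3, rfl, rfl, rfl⟩, e4', e5'⟩
  -- In the tree below u the new potential of a vertex v deeper than u is the minimum of `p v` and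
  -- `p' u + D v`. If both ends are deeper than u, each of the two values at the tail bounds the
  -- corresponding one at the head. If the head is u, `h0` handles the old value, and otherwise `D
  -- (T e) + w e` is the length of a closed walk. If the tail is u, then `D (H e) ≤ w e`. If both
  -- ends are u, the edge is a loop.
  rcases e4'.lt_or_eq with hx | hx <;> rcases e5'.lt_or_eq with hy | hy
  · obtain ⟨a1, a2, a3⟩ := h1 _ hT hx
    obtain ⟨b1, b2, b3⟩ := h1 _ hH hy
    rcases a3 with a3 | ⟨a3, a4⟩
    · rw [a3]
      exact b1.trans (hp e e1 e2 e3 hx hy)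
    · obtain ⟨c1, c2⟩ := hS.closed e ⟨e1, e2, e3, e4', hy⟩ a3
      have c3 : D (H e) ≤ D (T e) + w e := c2 hp.feasible
      have := b2 c1
      rw [a4, htop]
      linarith
  · obtain ⟨a1, a2, a3⟩ := h1 _ hT hx
    rcases a3 with a3 | ⟨a3, a4⟩
    · rw [a3]; exact h0 e e1 e2 e3 hy.symm hx
    · obtain ⟨-, c1⟩ := h.walk_of_done hS hT a3
      have c2 := c1.snoc hE
      rw [htop, Forest.top_self hy.symm] at c2
      have := h.cycle_nonneg _ _ (c2.mono fun _ _ _ h => h.1)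
      rw [a4, htop, Forest.top_self hy.symm]
      linarith
  · obtain ⟨b1, b2, b3⟩ := h1 _ hH hy
    obtain ⟨s1, s2⟩ := hS.src _ hT hx.symm
    obtain ⟨c1, c2⟩ := hS.closed e ⟨e1, e2, e3, e4', hy⟩ s1
    have c3 : D (H e) ≤ D (T e) + w e := c2 hp.feasible
    have := b2 c1
    rw [← htop, Forest.top_self hx.symm] at this
    linarith
  · rw [Forest.top_self hx.symm, Forest.top_self hy.symm] at htop
    rw [← htop] at hE ⊢
    have := h.cycle_nonneg _ _ (Wk.single hE.1)
    linarith

end search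

/-- The lengths of the walks considered at level `d` that leave the path `P 0, …, P ℓ` before its
`i`-th edge. -/
def Candidate (dep tp : ℕ → ℕ) (P : ℕ → ℕ) (pre : ℕ → ℝ) (ℓ : ℕ) (bd : ℕ → ℕ) (D : ℕ → ℝ)
    (fd : ℕ → ℕ) (F : ℕ → ℝ) (d i : ℕ) (x : ℝ) : Prop :=
  ∃ a b, a ≤ i ∧ i < b ∧ b ≤ ℓ ∧ d ≤ dep (P a) ∧ d ≤ dep (P b) ∧ tp (P a) = tp (P b) ∧
    bd (P a) = 1 ∧ fd (P b) = 1 ∧ x = pre a + D (P a) + (F (P b) + (pre ℓ - pre b))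

section candidates

variable {bd fd : ℕ → ℕ} {D F : ℕ → ℝ} {P : ℕ → ℕ} {ℓ i : ℕ} {pre : ℕ → ℝ} {p' : ℕ → ℝ}

theorem walk_of_candidate (h : Elimination n m T H par dep good w)
    (hB : (levelProblem n m H T good dep w p' d).Solved bd D)
    (hF : (levelProblem n m T H good dep w p d).Solved fd F) (hP : ∀ j ≤ ℓ, P j < n)
    {x : ℝ} (hx : Candidate dep (Forest.top par dep d) P pre ℓ bd D fd F d i x) :
    ∃ a b L, a ≤ i ∧ i < b ∧ b ≤ ℓ ∧ Wk (ListedEdge m T H good w) (P a) (P b) L ∧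
      x = pre a + L + (pre ℓ - pre b) := by
  obtain ⟨a, b, h1, h2, h3, h4, h5, h6, h7, h8, rfl⟩ := hx
  have w1 := (h.swap.walk_of_done hB (hP a (by omega)) h7).2.reverse
  have w2 := (h.walk_of_done hF (hP b h3) h8).2
  rw [h6] at w1
  refine ⟨a, b, D (P a) + F (P b), h1, h2, h3, (w1.mono ?_).trans (w2.mono fun _ _ _ h => h.1),
    by ring⟩
  rintro x y c ⟨⟨e, h1, h2, h3, h4, h5, h6⟩, -, -⟩
  exact ⟨e, h1, h2, h3, h5, h4, h6⟩

/-- The vertex `u` is the ancestor of depth `d` of both `P a` and `P b`, and the two searches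
provide distances to and from it that are at most `L₁` and `L₂`. -/
theorem exists_candidate (h : Elimination n m T H par dep good w) (hd : 1 ≤ d)
    (hp : FeasibleAbove m T H dep good w p d)
    (hB : (levelProblem n m H T good dep w (fun v => - p v) d).Solved bd D)
    (hF : (levelProblem n m T H good dep w p d).Solved fd F) (hP : ∀ j ≤ ℓ, P j < n)
    {a b u : ℕ} {L₁ L₂ : ℝ} (ha : a ≤ i) (hb : i < b) (hbl : b ≤ ℓ) (hu : dep u = d)
    (hda : d ≤ dep (P a)) (hdb : d ≤ dep (P b))
    (h₁ : Wk (LevelEdge m T H dep good w d) (P a) u L₁)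
    (h₂ : Wk (LevelEdge m T H dep good w d) u (P b) L₂) :
    ∃ x, Candidate dep (Forest.top par dep d) P pre ℓ bd D fd F d i x ∧
      x ≤ pre a + (L₁ + L₂) + (pre ℓ - pre b) := by
  have ht := h.top_eq_of_walk h₁
  rw [Forest.top_self hu] at ht
  have hun : u < n := ht ▸ h.forest.top_lt (hP a (by omega)) hd
  obtain ⟨b1, b2⟩ := h.swap.le_of_walk hB hp.feasible_swap hun hu (h₁.reverse.mono (by
    rintro x y c ⟨⟨e, h1, h2, h3, h4, h5, h6⟩, h7, h8⟩
    exact ⟨⟨e, h1, h2, h3, h5, h4, h6⟩, h8, h7⟩))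
  obtain ⟨f1, f2⟩ := h.le_of_walk hF hp.feasible hun hu h₂
  refine ⟨_, ⟨a, b, ha, hb, hbl, hda, hdb, ?_, b1, f1, rfl⟩, by linarith⟩
  rw [h.top_eq_of_walk h₁, h.top_eq_of_walk h₂]

end candidates

end Elimination


/-! ## Minima of sets of reals -/

/-- `f` is `1` and `r` is the minimum of `S`, or `f` is `0` and `S` is empty. -/
def MinOf (f : ℕ) (r : ℝ) (S : ℝ → Prop) : Prop :=
  (f = 0 ∧ ∀ x, ¬ S x) ∨ (f = 1 ∧ S r ∧ ∀ x, S x → r ≤ x)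

namespace MinOf

variable {f : ℕ} {r c : ℝ} {S S' : ℝ → Prop}

theorem congr (h : MinOf f r S) (hS : ∀ x, S x ↔ S' x) : MinOf f r S' := by
  rwa [show S' = S from funext fun x => propext (hS x).symm]

theorem keep (h : MinOf f r S) (hf : f = 1) (hc : r ≤ c) : MinOf f r fun x => S x ∨ x = c := by
  rcases h with ⟨h, -⟩ | ⟨h1, h2, h3⟩
  · omega
  · refine .inr ⟨h1, .inl h2, ?_⟩
    rintro x (hx | rfl)
    · exact h3 x hx
    · exact hc

theorem put (h : MinOf f r S) (hc : f = 1 → c < r) : MinOf 1 c fun x => S x ∨ x = c := by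
  refine .inr ⟨rfl, .inr rfl, ?_⟩
  rintro x (hx | rfl)
  · rcases h with ⟨-, h⟩ | ⟨h1, -, h3⟩
    · exact (h x hx).elim
    · exact (hc h1).le.trans (h3 x hx)
  · exact le_rfl

end MinOf

/-! ## Tournament trees -/

/-- Node `i` of a tournament tree holds the minimum of the values at its children `2 i` and
`2 i + 1`. -/
def TreeNode (f : ℕ → ℕ) (r : ℕ → ℝ) (i : ℕ) : Prop :=
  ∃ c, (c = 2 * i ∨ c = 2 * i + 1) ∧ f i = f c ∧ (f i = 1 → r i = r c) ∧
    ∀ c', (c' = 2 * i ∨ c' = 2 * i + 1) → f c' = 1 → f c = 1 ∧ r c ≤ r c'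

/-- A tournament tree with leaves `n, …, 2 n - 1`. -/
def Tournament (n : ℕ) (f : ℕ → ℕ) (r : ℕ → ℝ) : Prop := ∀ i, 1 ≤ i → i < n → TreeNode f r i

namespace Tournament

variable {n : ℕ} {f : ℕ → ℕ} {r : ℕ → ℝ}

/-- Climb by halving the index. The number of leaves need not be a power of two: both children of a
node below `n` are below `2 n`, and for `n = 1` the root is the only leaf. -/
theorem root_le (h : Tournament n f r) : ∀ {i : ℕ}, 1 ≤ i → i < 2 * n → f i = 1 →
    f 1 = 1 ∧ r 1 ≤ r i := by
  intro i
  induction i using Nat.strong_induction_on with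
  | _ i ih =>
    intro h1 h2 h3
    by_cases hi : i = 1
    · subst hi; exact ⟨h3, le_rfl⟩
    · obtain ⟨c, -, h5, h6, h7⟩ := h (i / 2) (by omega) (by omega)
      obtain ⟨h8, h9⟩ := h7 i (by omega) h3
      obtain ⟨h10, h11⟩ := ih (i / 2) (by omega) (by omega) (by omega) (h5.trans h8)
      exact ⟨h10, h11.trans ((h6 (h5.trans h8)).trans_le h9)⟩

theorem exists_leaf (h : Tournament n f r) : ∀ (k : ℕ) {i : ℕ}, 2 * n ≤ i + k → 1 ≤ i → i < 2 * n →
    f i = 1 → ∃ u < n, f (n + u) = 1 ∧ r (n + u) = r i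
  | 0, i, hk, _, h2, _ => by omega
  | k + 1, i, hk, h1, h2, h3 => by
      by_cases hi : n ≤ i
      · obtain ⟨u, rfl⟩ := Nat.exists_eq_add_of_le hi
        exact ⟨u, by omega, h3, rfl⟩
      · obtain ⟨c, h4, h5, h6, -⟩ := h i h1 (by omega)
        rw [h6 h3]
        exact h.exists_leaf k (by omega) (by omega) (by omega) (h5 ▸ h3)

end Tournament

namespace RealRAM

open Function

open Program in
/-- Replaces entry `y` of the array `r`, which is valid if entry `y` of `f` is `1`, by its minimum
with `c`, where `y` is in a register. -/
def minPut (f r y : ℕ) (c : RExpr) : Program :=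
  branch (.and (.neq (.get f (.reg y)) (.lit 1)) (.neg (.rlt c (.get r (.reg y))))) skip
    ((rput r (.reg y) c).seq (nput f (.reg y) (.lit 1)))

open Program in
/-- Recomputes the leaf of the tournament tree in array 12 for the vertex in register 33, and its
ancestors. -/
def treeUpdate : Program :=
  (nset 34 (.add (.reg 0) (.reg 33))).seq <|
  (branch (.and (.neq (.get 21 (.reg 33)) (.lit 1)) (.neq (.get 22 (.reg 33)) (.lit 1)))
    ((nput 24 (.reg 34) (.lit 1)).seq <|
      rput 12 (.reg 34) (.add (.get 9 (.reg 33)) (.get 10 (.reg 33))))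
    (nput 24 (.reg 34) (.lit 0))).seq <|
  (nset 34 (.div (.reg 34) (.lit 2))).seq <|
  loop (.neg (.neq (.reg 34) (.lit 0))) <|
    (nset 35 (.add (.reg 34) (.reg 34))).seq <|
    (branch (.and (.neq (.get 24 (.reg 35)) (.lit 1))
        (.neg (.and (.neq (.get 24 (.add (.reg 35) (.lit 1))) (.lit 1))
          (.rlt (.get 12 (.add (.reg 35) (.lit 1))) (.get 12 (.reg 35)))))) skip
      (nset 35 (.add (.reg 35) (.lit 1)))).seq <|
    (nput 24 (.reg 34) (.get 24 (.reg 35))).seq <|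
    (rput 12 (.reg 34) (.get 12 (.reg 35))).seq <|
    nset 34 (.div (.reg 34) (.lit 2))

section

attribute [local simp] wp NExpr.val NExpr.Need NExpr.cost RExpr.val RExpr.cost Test.Holds Test.cost
  State.setReg

/-- Both branches are covered at once by letting the old entry count as rewritten. All that is kept
is how `MinOf` is transferred, for every set that the entry may represent. The expression `c` is
evaluated up to twice. -/
theorem wp_minPut {B f r y : ℕ} {c : RExpr} {Q : State → ℕ → Prop} {σ : State} {t : ℕ}
    (hQ : ∀ t' f' r', t' ≤ t + 2 * c.cost + 20 →
      (∀ S, MinOf (σ.nmem f (σ.nreg y)) (σ.rmem r (σ.nreg y)) S →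
        MinOf f' r' fun x => S x ∨ x = c.val σ) →
      Q ⟨σ.nreg, σ.rreg, update σ.nmem f (update (σ.nmem f) (σ.nreg y) f'),
        update σ.rmem r (update (σ.rmem r) (σ.nreg y) r')⟩ t') :
    wp B (minPut f r y c) Q σ t := by
  simp [minPut]
  refine ⟨fun h1 h2 => ?_, fun h => ?_⟩
  · have := hQ (t + (2 + 1 + 1 + (c.cost + 2 + 1 + 1) + 1 + 1) + 1) (σ.nmem f (σ.nreg y)) (σ.rmem r (σ.nreg y)) (by omega)
      fun S hS => hS.keep h1 h2
    simpa using this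
  · refine hQ _ _ _ (by omega) fun S hS => hS.put h

theorem wp_treeUpdate {B n u : ℕ} (hn2 : 2 * n < B) {σ : State} {t : ℕ}
    (hn : σ.nreg 0 = n) (hu : σ.nreg 33 = u) (hun : u < n)
    (htree : Tournament n (σ.nmem 24) (σ.rmem 12)) :
    wp B treeUpdate (fun τ t' => Tournament n (τ.nmem 24) (τ.rmem 12) ∧
      (∀ v < n, v ≠ u → τ.nmem 24 (n + v) = σ.nmem 24 (n + v) ∧
        τ.rmem 12 (n + v) = σ.rmem 12 (n + v)) ∧
      (τ.nmem 24 (n + u) = 1 ↔ σ.nmem 21 u = 1 ∧ σ.nmem 22 u = 1) ∧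
      (τ.nmem 24 (n + u) = 1 → τ.rmem 12 (n + u) = σ.rmem 9 u + σ.rmem 10 u) ∧
      t' ≤ t + 100 * (Nat.log 2 n + 3)) σ t := by
  -- The way up after the leaf has been rewritten: all inner nodes except the current one are
  -- correct, and repairing it can spoil only its parent.
  have hbody : ∀ (σ' : State) (t₀ : ℕ), σ'.nreg 34 = (n + u) / 2 →
      (∀ i, 1 ≤ i → i < n → i ≠ (n + u) / 2 → TreeNode (σ'.nmem 24) (σ'.rmem 12) i) →
      (∀ v < n, v ≠ u → σ'.nmem 24 (n + v) = σ.nmem 24 (n + v) ∧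
        σ'.rmem 12 (n + v) = σ.rmem 12 (n + v)) →
      (σ'.nmem 24 (n + u) = 1 ↔ σ.nmem 21 u = 1 ∧ σ.nmem 22 u = 1) →
      (σ'.nmem 24 (n + u) = 1 → σ'.rmem 12 (n + u) = σ.rmem 9 u + σ.rmem 10 u) →
      t₀ ≤ t + 50 → 
      wp B (.loop (.neg (.neq (.reg 34) (.lit 0))) <|
    (Program.nset 35 (.add (.reg 34) (.reg 34))).seq <|
    (Program.branch (.and (.neq (.get 24 (.reg 35)) (.lit 1))
        (.neg (.and (.neq (.get 24 (.add (.reg 35) (.lit 1))) (.lit 1))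
          (.rlt (.get 12 (.add (.reg 35) (.lit 1))) (.get 12 (.reg 35)))))) .skip
      (.nset 35 (.add (.reg 35) (.lit 1)))).seq <|
    (Program.nput 24 (.reg 34) (.get 24 (.reg 35))).seq <|
    (Program.rput 12 (.reg 34) (.get 12 (.reg 35))).seq <|
    .nset 34 (.div (.reg 34) (.lit 2))) (fun τ t' => Tournament n (τ.nmem 24) (τ.rmem 12) ∧
      (∀ v < n, v ≠ u → τ.nmem 24 (n + v) = σ.nmem 24 (n + v) ∧
        τ.rmem 12 (n + v) = σ.rmem 12 (n + v)) ∧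
      (τ.nmem 24 (n + u) = 1 ↔ σ.nmem 21 u = 1 ∧ σ.nmem 22 u = 1) ∧
      (τ.nmem 24 (n + u) = 1 → τ.rmem 12 (n + u) = σ.rmem 9 u + σ.rmem 10 u) ∧
      t' ≤ t + 100 * (Nat.log 2 n + 3)) σ' t₀ := by
    intro σ' t₀ hx h1 h2 h3 h4 ht
    refine wp_loop (fun τ t' => τ.nreg 34 < n ∧
      (∀ i, 1 ≤ i → i < n → i ≠ τ.nreg 34 → TreeNode (τ.nmem 24) (τ.rmem 12) i) ∧
      (∀ v < n, τ.nmem 24 (n + v) = σ'.nmem 24 (n + v) ∧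
        τ.rmem 12 (n + v) = σ'.rmem 12 (n + v)) ∧
      -- With the factor 2 the logarithm drops in the last round as well, when the index goes from 1
      -- to 0.
      t' + 100 * Nat.log 2 (2 * τ.nreg 34) ≤ t + 50 + 100 * Nat.log 2 (2 * n))
      (t + 50 + 100 * Nat.log 2 (2 * n)) ⟨by omega, ?_, ?_, ?_⟩ ?_ ?_ ?_
    · rw [hx]; exact h1
    · exact fun v _ => ⟨rfl, rfl⟩
    · have : Nat.log 2 (2 * σ'.nreg 34) ≤ Nat.log 2 (2 * n) := Nat.log_mono_right (by omega)
      omega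
    · rintro τ t' ⟨-, -, -, h⟩; omega
    · rintro τ t' hF ⟨i1, i2, i3, i4⟩ hb
      generalize hx' : τ.nreg 34 = x at *
      have hx0 : x ≠ 0 := by simpa [hx'] using hb
      have hlog : Nat.log 2 (2 * (x / 2)) + 1 ≤ Nat.log 2 (2 * x) := by
        rw [show 2 * x = x * 2 by ring, Nat.log_mul_base (by omega) hx0]
        have := Nat.log_mono_right (b := 2) (show 2 * (x / 2) ≤ x by omega)
        omega
      have key : ∀ c, (c = 2 * x ∨ c = 2 * x + 1) →
          (∀ c', (c' = 2 * x ∨ c' = 2 * x + 1) → τ.nmem 24 c' = 1 →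
            τ.nmem 24 c = 1 ∧ τ.rmem 12 c ≤ τ.rmem 12 c') →
          (∀ i, 1 ≤ i → i < n → i ≠ x / 2 → TreeNode (update (τ.nmem 24) x (τ.nmem 24 c))
            (update (τ.rmem 12) x (τ.rmem 12 c)) i) ∧
          (∀ v < n, update (τ.nmem 24) x (τ.nmem 24 c) (n + v) = σ'.nmem 24 (n + v) ∧
            update (τ.rmem 12) x (τ.rmem 12 c) (n + v) = σ'.rmem 12 (n + v)) := by
        intro c hc hmin
        refine ⟨fun i hi hi' hix => ?_, fun v hv => ?_⟩
        · by_cases hxi : i = x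
          · subst hxi
            refine ⟨c, hc, ?_⟩
            rw [update_self, update_self, update_of_ne (by omega), update_of_ne (by omega)]
            refine ⟨rfl, fun _ => rfl, fun c' hc' => ?_⟩
            rw [update_of_ne (by omega), update_of_ne (by omega)]
            exact hmin c' hc'
          · obtain ⟨c₁, k1, k2, k3, k4⟩ := i2 i hi hi' hxi
            refine ⟨c₁, k1, ?_⟩
            rw [update_of_ne hxi, update_of_ne hxi, update_of_ne (by omega), update_of_ne (by omega)]
            refine ⟨k2, k3, fun c' hc' => ?_⟩
            rw [update_of_ne (by omega), update_of_ne (by omega)]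
            exact k4 c' hc'
        · rw [update_of_ne (by omega), update_of_ne (by omega)]
          exact i3 v hv
      have hxx : x + x = 2 * x := by ring
      simp [hx', hxx]
      refine ⟨by omega, fun k1 k2 => ?_, fun k1 => ⟨by omega, ?_⟩⟩
      · obtain ⟨a1, a2⟩ := key (2 * x) (.inl rfl) (by
          rintro c' (rfl | rfl) hc'
          · exact ⟨k1, le_rfl⟩
          · exact ⟨k1, k2 hc'⟩)
        exact ⟨by omega, a1, a2, by omega⟩
      · obtain ⟨a1, a2⟩ := key (2 * x + 1) (.inr rfl) (by
          rintro c' (rfl | rfl) hc'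
          · exact ⟨(k1 hc').1, (k1 hc').2.le⟩
          · exact ⟨hc', le_rfl⟩)
        exact ⟨by omega, a1, a2, by omega⟩
    · rintro τ t' hF ⟨i1, i2, i3, i4⟩ hb
      have hx0 : τ.nreg 34 = 0 := by simpa using hb
      rw [hx0] at i2
      refine ⟨fun i hi hi' => i2 i hi hi' (by omega), fun v hv hvu => ?_, ?_, ?_, ?_⟩
      · rw [(i3 v hv).1, (i3 v hv).2]; exact h2 v hv hvu
      · rw [(i3 u hun).1]; exact h3
      · rw [(i3 u hun).1, (i3 u hun).2]; exact h4
      · have : Nat.log 2 (2 * n) = Nat.log 2 n + 1 := by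
          rw [mul_comm, Nat.log_mul_base (by omega) (by omega)]
        simp
        omega
  have hnode : ∀ (f : ℕ → ℕ) (r : ℕ → ℝ), (∀ j, j ≠ n + u → f j = σ.nmem 24 j) →
      (∀ j, j ≠ n + u → r j = σ.rmem 12 j) → ∀ i, 1 ≤ i → i < n → i ≠ (n + u) / 2 →
      TreeNode f r i := by
    intro f r hf hr i h1 h2 h3
    obtain ⟨c₁, k1, k2, k3, k4⟩ := htree i h1 h2
    refine ⟨c₁, k1, ?_⟩
    rw [hf _ (by omega), hr _ (by omega), hf _ (by omega), hr _ (by omega)]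
    refine ⟨k2, k3, fun c' hc' => ?_⟩
    rw [hf _ (by omega), hr _ (by omega)]
    exact k4 c' hc'
  unfold treeUpdate
  change wp _ (.nset _ _) (wp _ (.branch _ _ _) (wp _ (.nset _ _) (wp _ (.loop _ _) _))) _ _
  generalize hl : Program.loop (.neg (.neq (.reg 34) (.lit 0))) _ = p at hbody ⊢
  simp [hn, hu]
  refine ⟨by omega, fun a1 a2 => ?_, fun a1 => ?_⟩
  · refine hbody _ _ (by simp) (hnode _ _ ?_ ?_) ?_ ?_ ?_ (by omega)
    · intro j hj; simp [hj]
    · intro j hj; simp [hj]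
    · intro v hv hvu; simp [hvu]
    · simp [a1, a2]
    · simp
  · refine hbody _ _ (by simp) (hnode _ _ ?_ ?_) ?_ ?_ ?_ (by omega)
    · intro j hj; simp [hj]
    · intro j hj; simp
    · intro v hv hvu; simp [hvu]
    · simpa using a1
    · simp

end

end RealRAM


/-! ### Combining ways to leave the path with ways to return to it -/

/-- The lengths `g a` for those `a` in `I` for which `P a` belongs to the tree below `u` at level
`d`, and is marked by `f`. -/
def Portion (dep tp : ℕ → ℕ) (P : ℕ → ℕ) (f : ℕ → ℕ) (g : ℕ → ℝ) (d u : ℕ) (I : ℕ → Prop) (x : ℝ) :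
    Prop :=
  ∃ a, I a ∧ d ≤ dep (P a) ∧ tp (P a) = u ∧ f (P a) = 1 ∧ x = g a

theorem Portion.insert {dep tp P f : ℕ → ℕ} {g : ℕ → ℝ} {d u b : ℕ} {I I' : ℕ → Prop} {x : ℝ}
    (hI : ∀ a, I' a ↔ I a ∨ a = b) (hd : d ≤ dep (P b)) (hu : tp (P b) = u) (hf : f (P b) = 1) :
    (Portion dep tp P f g d u I x ∨ x = g b) ↔ Portion dep tp P f g d u I' x := by
  constructor
  · rintro (⟨a, h1, h2, h3, h4, rfl⟩ | rfl)
    · exact ⟨a, (hI a).2 (.inl h1), h2, h3, h4, rfl⟩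
    · exact ⟨b, (hI b).2 (.inr rfl), hd, hu, hf, rfl⟩
  · rintro ⟨a, h1, h2, h3, h4, rfl⟩
    rcases (hI a).1 h1 with h | rfl
    · exact .inl ⟨a, h, h2, h3, h4, rfl⟩
    · exact .inr rfl

theorem Portion.congr {dep tp P f : ℕ → ℕ} {g : ℕ → ℝ} {d u b : ℕ} {I I' : ℕ → Prop} {x : ℝ}
    (hI : ∀ a, I' a ↔ I a ∨ a = b) (h : ¬ (d ≤ dep (P b) ∧ tp (P b) = u ∧ f (P b) = 1)) :
    Portion dep tp P f g d u I x ↔ Portion dep tp P f g d u I' x := by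
  constructor
  · rintro ⟨a, h1, h2⟩
    exact ⟨a, (hI a).2 (.inl h1), h2⟩
  · rintro ⟨a, h1, h2, h3, h4, rfl⟩
    rcases (hI a).1 h1 with h' | rfl
    · exact ⟨a, h', h2, h3, h4, rfl⟩
    · exact (h ⟨h2, h3, h4⟩).elim

theorem MinOf.union {f : ℕ} {r c : ℝ} {S S' : ℝ → Prop} (h : MinOf f r fun x => S x ∨ x = c)
    (h1 : S' c) (h2 : ∀ x, S' x → c ≤ x) : MinOf f r fun x => S x ∨ S' x := by
  rcases h with ⟨-, h⟩ | ⟨h3, h4, h5⟩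
  · exact (h c (.inr rfl)).elim
  · refine .inr ⟨h3, h4.imp id ?_, ?_⟩
    · rintro rfl; exact h1
    · rintro x (hx | hx)
      · exact h5 x (.inl hx)
      · exact (h5 c (.inr rfl)).trans (h2 x hx)

/-- The sums of an element of `A u` and an element of `A' u`, for some `u`. -/
def SumsBelow (n : ℕ) (A A' : ℕ → ℝ → Prop) (x : ℝ) : Prop :=
  ∃ u < n, ∃ x₁ x₂, A u x₁ ∧ A' u x₂ ∧ x = x₁ + x₂

/-- The leaves of a tournament tree hold sums of minima. -/
def LeafSums (n : ℕ) (f : ℕ → ℕ) (r : ℕ → ℝ) (fa fb : ℕ → ℕ) (ra rb : ℕ → ℝ) : Prop :=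
  ∀ u < n, (f (n + u) = 1 ↔ fa u = 1 ∧ fb u = 1) ∧ (f (n + u) = 1 → r (n + u) = ra u + rb u)

/-- For each `u` the least sum is the sum of the two minima, and the root holds the least of these
over all `u`. -/
theorem Tournament.root {n : ℕ} {f fa fb : ℕ → ℕ} {r ra rb : ℕ → ℝ} {A A' : ℕ → ℝ → Prop}
    (h : Tournament n f r) (hl : LeafSums n f r fa fb ra rb)
    (ha : ∀ u < n, MinOf (fa u) (ra u) (A u)) (hb : ∀ u < n, MinOf (fb u) (rb u) (A' u)) :
    (f 1 = 1 → 1 ≤ n → SumsBelow n A A' (r 1)) ∧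
      ∀ x, SumsBelow n A A' x → f 1 = 1 ∧ r 1 ≤ x := by
  constructor
  · intro h1 hn
    obtain ⟨u, hu, h2, h3⟩ := h.exists_leaf (2 * n) (i := 1) (by omega) le_rfl (by omega) h1
    obtain ⟨h4, h5⟩ := (hl u hu).1.1 h2
    rcases ha u hu with ⟨h6, -⟩ | ⟨-, h6, -⟩
    · omega
    rcases hb u hu with ⟨h7, -⟩ | ⟨-, h7, -⟩
    · omega
    exact ⟨u, hu, _, _, h6, h7, by rw [← h3, (hl u hu).2 h2]⟩
  · rintro x ⟨u, hu, x₁, x₂, h1, h2, rfl⟩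
    rcases ha u hu with ⟨-, h6⟩ | ⟨h3, -, h6⟩
    · exact (h6 _ h1).elim
    rcases hb u hu with ⟨-, h7⟩ | ⟨h4, -, h7⟩
    · exact (h7 _ h2).elim
    have h5 := (hl u hu).1.2 ⟨h3, h4⟩
    obtain ⟨h8, h9⟩ := h.root_le (i := n + u) (by omega) (by omega) h5
    refine ⟨h8, h9.trans ?_⟩
    rw [(hl u hu).2 h5]
    exact add_le_add (h6 _ h1) (h7 _ h2)

namespace RealRAM

open Function

open Program in
/-- Clears the minima. -/
def clearMinima : Program :=
  (forTo 30 (.reg 0) <| (nput 21 (.reg 30) (.lit 0)).seq (nput 22 (.reg 30) (.lit 0))).seq <|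
  forTo 30 (.add (.reg 0) (.reg 0)) <| nput 24 (.reg 30) (.lit 0)

open Program in
/-- Computes, from the end of the path, the minimal lengths of the ways to return to the path. -/
def backwardSweep : Program :=
  forTo 30 (.reg 2) <|
    (nset 31 (.sub (.sub (.reg 2) (.lit 1)) (.reg 30))).seq <|
    (nset 32 (.get 2 (.reg 31))).seq <|
    branch (.nlt (.get 7 (.reg 32)) (.reg 3)) skip <|
      (nset 33 (.get 19 (.reg 32))).seq <|
      (nput 23 (.reg 31) (.get 22 (.reg 33))).seq <|
      (rput 11 (.reg 31) (.get 10 (.reg 33))).seq <|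
      branch (.neq (.get 18 (.reg 32)) (.lit 1))
        (minPut 22 10 33 (.add (.get 6 (.reg 32))
          (.sub (.get 7 (.sub (.reg 2) (.lit 1))) (.get 7 (.reg 31)))))
        skip

open Program in
/-- Combines, from the start of the path, ways to leave the path with ways to return to it. -/
def forwardSweep : Program :=
  forTo 30 (.reg 2) <|
    (nset 32 (.get 2 (.reg 30))).seq <|
    (branch (.nlt (.get 7 (.reg 32)) (.reg 3)) skip <|
      (nset 33 (.get 19 (.reg 32))).seq <|
      (nput 22 (.reg 33) (.get 23 (.reg 30))).seq <|
      (rput 10 (.reg 33) (.get 11 (.reg 30))).seq <|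
      (branch (.neq (.get 13 (.reg 32)) (.lit 1))
        (minPut 21 9 33 (.add (.get 7 (.reg 30)) (.get 3 (.reg 32))))
        skip).seq treeUpdate).seq <|
    branch (.neq (.get 24 (.lit 1)) (.lit 1)) (minPut 4 1 30 (.get 12 (.lit 1))) skip

section

attribute [local simp] wp NExpr.val NExpr.Need NExpr.cost RExpr.val RExpr.cost Test.Holds Test.cost
  State.setReg

theorem wp_clearMinima {B n : ℕ} (hn2 : 2 * n < B) {σ : State} {t : ℕ} (hn : σ.nreg 0 = n) :
    wp B clearMinima (fun τ t' => (∀ u < n, τ.nmem 21 u = 0 ∧ τ.nmem 22 u = 0) ∧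
      (∀ i < 2 * n, τ.nmem 24 i = 0) ∧ t' ≤ t + 60 * (n + 1)) σ t := by
  refine wp_for (fun j σ' t' => (∀ v < j, σ'.nmem 21 v = 0 ∧ σ'.nmem 22 v = 0) ∧
    t' ≤ t + 2 + 20 * j) n (t + 2 + 20 * n) (by omega) rfl ?_ ?_ ?_ ?_ ?_
  · intro σ' hF
    exact (hF.nreg 0 rfl).trans hn
  · simp
  · rintro j σ' t' hj ⟨-, h⟩; omega
  · rintro j σ' t' hj hF hx ⟨h1, h2⟩
    simp [hx]
    refine ⟨fun v hv => ?_, by omega⟩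
    by_cases hvj : v = j
    · subst hvj; simp
    · simp [hvj]
      exact h1 v (by omega)
  rintro σ₁ t₁ hF₁ ⟨g1, g2⟩
  simp only [NExpr.cost]
  refine wp_for (fun j σ' t' => (∀ v < j, σ'.nmem 24 v = 0) ∧
    t' ≤ t + 10 + 20 * n + 20 * j) (2 * n) (t + 10 + 60 * n) (by omega) rfl ?_ ?_ ?_ ?_ ?_
  · intro σ' hF
    simp [hF.nreg 0 rfl, hF₁.nreg 0 rfl, hn]
    ring
  · simp; omega
  · rintro j σ' t' hj ⟨-, h⟩; omega
  · rintro j σ' t' hj hF hx ⟨h1, h2⟩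
    simp [hx]
    refine ⟨fun v hv => ?_, by omega⟩
    by_cases hvj : v = j
    · subst hvj; simp
    · simp [hvj]
      exact h1 v (by omega)
  · rintro τ t' hF ⟨h1, h2⟩
    rw [hF.nmem 21 rfl, hF.nmem 22 rfl]
    simp
    exact ⟨g1, h1, by omega⟩

/-- Minima allow insertions but no deletions. So the vertices are inserted from the end of the path,
and just before `P j` enters, the minimum of its tree is saved; that is the value to which the
forward sweep has to return when `P j` is no longer available. -/
theorem wp_backwardSweep {B n lenP d : ℕ} {P dep tp fd : ℕ → ℕ} {F pre : ℕ → ℝ} (hl : lenP < B)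
    {σ : State} {t : ℕ} (h2 : σ.nreg 2 = lenP) (hd : σ.nreg 3 = d) (hP : σ.nmem 2 = P)
    (hdep : σ.nmem 7 = dep) (htp : σ.nmem 19 = tp) (hfd : σ.nmem 18 = fd) (hF : σ.rmem 6 = F)
    (hpre : σ.rmem 7 = pre) (h0 : ∀ u < n, σ.nmem 22 u = 0)
    (htpn : ∀ j < lenP, d ≤ dep (P j) → tp (P j) < n) :
    wp B backwardSweep (fun τ t' =>
      (∀ u < n, MinOf (τ.nmem 22 u) (τ.rmem 10 u) (Portion dep tp P fd
        (fun b => F (P b) + (pre (lenP - 1) - pre b)) d u (fun b => 0 ≤ b ∧ b < lenP))) ∧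
      (∀ j < lenP, d ≤ dep (P j) → MinOf (τ.nmem 23 j) (τ.rmem 11 j) (Portion dep tp P fd
        (fun b => F (P b) + (pre (lenP - 1) - pre b)) d (tp (P j))
        (fun b => j + 1 ≤ b ∧ b < lenP))) ∧
      t' ≤ t + 100 * (lenP + 1)) σ t := by
  set g : ℕ → ℝ := fun b => F (P b) + (pre (lenP - 1) - pre b) with hg
  refine wp_for (fun j σ' t' =>
      (∀ u < n, MinOf (σ'.nmem 22 u) (σ'.rmem 10 u) (Portion dep tp P fd g d u
        (fun b => lenP - j ≤ b ∧ b < lenP))) ∧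
      (∀ i, lenP - j ≤ i → i < lenP → d ≤ dep (P i) → MinOf (σ'.nmem 23 i) (σ'.rmem 11 i)
        (Portion dep tp P fd g d (tp (P i)) (fun b => i + 1 ≤ b ∧ b < lenP))) ∧
      t' ≤ t + 2 + 100 * j) lenP (t + 2 + 100 * lenP) hl rfl ?_ ?_ ?_ ?_ ?_
  · intro σ' hF
    exact (hF.nreg 2 rfl).trans h2
  · refine ⟨fun u hu => .inl ⟨h0 u hu, ?_⟩, fun i h1 h2 => by omega, by omega⟩
    rintro x ⟨a, h1, -⟩
    omega
  · rintro j σ' t' hj ⟨-, -, h⟩; omega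
  · rintro j σ' t' hj hFr hx ⟨i1, i2, i3⟩
    have e2 : σ'.nreg 2 = lenP := (hFr.nreg 2 rfl).trans h2
    have e3 : σ'.nreg 3 = d := (hFr.nreg 3 rfl).trans hd
    have eP : σ'.nmem 2 = P := (hFr.nmem 2 rfl).trans hP
    have ed : σ'.nmem 7 = dep := (hFr.nmem 7 rfl).trans hdep
    have et : σ'.nmem 19 = tp := (hFr.nmem 19 rfl).trans htp
    have ef : σ'.nmem 18 = fd := (hFr.nmem 18 rfl).trans hfd
    have eF : σ'.rmem 6 = F := (hFr.rmem 6 rfl).trans hF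
    have ep : σ'.rmem 7 = pre := (hFr.rmem 7 rfl).trans hpre
    obtain ⟨b, hb⟩ : ∃ b, lenP - 1 - j = b := ⟨_, rfl⟩
    have hbI : ∀ a, (lenP - j ≤ a ∧ a < lenP) ↔ (b < a ∧ a < lenP) := by
      intro a; omega
    simp [hx, e2, e3, eP, ed, et, ef, hb]
    refine ⟨fun k1 => ⟨fun u hu => ?_, fun i hi hi' hdi => ?_, by omega⟩, fun k1 => ⟨fun k2 => ?_,
      fun k2 => ⟨fun u hu => ?_, fun i hi hi' hdi => ?_, by omega⟩⟩⟩
    · exact (i1 u hu).congr fun x => Portion.congr (b := b) (fun a => by omega) (by omega)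
    · refine i2 i ?_ hi' hdi
      rcases Nat.lt_or_ge i (lenP - j) with h | h
      · obtain rfl : i = b := by omega
        omega
      · exact h
    · refine wp_minPut fun t'' f' r' ht hm => ?_
      simp [e2, eF, ep] at hm ht ⊢
      have hsv := i1 (tp (P b)) (htpn b (by omega) k1)
      refine ⟨fun u hu => ?_, fun i hi hi' hdi => ?_, by omega⟩
      · by_cases hub : u = tp (P b)
        · subst hub
          rw [update_self, update_self]
          exact (hm _ hsv).congr fun x => Portion.insert (g := g) (fun a => by omega) k1 rfl k2
        · rw [update_of_ne hub, update_of_ne hub]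
          exact (i1 u hu).congr fun x => Portion.congr (b := b) (fun a => by omega) (fun h => hub h.2.1.symm)
      · by_cases hib : i = b
        · subst hib
          rw [update_self, update_self]
          refine hsv.congr fun x => ?_
          simp only [hbI]
        · rw [update_of_ne hib, update_of_ne hib]
          exact i2 i (by omega) hi' hdi
    · exact (i1 u hu).congr fun x => Portion.congr (b := b) (fun a => by omega) (fun h => k2 h.2.2)
    · by_cases hib : i = b
      · subst hib
        rw [update_self, update_self]
        refine (i1 _ (htpn i hi' hdi)).congr fun x => ?_
        simp only [hbI]
      · rw [update_of_ne hib, update_of_ne hib]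
        exact i2 i (by omega) hi' hdi
  · rintro τ t' hF ⟨i1, i2, i3⟩
    simp only [NExpr.cost]
    refine ⟨fun u hu => (i1 u hu).congr fun x => by simp, fun j hj => i2 j (by omega) hj, by omega⟩

/-- At step j the vertex `P j` becomes a possible start of a detour and ceases to be a possible end.
Only the leaf of its own tree is affected, as `hA'` says for the ends, so one update of the
tournament tree per step suffices. `A' u q` is the set of lengths of returns with b ≥ q. -/
theorem wp_forwardSweep {B n lenP d : ℕ} {P dep tp bd fs : ℕ → ℕ} {D pre rs : ℕ → ℝ}
    {A' : ℕ → ℕ → ℝ → Prop} (hl : lenP < B) (hn2 : 2 * n < B) (hn1 : 1 ≤ n)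
    {σ : State} {t : ℕ} (h0 : σ.nreg 0 = n) (h2 : σ.nreg 2 = lenP) (hd : σ.nreg 3 = d)
    (hP : σ.nmem 2 = P) (hdep : σ.nmem 7 = dep) (htp : σ.nmem 19 = tp) (hbd : σ.nmem 13 = bd)
    (hD : σ.rmem 3 = D) (hpre : σ.rmem 7 = pre)
    (htpn : ∀ j < lenP, d ≤ dep (P j) → tp (P j) < n)
    (hA : ∀ u < n, σ.nmem 21 u = 0) (hB : ∀ u < n, MinOf (σ.nmem 22 u) (σ.rmem 10 u) (A' u 0))
    (hf : σ.nmem 23 = fs) (hr : σ.rmem 11 = rs)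
    (hS : ∀ j < lenP, d ≤ dep (P j) → MinOf (fs j) (rs j) (A' (tp (P j)) (j + 1)))
    (hT : ∀ i < 2 * n, σ.nmem 24 i = 0)
    (hA' : ∀ j < lenP, ∀ u < n, ¬ (d ≤ dep (P j) ∧ tp (P j) = u) → ∀ x, A' u j x ↔ A' u (j + 1) x) :
    wp B forwardSweep (fun τ t' =>
      (∀ i < lenP, ∀ S, MinOf (σ.nmem 4 i) (σ.rmem 1 i) S → MinOf (τ.nmem 4 i) (τ.rmem 1 i)
        fun x => S x ∨ SumsBelow n (fun u => Portion dep tp P bd (fun a => pre a + D (P a)) d u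
          (fun a => a ≤ i)) (fun u => A' u (i + 1)) x) ∧
      t' ≤ t + 10 + lenP * (200 * (Nat.log 2 n + 3))) σ t := by
  set g : ℕ → ℝ := fun a => pre a + D (P a) with hg
  generalize hE : 200 * (Nat.log 2 n + 3) = E
  obtain ⟨J, hJ⟩ : ∃ J : ℕ → State → ℕ → Prop, ∀ j σ' t', J j σ' t' ↔
      (∀ u < n, MinOf (σ'.nmem 21 u) (σ'.rmem 9 u) (Portion dep tp P bd g d u (fun a => a < j))) ∧
      (∀ u < n, MinOf (σ'.nmem 22 u) (σ'.rmem 10 u) (A' u j)) ∧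
      Tournament n (σ'.nmem 24) (σ'.rmem 12) ∧
      LeafSums n (σ'.nmem 24) (σ'.rmem 12) (σ'.nmem 21) (σ'.nmem 22) (σ'.rmem 9) (σ'.rmem 10) ∧
      (∀ i < j, ∀ S, MinOf (σ.nmem 4 i) (σ.rmem 1 i) S → MinOf (σ'.nmem 4 i) (σ'.rmem 1 i)
        fun x => S x ∨ SumsBelow n (fun u => Portion dep tp P bd g d u
          (fun a => a ≤ i)) (fun u => A' u (i + 1)) x) ∧
      (∀ i, j ≤ i → σ'.nmem 4 i = σ.nmem 4 i ∧ σ'.rmem 1 i = σ.rmem 1 i) ∧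
      t' ≤ t + 2 + j * E := ⟨_, fun _ _ _ => Iff.rfl⟩
  refine wp_for J lenP (t + 2 + lenP * E) hl rfl ?_ ?_ ?_ ?_ ?_
  · intro σ' hF
    exact (hF.nreg 2 rfl).trans h2
  · rw [hJ]
    refine ⟨fun u hu => .inl ⟨hA u hu, ?_⟩, hB, fun i hi hi' => ?_, fun u hu => ?_,
      fun i hi => by omega, fun i _ => ⟨rfl, rfl⟩, by omega⟩
    · rintro x ⟨a, h1, -⟩; omega
    · have a1 := hT i (by omega)
      have a2 := hT (2 * i) (by omega)
      have a3 := hT (2 * i + 1) (by omega)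
      exact ⟨2 * i, .inl rfl, a1.trans a2.symm, fun h => by simp [a1] at h, by
        rintro c' (rfl | rfl) h <;> simp [a2, a3] at h⟩
    · have a1 := hT (n + u) (by omega)
      have a2 := hA u hu
      simp [a1, a2]
  · intro j σ' t' hj h
    have h := ((hJ _ _ _).1 h).2.2.2.2.2.2
    have := Nat.mul_le_mul_right E hj
    omega
  · intro j σ' t' hj hFr hx hI
    obtain ⟨i1, i2, i3, i4, i5, i6, i7⟩ := (hJ _ _ _).1 hI
    have e0 : σ'.nreg 0 = n := (hFr.nreg 0 rfl).trans h0
    have e3 : σ'.nreg 3 = d := (hFr.nreg 3 rfl).trans hd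
    have eP : σ'.nmem 2 = P := (hFr.nmem 2 rfl).trans hP
    have ed : σ'.nmem 7 = dep := (hFr.nmem 7 rfl).trans hdep
    have et : σ'.nmem 19 = tp := (hFr.nmem 19 rfl).trans htp
    have eb : σ'.nmem 13 = bd := (hFr.nmem 13 rfl).trans hbd
    have eD : σ'.rmem 3 = D := (hFr.rmem 3 rfl).trans hD
    have ep : σ'.rmem 7 = pre := (hFr.rmem 7 rfl).trans hpre
    have ef : σ'.nmem 23 = fs := (hFr.nmem 23 rfl).trans hf
    have er : σ'.rmem 11 = rs := (hFr.rmem 11 rfl).trans hr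
    have hEj : (j + 1) * E = j * E + E := by ring
    have final : ∀ (τ : State) (t₁ : ℕ), τ.nreg 30 = j →
        (∀ u < n, MinOf (τ.nmem 21 u) (τ.rmem 9 u)
          (Portion dep tp P bd g d u (fun a => a < j + 1))) →
        (∀ u < n, MinOf (τ.nmem 22 u) (τ.rmem 10 u) (A' u (j + 1))) →
        Tournament n (τ.nmem 24) (τ.rmem 12) →
        LeafSums n (τ.nmem 24) (τ.rmem 12) (τ.nmem 21) (τ.nmem 22) (τ.rmem 9) (τ.rmem 10) →
        τ.nmem 4 = σ'.nmem 4 → τ.rmem 1 = σ'.rmem 1 →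
        t₁ ≤ t' + 100 + 100 * (Nat.log 2 n + 3) →
        wp B (Program.branch (.neq (.get 24 (.lit 1)) (.lit 1)) (minPut 4 1 30 (.get 12 (.lit 1))) .skip)
          (fun τ t'' => J (j + 1) (τ.setReg 30 (j + 1)) (t'' + 4)) τ t₁ := by
      intro τ t₁ hx' b1 b2 b3 b4 b5 b6 ht
      obtain ⟨c1, c2⟩ := b3.root b4 b1 b2
      simp only [Nat.lt_succ_iff] at b1 c1 c2
      rw [← b5, ← b6] at i5 i6
      have i6j := i6 j le_rfl
      simp [hJ]
      refine ⟨fun k1 => ?_, fun k1 => ⟨b1, b2, b3, b4, fun i hi S hS => ?_, fun i hi =>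
        i6 i (by omega), by omega⟩⟩
      · refine wp_minPut fun t'' f' r' ht' hm => ?_
        simp [hx'] at hm ht' ⊢
        refine ⟨b1, b2, b3, b4, fun i hi S hS => ?_, fun i hi => ?_, by omega⟩
        · by_cases hij : i = j
          · subst hij
            rw [update_self, update_self]
            rw [← i6j.1, ← i6j.2] at hS
            exact (hm S hS).union (c1 k1 hn1) fun x hx => (c2 x hx).2
          · rw [update_of_ne hij, update_of_ne hij]
            exact i5 i (by omega) S hS
        · rw [update_of_ne (by omega), update_of_ne (by omega)]
          exact i6 i (by omega)
      · by_cases hij : i = j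
        · subst hij
          rw [i6j.1, i6j.2]
          exact hS.congr fun x => ⟨.inl, fun h => h.resolve_right fun h => k1 (c2 x h).1⟩
        · exact i5 i (by omega) S hS
    have hupd : ∀ (τ : State) (t₁ : ℕ), τ.nreg 30 = j → τ.nreg 33 = tp (P j) → d ≤ dep (P j) →
        τ.nreg 0 = n →
        (∀ u < n, MinOf (τ.nmem 21 u) (τ.rmem 9 u)
          (Portion dep tp P bd g d u (fun a => a < j + 1))) →
        (∀ u < n, MinOf (τ.nmem 22 u) (τ.rmem 10 u) (A' u (j + 1))) →
        (∀ u, u ≠ tp (P j) → τ.nmem 21 u = σ'.nmem 21 u ∧ τ.nmem 22 u = σ'.nmem 22 u ∧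
          τ.rmem 9 u = σ'.rmem 9 u ∧ τ.rmem 10 u = σ'.rmem 10 u) →
        τ.nmem 24 = σ'.nmem 24 → τ.rmem 12 = σ'.rmem 12 →
        τ.nmem 4 = σ'.nmem 4 → τ.rmem 1 = σ'.rmem 1 →
        t₁ ≤ t' + 100 →
        wp B treeUpdate (wp B (Program.branch (.neq (.get 24 (.lit 1)) (.lit 1))
            (minPut 4 1 30 (.get 12 (.lit 1))) .skip)
          (fun τ t'' => J (j + 1) (τ.setReg 30 (j + 1)) (t'' + 4))) τ t₁ := by
      intro τ t₁ hx' hu hdj hn b1 b2 b3 b4 b5 b6 b7 ht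
      have hun := htpn j hj hdj
      refine wp_use (p := treeUpdate) (wp_treeUpdate hn2 hn hu hun (by rw [b4, b5]; exact i3)) ?_
      rintro ρ t₂ hF ⟨c1, c2, c3, c4, c5⟩
      have f1 : ρ.nmem 21 = τ.nmem 21 := hF.nmem 21 rfl
      have f2 : ρ.nmem 22 = τ.nmem 22 := hF.nmem 22 rfl
      have f3 : ρ.rmem 9 = τ.rmem 9 := hF.rmem 9 rfl
      have f4 : ρ.rmem 10 = τ.rmem 10 := hF.rmem 10 rfl
      refine final ρ t₂ ((hF.nreg 30 rfl).trans hx') ?_ ?_ c1 ?_ ((hF.nmem 4 rfl).trans b6)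
        ((hF.rmem 1 rfl).trans b7) (c5.trans (Nat.add_le_add_right ht _))
      · rw [f1, f3]; exact b1
      · rw [f2, f4]; exact b2
      · intro u hu
        rw [f1, f2, f3, f4]
        by_cases huj : u = tp (P j)
        · subst huj; exact ⟨c3, c4⟩
        · obtain ⟨d1, d2⟩ := c2 u hu huj
          obtain ⟨d3, d4, d5, d6⟩ := b3 u huj
          rw [d1, d2, b4, b5, d3, d4, d5, d6]
          exact i4 u hu
    have hlt : ∀ {u : ℕ} {x : ℝ}, ¬ (d ≤ dep (P j) ∧ tp (P j) = u ∧ bd (P j) = 1) →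
        (Portion dep tp P bd g d u (fun a => a < j) x ↔
          Portion dep tp P bd g d u (fun a => a < j + 1) x) :=
      fun h => Portion.congr (b := j) (fun a => Nat.lt_succ_iff_lt_or_eq) h
    change wp B (.nset 32 (.get 2 (.reg 30))) (wp B (.branch _ _ _) (wp B (.branch _ _ _) _)) σ' _
    generalize hp : Program.branch (.neq (.get 24 (.lit 1)) (.lit 1)) _ _ = p at final hupd ⊢
    simp [ hx, e3, eP, ed, et, eb, ef, er]
    refine ⟨fun k1 => final _ _ (by simp [hx]) (fun u hu => ?_) (fun u hu => ?_) i3 i4 rfl rfl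
      (by omega), fun k1 => ⟨fun k2 => ?_, fun k2 => ?_⟩⟩
    · exact (i1 u hu).congr fun x => hlt (by omega)
    · exact (i2 u hu).congr (hA' j hj u hu (by omega))
    · refine wp_minPut fun t'' f' r' ht hm => ?_
      simp [hx, ep, eD] at hm ht ⊢
      refine hupd _ _ (by simp [hx]) (by simp) k1 (by simp [e0]) (fun u hu => ?_) (fun u hu => ?_)
        (fun u hu => ?_) rfl rfl rfl rfl (by omega)
      · by_cases huj : u = tp (P j)
        · subst huj
          simp
          exact (hm _ (i1 _ hu)).congr fun x => Portion.insert (g := g)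
            (fun a => Nat.le_iff_lt_or_eq) k1 rfl k2
        · simp only [update_self, update_of_ne huj]
          exact (i1 u hu).congr fun x => hlt (by tauto)
      · by_cases huj : u = tp (P j)
        · subst huj
          simp
          exact hS j hj k1
        · simp [huj]
          exact (i2 u hu).congr (hA' j hj u hu (by tauto))
      · simp [hu]
    · refine hupd _ _ (by simp [hx]) (by simp) k1 (by simp [e0]) (fun u hu => ?_) (fun u hu => ?_)
        (fun u hu => ?_) rfl rfl rfl rfl (by omega)
      · simp only [ne_eq, Nat.reduceEqDiff, not_false_eq_true, update_of_ne]
        exact (i1 u hu).congr fun x => hlt (by tauto)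
      · by_cases huj : u = tp (P j)
        · subst huj
          simp
          exact hS j hj k1
        · simp [huj]
          exact (i2 u hu).congr (hA' j hj u hu (by tauto))
      · simp [hu]
  · intro τ t' hF hI
    obtain ⟨i1, i2, i3, i4, i5, i6, i7⟩ := (hJ _ _ _).1 hI
    simp only [NExpr.cost]
    refine ⟨fun i hi => i5 i hi, by omega⟩

end

end RealRAM


/-! ### Ancestors and potentials from one level to the next -/

namespace SearchProblem

theorem Solved.congr_values {I : SearchProblem} {done done' : ℕ → ℕ} {D D' : ℕ → ℝ}
    (h : I.Solved done D) (hw : I.WellFormed)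
    (he : ∀ v < I.n, done' v = done v ∧ D' v = D v) : I.Solved done' D' := by
  refine ⟨fun v hv => ?_, fun v hv hs => ?_, fun e hE ht => ?_, fun v hv hd => ?_⟩
  · rw [(he v hv).1]; exact h.zero_or_one v hv
  · rw [(he v hv).1, (he v hv).2]; exact h.src v hv hs
  · have h1 := he _ (hw e hE).1
    have h2 := he _ (hw e hE).2.1
    rw [h1.1] at ht
    rw [h1.2, h2.1, h2.2]
    exact h.closed e hE ht
  · rw [(he v hv).1] at hd
    rw [(he v hv).2]
    exact h.sound v hv hd

end SearchProblem

open RealRAM in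
theorem Elimination.wellFormed {n m : ℕ} {T H good lv : ℕ → ℕ} {w p : ℕ → ℝ} {d : ℕ}
    (hT : ∀ e, 1 ≤ e → e ≤ m → T e < n) (hH : ∀ e, 1 ≤ e → e ≤ m → H e < n) :
    (levelProblem n m T H good lv w p d).WellFormed := fun e he =>
  ⟨hT e he.1 he.2.1, hH e he.1 he.2.1, fun h => by
    have h1 : d < lv (H e) := he.2.2.2.2
    have h2 : lv (H e) = d := h
    omega⟩

namespace RealRAM

open Function

open Program in
/-- Computes the ancestors at the level in register 3 from those at the level below. -/
def updateTop : Program :=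
  forTo 30 (.reg 0) <|
    branch (.neq (.get 7 (.reg 30)) (.reg 3)) (nput 19 (.reg 30) (.reg 30)) <|
      branch (.nlt (.reg 3) (.get 7 (.reg 30))) (nput 19 (.reg 30) (.get 3 (.get 19 (.reg 30)))) skip

open Program in
/-- Saves the result of a search. -/
def copySearch : Program :=
  forTo 30 (.reg 0) <|
    (nput 18 (.reg 30) (.get 13 (.reg 30))).seq (rput 6 (.reg 30) (.get 3 (.reg 30)))

open Program in
/-- Potentials of the vertices of the level in register 3. -/
def potentialAt : Program :=
  forTo 30 (.reg 1) <|
    (nset 31 (.get 1 (.reg 30))).seq <|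
    (nset 32 (.get 0 (.reg 30))).seq <|
    branch (.and (.neq (.get 6 (.add (.reg 30) (.lit 1))) (.lit 1))
        (.and (.neq (.get 7 (.reg 31)) (.reg 3)) (.and (.nlt (.reg 3) (.get 7 (.reg 32)))
          (.rlt (.add (.get 5 (.reg 32)) (.get 0 (.reg 30))) (.get 5 (.reg 31))))))
      (rput 5 (.reg 31) (.add (.get 5 (.reg 32)) (.get 0 (.reg 30)))) skip

open Program in
/-- Potentials of the vertices below the level in register 3. -/
def potentialBelow : Program :=
  forTo 30 (.reg 0) <|
    branch (.and (.nlt (.reg 3) (.get 7 (.reg 30))) (.and (.neq (.get 18 (.reg 30)) (.lit 1))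
        (.rlt (.add (.get 5 (.get 19 (.reg 30))) (.get 6 (.reg 30))) (.get 5 (.reg 30)))))
      (rput 5 (.reg 30) (.add (.get 5 (.get 19 (.reg 30))) (.get 6 (.reg 30)))) skip

section

attribute [local simp] wp NExpr.val NExpr.Need NExpr.cost RExpr.val RExpr.cost Test.Holds Test.cost
  State.setReg

theorem wp_updateTop {B n d : ℕ} {par dep : ℕ → ℕ} (hn : n < B) {σ : State} {t : ℕ}
    (h0 : σ.nreg 0 = n) (hd : σ.nreg 3 = d) (hpar : σ.nmem 3 = par) (hdep : σ.nmem 7 = dep)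
    (htp : ∀ v < n, d + 1 ≤ dep v → σ.nmem 19 v = Forest.top par dep (d + 1) v) :
    wp B updateTop (fun τ t' => (∀ v < n, d ≤ dep v → τ.nmem 19 v = Forest.top par dep d v) ∧
      t' ≤ t + 50 * (n + 1)) σ t := by
  refine wp_for (fun j σ' t' => (∀ v < j, d ≤ dep v → σ'.nmem 19 v = Forest.top par dep d v) ∧
    (∀ v, j ≤ v → σ'.nmem 19 v = σ.nmem 19 v) ∧
    t' ≤ t + 2 + 40 * j) n (t + 2 + 40 * n) hn rfl ?_ ?_ ?_ ?_ ?_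
  · intro σ' hF
    exact (hF.nreg 0 rfl).trans h0
  · simp
  · rintro j σ' t' hj ⟨-, -, h⟩; omega
  · rintro j σ' t' hj hF hx ⟨h1, h2, h3⟩
    have e3 : σ'.nreg 3 = d := (hF.nreg 3 rfl).trans hd
    have ep : σ'.nmem 3 = par := (hF.nmem 3 rfl).trans hpar
    have ed : σ'.nmem 7 = dep := (hF.nmem 7 rfl).trans hdep
    have key : ∀ x, (d ≤ dep j → x = Forest.top par dep d j) →
        (∀ v ≤ j, d ≤ dep v → update (σ'.nmem 19) j x v = Forest.top par dep d v) ∧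
        ∀ v, j < v → update (σ'.nmem 19) j x v = σ.nmem 19 v := by
      intro x hx
      refine ⟨fun v hv hdv => ?_, fun v hv => ?_⟩
      · by_cases hvj : v = j
        · subst hvj; simpa using hx hdv
        · simp [hvj]
          exact h1 v (by omega) hdv
      · rw [update_of_ne (by omega)]
        exact h2 v (by omega)
    simp [hx, e3, ep, ed]
    refine ⟨fun k1 => ?_, fun k1 => ⟨fun k2 => ?_, fun k2 => ?_⟩⟩
    · obtain ⟨a1, a2⟩ := key j (fun _ => (Forest.top_self k1).symm)
      exact ⟨a1, a2, by omega⟩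
    · obtain ⟨a1, a2⟩ := key (par (σ'.nmem 19 j)) (fun _ => by
        rw [h2 j le_rfl, htp j hj k2, Forest.top_succ k2])
      exact ⟨a1, a2, by omega⟩
    · obtain ⟨a1, a2⟩ := key (σ'.nmem 19 j) (fun _ => by omega)
      rw [update_eq_self] at a1 a2
      exact ⟨a1, a2, by omega⟩
  · rintro τ t' hF ⟨h1, h2, h3⟩
    simp
    exact ⟨h1, by omega⟩

theorem wp_copySearch {B n : ℕ} (hn : n < B) {σ : State} {t : ℕ} (h0 : σ.nreg 0 = n) :
    wp B copySearch (fun τ t' => (∀ v < n, τ.nmem 18 v = σ.nmem 13 v ∧ τ.rmem 6 v = σ.rmem 3 v) ∧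
      t' ≤ t + 50 * (n + 1)) σ t := by
  refine wp_for (fun j σ' t' => (∀ v < j, σ'.nmem 18 v = σ.nmem 13 v ∧ σ'.rmem 6 v = σ.rmem 3 v) ∧
    t' ≤ t + 2 + 40 * j) n (t + 2 + 40 * n) hn rfl ?_ ?_ ?_ ?_ ?_
  · intro σ' hF
    exact (hF.nreg 0 rfl).trans h0
  · simp
  · rintro j σ' t' hj ⟨-, h⟩; omega
  · rintro j σ' t' hj hF hx ⟨h1, h2⟩
    have e1 : σ'.nmem 13 = σ.nmem 13 := hF.nmem 13 rfl
    have e2 : σ'.rmem 3 = σ.rmem 3 := hF.rmem 3 rfl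
    simp [hx, e1, e2]
    refine ⟨fun v hv => ?_, by omega⟩
    by_cases hvj : v = j
    · subst hvj; simp
    · simp [hvj]
      exact h1 v (by omega)
  · rintro τ t' hF ⟨h1, h2⟩
    simp
    exact ⟨h1, by omega⟩

theorem wp_potentialAt {B m d : ℕ} {T H dep good : ℕ → ℕ} {w p : ℕ → ℝ} (hm : m + 1 < B)
    {σ : State} {t : ℕ} (h1 : σ.nreg 1 = m) (hd : σ.nreg 3 = d)
    (hT : ∀ e, σ.nmem 0 (e - 1) = T e) (hH : ∀ e, σ.nmem 1 (e - 1) = H e)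
    (hw : ∀ e, σ.rmem 0 (e - 1) = w e) (hgood : σ.nmem 6 = good) (hdep : σ.nmem 7 = dep)
    (hp : σ.rmem 5 = p) :
    wp B potentialAt (fun τ t' => (∀ v, dep v ≠ d → τ.rmem 5 v = p v) ∧
      (∀ e, 1 ≤ e → e ≤ m → good e = 1 → dep (H e) = d → d < dep (T e) →
        τ.rmem 5 (H e) ≤ p (T e) + w e) ∧ t' ≤ t + 100 * (m + 1)) σ t := by
  refine wp_for (fun j σ' t' => (∀ v, dep v ≠ d → σ'.rmem 5 v = p v) ∧
    (∀ e, 1 ≤ e → e ≤ j → good e = 1 → dep (H e) = d → d < dep (T e) →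
        σ'.rmem 5 (H e) ≤ p (T e) + w e) ∧
    t' ≤ t + 2 + 90 * j) m (t + 2 + 90 * m) (by omega) rfl ?_ ?_ ?_ ?_ ?_
  · intro σ' hF
    exact (hF.nreg 1 rfl).trans h1
  · simp [hp]
    intros; omega
  · rintro j σ' t' hj ⟨-, -, h⟩; omega
  · rintro j σ' t' hj hF hx ⟨i1, i2, i3⟩
    have e3 : σ'.nreg 3 = d := (hF.nreg 3 rfl).trans hd
    have eg : σ'.nmem 6 = good := (hF.nmem 6 rfl).trans hgood
    have ed : σ'.nmem 7 = dep := (hF.nmem 7 rfl).trans hdep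
    have eT : σ'.nmem 0 j = T (j + 1) := by rw [hF.nmem 0 rfl, ← hT]; rfl
    have eH : σ'.nmem 1 j = H (j + 1) := by rw [hF.nmem 1 rfl, ← hH]; rfl
    have ew : σ'.rmem 0 j = w (j + 1) := by rw [hF.rmem 0 rfl, ← hw]; rfl
    simp [hx, e3, eg, ed, eT, eH, ew]
    refine ⟨fun k1 k2 k3 k4 => ⟨fun v hv => ?_, fun e he he' g1 g2 g3 => ?_, by omega⟩,
      fun k => ⟨i1, fun e he he' g1 g2 g3 => ?_, by omega⟩⟩
    · rw [update_of_ne (by rintro rfl; exact hv k2)]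
      exact i1 v hv
    · by_cases hej : e = j + 1
      · subst hej
        rw [update_self, i1 _ (by omega)]
      · have := i2 e he (by omega) g1 g2 g3
        by_cases heH : H e = H (j + 1)
        · rw [heH, update_self]
          rw [heH] at this
          linarith
        · rw [update_of_ne heH]
          exact this
    · by_cases hej : e = j + 1
      · subst hej
        have := k g1 g2 g3
        rwa [i1 (T (j + 1)) (by omega)] at this
      · exact i2 e he (by omega) g1 g2 g3
  · rintro τ t' hF ⟨i1, i2, i3⟩
    simp
    exact ⟨i1, i2, by omega⟩

theorem wp_potentialBelow {B n d : ℕ} {dep tp fd : ℕ → ℕ} {F p : ℕ → ℝ} (hn : n < B)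
    {σ : State} {t : ℕ} (h0 : σ.nreg 0 = n) (hd : σ.nreg 3 = d) (hdep : σ.nmem 7 = dep)
    (htp : σ.nmem 19 = tp) (hfd : σ.nmem 18 = fd) (hF' : σ.rmem 6 = F) (hp : σ.rmem 5 = p)
    (htpd : ∀ v < n, d < dep v → dep (tp v) = d) :
    wp B potentialBelow (fun τ t' => (∀ v, dep v ≤ d → τ.rmem 5 v = p v) ∧
      (∀ v < n, d < dep v → τ.rmem 5 v ≤ p v ∧
        (fd v = 1 → τ.rmem 5 v ≤ τ.rmem 5 (tp v) + F v) ∧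
        (τ.rmem 5 v = p v ∨ fd v = 1 ∧ τ.rmem 5 v = τ.rmem 5 (tp v) + F v)) ∧
      t' ≤ t + 100 * (n + 1)) σ t := by
  refine wp_for (fun j σ' t' => (∀ v, dep v ≤ d → σ'.rmem 5 v = p v) ∧
      (∀ v < j, d < dep v → σ'.rmem 5 v ≤ p v ∧
        (fd v = 1 → σ'.rmem 5 v ≤ σ'.rmem 5 (tp v) + F v) ∧
        (σ'.rmem 5 v = p v ∨ fd v = 1 ∧ σ'.rmem 5 v = σ'.rmem 5 (tp v) + F v)) ∧
      (∀ v, j ≤ v → σ'.rmem 5 v = p v) ∧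
      t' ≤ t + 2 + 90 * j) n (t + 2 + 90 * n) hn rfl ?_ ?_ ?_ ?_ ?_
  · intro σ' hF
    exact (hF.nreg 0 rfl).trans h0
  · simp [hp]
  · rintro j σ' t' hj ⟨-, -, -, h⟩; omega
  · rintro j σ' t' hj hF hx ⟨i1, i2, i3, i4⟩
    have e3 : σ'.nreg 3 = d := (hF.nreg 3 rfl).trans hd
    have ed : σ'.nmem 7 = dep := (hF.nmem 7 rfl).trans hdep
    have et : σ'.nmem 19 = tp := (hF.nmem 19 rfl).trans htp
    have ef : σ'.nmem 18 = fd := (hF.nmem 18 rfl).trans hfd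
    have eF : σ'.rmem 6 = F := (hF.rmem 6 rfl).trans hF'
    simp [hx, e3, ed, et, ef, eF]
    have hj3 := i3 j le_rfl
    refine ⟨fun k1 k2 k3 => ?_, fun k => ⟨i1, fun v hv hdv => ?_, fun v hv => i3 v (by omega),
      by omega⟩⟩
    -- New values refer to potentials of vertices of depth `d`, which this loop does not touch.
    · have hne : ∀ v < n, d < dep v → tp v ≠ j := fun v hv hdv h => by
        have := htpd v hv hdv
        rw [h] at this
        omega
      refine ⟨fun v hv => ?_, fun v hv hdv => ?_, fun v hv => ?_, by omega⟩
      · rw [update_of_ne (by rintro rfl; omega)]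
        exact i1 v hv
      · rw [update_of_ne (hne v (by omega) hdv)]
        by_cases hvj : v = j
        · subst hvj
          rw [update_self]
          exact ⟨by linarith, fun _ => le_rfl, .inr ⟨k2, rfl⟩⟩
        · rw [update_of_ne hvj]
          exact i2 v (by omega) hdv
      · rw [update_of_ne (by omega)]
        exact i3 v (by omega)
    · by_cases hvj : v = j
      · subst hvj
        exact ⟨hj3.le, fun h => k hdv h, .inl hj3⟩
      · exact i2 v (by omega) hdv
  · rintro τ t' hF ⟨i1, i2, i3, i4⟩
    simp
    exact ⟨i1, i2, by omega⟩

end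

end RealRAM


/-! ### One level of the algorithm -/

/-- What the output has to satisfy when the levels `d, d + 1, …` have been dealt with. -/
def OutputAbove (m : ℕ) (T H dep good : ℕ → ℕ) (w : ℕ → ℝ) (P : ℕ → ℕ) (pre : ℕ → ℝ) (ℓ d : ℕ)
    (f : ℕ → ℕ) (r : ℕ → ℝ) : Prop :=
  ∀ i < ℓ, (f i = 0 ∨ f i = 1 ∧ ∃ a b L, a ≤ i ∧ i < b ∧ b ≤ ℓ ∧
      Wk (ListedEdge m T H good w) (P a) (P b) L ∧ r i = pre a + L + (pre ℓ - pre b)) ∧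
    ∀ a b u L₁ L₂ d', d ≤ d' → a ≤ i → i < b → b ≤ ℓ → dep u = d' → d' ≤ dep (P a) →
      d' ≤ dep (P b) → Wk (Elimination.LevelEdge m T H dep good w d') (P a) u L₁ →
      Wk (Elimination.LevelEdge m T H dep good w d') u (P b) L₂ →
      f i = 1 ∧ r i ≤ pre a + (L₁ + L₂) + (pre ℓ - pre b)

open RealRAM in
theorem Elimination.outputAbove_step {n m d ℓ : ℕ} {T H par dep good : ℕ → ℕ} {w p : ℕ → ℝ}
    {bd fd f f' tp : ℕ → ℕ} {D F r r' : ℕ → ℝ} {P : ℕ → ℕ} {pre : ℕ → ℝ}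
    (h : Elimination n m T H par dep good w) (hd : 1 ≤ d)
    (hp : FeasibleAbove m T H dep good w p d)
    (hB : (levelProblem n m H T good dep w (fun v => - p v) d).Solved bd D)
    (hF : (levelProblem n m T H good dep w p d).Solved fd F) (hP : ∀ j ≤ ℓ, P j < n)
    (htp : ∀ v < n, d ≤ dep v → tp v = Forest.top par dep d v)
    (ho : OutputAbove m T H dep good w P pre ℓ (d + 1) f r)
    (hf : ∀ i < ℓ, ∀ S, MinOf (f i) (r i) S → MinOf (f' i) (r' i) fun x => S x ∨
      SumsBelow n (fun u => Portion dep tp P bd (fun a => pre a + D (P a)) d u (fun a => a ≤ i))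
        (fun u => Portion dep tp P fd (fun b => F (P b) + (pre ℓ - pre b)) d u
          (fun b => i + 1 ≤ b ∧ b < ℓ + 1)) x) :
    OutputAbove m T H dep good w P pre ℓ d f' r' := by
  intro i hi
  obtain ⟨h1, h2⟩ := ho i hi
  have hcand : ∀ x, SumsBelow n
      (fun u => Portion dep tp P bd (fun a => pre a + D (P a)) d u (fun a => a ≤ i))
        (fun u => Portion dep tp P fd (fun b => F (P b) + (pre ℓ - pre b)) d u
          (fun b => i + 1 ≤ b ∧ b < ℓ + 1)) x ↔
      Candidate dep (Forest.top par dep d) P pre ℓ bd D fd F d i x := by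
    intro x
    constructor
    · rintro ⟨u, hu, x₁, x₂, ⟨a, a1, a2, a3, a4, rfl⟩, ⟨b, ⟨b1, b1'⟩, b2, b3, b4, rfl⟩, rfl⟩
      refine ⟨a, b, a1, b1, by omega, a2, b2, ?_, a4, b4, rfl⟩
      rw [← htp _ (hP a (by omega)) a2, ← htp _ (hP b (by omega)) b2, a3, b3]
    · rintro ⟨a, b, a1, b1, b1', a2, b2, hab, a4, b4, rfl⟩
      refine ⟨tp (P a), ?_, _, _, ⟨a, a1, a2, rfl, a4, rfl⟩, ⟨b, ⟨b1, by omega⟩, b2, ?_, b4, rfl⟩, rfl⟩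
      · rw [htp _ (hP a (by omega)) a2]
        exact h.forest.top_lt (hP a (by omega)) hd
      · rw [htp _ (hP a (by omega)) a2, htp _ (hP b b1') b2, hab]
  -- The output so far is the minimum of the set that contains just itself, or nothing; `hf` adds
  -- the candidates of level `d`.
  have hmin : MinOf (f i) (r i) fun x => f i = 1 ∧ x = r i := by
    rcases h1 with h1 | ⟨h1, -⟩
    · exact .inl ⟨h1, fun x hx => by omega⟩
    · exact .inr ⟨h1, ⟨h1, rfl⟩, fun x hx => hx.2.ge⟩
  have hmin' := (hf i hi _ hmin).congr (S' := fun x => (f i = 1 ∧ x = r i) ∨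
    Candidate dep (Forest.top par dep d) P pre ℓ bd D fd F d i x) fun x => or_congr_right (hcand x)
  have hle : ∀ x, ((f i = 1 ∧ x = r i) ∨
    Candidate dep (Forest.top par dep d) P pre ℓ bd D fd F d i x) → f' i = 1 ∧ r' i ≤ x := by
    intro x hx
    rcases hmin' with ⟨-, h4⟩ | ⟨h3, -, h4⟩
    · exact (h4 x hx).elim
    · exact ⟨h3, h4 x hx⟩
  refine ⟨?_, ?_⟩
  · rcases hmin' with ⟨h3, -⟩ | ⟨h3, h4, -⟩
    · exact .inl h3
    · refine .inr ⟨h3, ?_⟩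
      rcases h4 with ⟨h4, h5⟩ | h4
      · rcases h1 with h1 | ⟨-, h1⟩
        · omega
        · rwa [← h5] at h1
      · exact h.walk_of_candidate hB hF hP h4
  · intro a b u L₁ L₂ d' hd' ha hb hbl hu hda hdb w1 w2
    rcases hd'.lt_or_eq with hlt | rfl
    · obtain ⟨c1, c2⟩ := h2 a b u L₁ L₂ d' hlt ha hb hbl hu hda hdb w1 w2
      obtain ⟨c3, c4⟩ := hle (r i) (.inl ⟨c1, rfl⟩)
      exact ⟨c3, c4.trans c2⟩
    · obtain ⟨x, hx, hx'⟩ := h.exists_candidate (pre := pre) hd hp hB hF hP ha hb hbl hu hda hdb w1 w2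
      obtain ⟨c3, c4⟩ := hle x (.inr hx)
      exact ⟨c3, c4.trans hx'⟩

namespace RealRAM

open Function

/-- The data that all levels use. -/
structure Inputs (n m lenP : ℕ) (T H P par good dep : ℕ → ℕ) (w pre : ℕ → ℝ) (σ : State) :
    Prop where
  n : σ.nreg 0 = n
  m : σ.nreg 1 = m
  lenP : σ.nreg 2 = lenP
  tail : ∀ e, σ.nmem 0 (e - 1) = T e
  head : ∀ e, σ.nmem 1 (e - 1) = H e
  path : σ.nmem 2 = P
  parent : σ.nmem 3 = par
  good : σ.nmem 6 = good
  depth : σ.nmem 7 = dep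
  weight : ∀ e, σ.rmem 0 (e - 1) = w e
  pre : σ.rmem 7 = pre

/-- The program does not change the data that all levels use. -/
def Program.keepsInputs (p : Program) : Bool :=
  !p.writesNReg 0 && !p.writesNReg 1 && !p.writesNReg 2 && !p.writesNMem 0 && !p.writesNMem 1 &&
    !p.writesNMem 2 && !p.writesNMem 3 && !p.writesNMem 6 && !p.writesNMem 7 && !p.writesRMem 0 &&
    !p.writesRMem 7

theorem Inputs.frame {n m lenP : ℕ} {T H P par good dep : ℕ → ℕ} {w pre : ℕ → ℝ} {σ τ : State}
    {p : Program} (h : Inputs n m lenP T H P par good dep w pre σ) (hF : Frame p σ τ)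
    (hp : p.keepsInputs = true) : Inputs n m lenP T H P par good dep w pre τ := by
  simp only [Program.keepsInputs, Bool.and_eq_true, Bool.not_eq_true'] at hp
  obtain ⟨⟨⟨⟨⟨⟨⟨⟨⟨⟨p1, p2⟩, p3⟩, p4⟩, p5⟩, p6⟩, p7⟩, p8⟩, p9⟩, p10⟩, p11⟩ := hp
  refine ⟨?_, ?_, ?_, fun e => ?_, fun e => ?_, ?_, ?_, ?_, ?_, fun e => ?_, ?_⟩
  · rw [hF.nreg 0 p1]; exact h.n
  · rw [hF.nreg 1 p2]; exact h.m
  · rw [hF.nreg 2 p3]; exact h.lenP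
  · rw [hF.nmem 0 p4]; exact h.tail e
  · rw [hF.nmem 1 p5]; exact h.head e
  · rw [hF.nmem 2 p6]; exact h.path
  · rw [hF.nmem 3 p7]; exact h.parent
  · rw [hF.nmem 6 p8]; exact h.good
  · rw [hF.nmem 7 p9]; exact h.depth
  · rw [hF.rmem 0 p10]; exact h.weight e
  · rw [hF.rmem 7 p11]; exact h.pre

open Program in
/-- Deals with the level in register 3. -/
def level : Program :=
  updateTop.seq <| (search 0 1 false).seq <| copySearch.seq <| (search 1 0 true).seq <|
  clearMinima.seq <| backwardSweep.seq <| forwardSweep.seq <| potentialAt.seq potentialBelow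

/-- The state when the levels `d, d + 1, …` have been dealt with. -/
structure LevelsDone (n m ℓ : ℕ) (T H P par good dep : ℕ → ℕ) (w pre : ℕ → ℝ) (d : ℕ) (σ : State) :
    Prop where
  inputs : Inputs n m (ℓ + 1) T H P par good dep w pre σ
  top : ∀ v < n, d ≤ dep v → σ.nmem 19 v = Forest.top par dep d v
  -- Depth greater than `d - 1`, that is, the levels already dealt with.
  feasible : Elimination.FeasibleAbove m T H dep good w (σ.rmem 5) (d - 1)
  output : OutputAbove m T H dep good w P pre ℓ d (σ.nmem 4) (σ.rmem 1)
  cur : ∀ y, σ.nmem 12 y = 0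
  bkt : ∀ r, σ.nmem 17 r = 0

/-- The forward search is copied before the backward search overwrites its arrays, and the
potentials change only after both have used them. Since ℓ < n, the ℓ + 1 updates of the tournament
tree stay within O(n log n). -/
theorem wp_level {B n m ℓ d : ℕ} {T H P par good dep : ℕ → ℕ} {w pre : ℕ → ℝ} (hBn : 2 * n < B)
    (hBm : 2 * m + 4 ≤ B) (h : Elimination n m T H par dep good w) (hd : 1 ≤ d)
    (hP : ∀ j ≤ ℓ, P j < n) (hl : ℓ < n) {σ : State} {t : ℕ}
    (hI : LevelsDone n m ℓ T H P par good dep w pre (d + 1) σ) (h3 : σ.nreg 3 = d) :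
    wp B level (fun τ t' => LevelsDone n m ℓ T H P par good dep w pre d τ ∧
      t' ≤ t + 20000 * (m + (n + 1) * (Nat.log 2 m + Nat.log 2 n + 3))) σ t := by
  obtain ⟨hI, htop, hfeas, hout, hcur, hbkt⟩ := hI
  unfold level
  refine wp_use (p := updateTop) (wp_updateTop (by omega) hI.n h3 hI.parent hI.depth htop) ?_
  rintro σ₁ t₁ hF₁ ⟨top₁, ht₁⟩
  have hI₁ := hI.frame hF₁ rfl
  have d₁ : σ₁.nreg 3 = d := (hF₁.nreg 3 rfl).trans h3
  have p₁ : σ₁.rmem 5 = σ.rmem 5 := hF₁.rmem 5 rfl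
  have wf₁ := Elimination.wellFormed (good := good) (lv := dep) (w := w) (p := σ.rmem 5) (d := d)
    h.tail_lt h.head_lt
  refine wp_use (p := search 0 1 false) (wp_search (p := σ.rmem 5) (by omega) hBm (by omega)
    (by omega) hI₁.n hI₁.m d₁ hI₁.tail hI₁.head hI₁.weight hI₁.good hI₁.depth (fun v => by simp [p₁])
    h.tail_lt h.head_lt (by rw [hF₁.nmem 12 rfl]; exact hcur)
    (by rw [hF₁.nmem 17 rfl]; exact hbkt)) ?_
  rintro σ₂ t₂ hF₂ ⟨hS₂, hcur₂, hbkt₂, ht₂⟩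
  have hI₂ := hI₁.frame hF₂ rfl
  refine wp_use (p := copySearch) (wp_copySearch (by omega) hI₂.n) ?_
  rintro σ₃ t₃ hF₃ ⟨hc₃, ht₃⟩
  have hS₃ := hS₂.congr_values wf₁ hc₃
  have hI₃ := hI₂.frame hF₃ rfl
  have d₃ : σ₃.nreg 3 = d := (hF₃.nreg 3 rfl).trans ((hF₂.nreg 3 rfl).trans d₁)
  have p₃ : σ₃.rmem 5 = σ.rmem 5 := (hF₃.rmem 5 rfl).trans ((hF₂.rmem 5 rfl).trans p₁)
  refine wp_use (p := search 1 0 true) (wp_search (p := fun v => - σ.rmem 5 v) (by omega) hBm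
    (by omega) (by omega) hI₃.n hI₃.m d₃ hI₃.head hI₃.tail hI₃.weight hI₃.good hI₃.depth
    (fun v => by simp [p₃])
    h.head_lt h.tail_lt (by rw [hF₃.nmem 12 rfl]; exact hcur₂)
    (by rw [hF₃.nmem 17 rfl]; exact hbkt₂)) ?_
  rintro σ₄ t₄ hF₄ ⟨hS₄, hcur₄, hbkt₄, ht₄⟩
  have hI₄ := hI₃.frame hF₄ rfl
  refine wp_use (p := clearMinima) (wp_clearMinima hBn hI₄.n) ?_
  rintro σ₅ t₅ hF₅ ⟨hz₅, hz₅', ht₅⟩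
  have hI₅ := hI₄.frame hF₅ rfl
  have d₅ : σ₅.nreg 3 = d := (hF₅.nreg 3 rfl).trans ((hF₄.nreg 3 rfl).trans d₃)
  have q₅ : σ₅.nmem 19 = σ₁.nmem 19 := (hF₅.nmem 19 rfl).trans ((hF₄.nmem 19 rfl).trans
    ((hF₃.nmem 19 rfl).trans (hF₂.nmem 19 rfl)))
  have fd₅ : σ₅.nmem 18 = σ₃.nmem 18 := (hF₅.nmem 18 rfl).trans (hF₄.nmem 18 rfl)
  have F₅ : σ₅.rmem 6 = σ₃.rmem 6 := (hF₅.rmem 6 rfl).trans (hF₄.rmem 6 rfl)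
  have htpn : ∀ j < ℓ + 1, d ≤ dep (P j) → σ₁.nmem 19 (P j) < n := by
    intro j hj hdj
    rw [top₁ _ (hP j (by omega)) hdj]
    exact h.forest.top_lt (hP j (by omega)) hd
  refine wp_use (p := backwardSweep) (wp_backwardSweep (n := n) (by omega) hI₅.lenP d₅ hI₅.path
    hI₅.depth q₅ fd₅ F₅ hI₅.pre (fun u hu => (hz₅ u hu).2) htpn) ?_
  rintro σ₆ t₆ hF₆ ⟨hB₆, hB₆', ht₆⟩
  have hI₆ := hI₅.frame hF₆ rfl
  have d₆ : σ₆.nreg 3 = d := (hF₆.nreg 3 rfl).trans d₅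
  have q₆ : σ₆.nmem 19 = σ₁.nmem 19 := (hF₆.nmem 19 rfl).trans q₅
  have bd₆ : σ₆.nmem 13 = σ₄.nmem 13 := (hF₆.nmem 13 rfl).trans (hF₅.nmem 13 rfl)
  have D₆ : σ₆.rmem 3 = σ₄.rmem 3 := (hF₆.rmem 3 rfl).trans (hF₅.rmem 3 rfl)
  refine wp_use (p := forwardSweep) (wp_forwardSweep (A' := fun u q => Portion dep (σ₁.nmem 19) P
      (σ₃.nmem 18) (fun b => σ₃.rmem 6 (P b) + (pre (ℓ + 1 - 1) - pre b)) d u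
      (fun b => q ≤ b ∧ b < ℓ + 1)) (by omega) hBn (by omega) hI₆.n hI₆.lenP d₆
      hI₆.path hI₆.depth q₆ bd₆ D₆ hI₆.pre htpn
      (fun u hu => by rw [hF₆.nmem 21 rfl]; exact (hz₅ u hu).1) hB₆ rfl rfl hB₆'
      (fun i hi => by rw [hF₆.nmem 24 rfl]; exact hz₅' i hi) ?_) ?_
  · intro j hj u hu hno x
    exact (Portion.congr (b := j) (fun a => by omega) (by tauto)).symm
  rintro σ₇ t₇ hF₇ ⟨ho₇, ht₇⟩
  have hI₇ := hI₆.frame hF₇ rfl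
  have d₇ : σ₇.nreg 3 = d := (hF₇.nreg 3 rfl).trans d₆
  have p₇ : σ₇.rmem 5 = σ.rmem 5 := (hF₇.rmem 5 rfl).trans ((hF₆.rmem 5 rfl).trans
    ((hF₅.rmem 5 rfl).trans ((hF₄.rmem 5 rfl).trans p₃)))
  refine wp_use (p := potentialAt) (wp_potentialAt (by omega) hI₇.m d₇ hI₇.tail hI₇.head hI₇.weight
    hI₇.good hI₇.depth p₇) ?_
  rintro σ₈ t₈ hF₈ ⟨hp₈, hp₈', ht₈⟩
  have hI₈ := hI₇.frame hF₈ rfl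
  have d₈ : σ₈.nreg 3 = d := (hF₈.nreg 3 rfl).trans d₇
  have q₈ : σ₈.nmem 19 = σ₁.nmem 19 := (hF₈.nmem 19 rfl).trans ((hF₇.nmem 19 rfl).trans q₆)
  have fd₈ : σ₈.nmem 18 = σ₃.nmem 18 := (hF₈.nmem 18 rfl).trans ((hF₇.nmem 18 rfl).trans
    ((hF₆.nmem 18 rfl).trans fd₅))
  have F₈ : σ₈.rmem 6 = σ₃.rmem 6 := (hF₈.rmem 6 rfl).trans ((hF₇.rmem 6 rfl).trans
    ((hF₆.rmem 6 rfl).trans F₅))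
  refine wp_use (p := potentialBelow) (wp_potentialBelow (by omega) hI₈.n d₈ hI₈.depth q₈ fd₈ F₈
    rfl fun v hv hdv => ?_) ?_
  · rw [top₁ v hv hdv.le]
    exact h.forest.dep_top hv hd hdv.le
  rintro σ₉ t₉ hF₉ ⟨hp₉, hp₉', ht₉⟩
  have hfeas' : Elimination.FeasibleAbove m T H dep good w (σ.rmem 5) d := hfeas
  refine ⟨⟨hI₈.frame hF₉ rfl, ?_, ?_, ?_, ?_, ?_⟩, ?_⟩
  · rw [hF₉.nmem 19 rfl, q₈]
    exact top₁
  · refine h.feasibleAbove_step hd hfeas' hS₃ ?_ ?_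
    · intro e e1 e2 e3 e4 e5
      rw [hp₉ _ e4.le]
      exact hp₈' e e1 e2 e3 e4 e5
    · intro v hv hdv
      have := hp₉' v hv hdv
      rwa [hp₈ v (by omega), top₁ v hv hdv.le] at this
  · have e4 : σ₉.nmem 4 = σ₇.nmem 4 := (hF₉.nmem 4 rfl).trans (hF₈.nmem 4 rfl)
    have e1 : σ₉.rmem 1 = σ₇.rmem 1 := (hF₉.rmem 1 rfl).trans (hF₈.rmem 1 rfl)
    have f4 : σ₆.nmem 4 = σ.nmem 4 := (hF₆.nmem 4 rfl).trans ((hF₅.nmem 4 rfl).trans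
      ((hF₄.nmem 4 rfl).trans ((hF₃.nmem 4 rfl).trans ((hF₂.nmem 4 rfl).trans (hF₁.nmem 4 rfl)))))
    have f1 : σ₆.rmem 1 = σ.rmem 1 := (hF₆.rmem 1 rfl).trans ((hF₅.rmem 1 rfl).trans
      ((hF₄.rmem 1 rfl).trans ((hF₃.rmem 1 rfl).trans ((hF₂.rmem 1 rfl).trans (hF₁.rmem 1 rfl)))))
    rw [e4, e1]
    rw [f4, f1] at ho₇
    exact h.outputAbove_step hd hfeas' hS₄ hS₃ hP top₁ hout fun i hi => ho₇ i (by omega)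
  · rw [hF₉.nmem 12 rfl, hF₈.nmem 12 rfl, hF₇.nmem 12 rfl, hF₆.nmem 12 rfl, hF₅.nmem 12 rfl]
    exact hcur₄
  · rw [hF₉.nmem 17 rfl, hF₈.nmem 17 rfl, hF₇.nmem 17 rfl, hF₆.nmem 17 rfl, hF₅.nmem 17 rfl]
    exact hbkt₄
  · generalize hN : (n + 1) * (Nat.log 2 m + Nat.log 2 n + 3) = N
    have h1 : (n + 1) * (Nat.log 2 m + 1) ≤ N := by
      rw [← hN]; exact Nat.mul_le_mul_left _ (by omega)
    have h2 : (ℓ + 1) * (200 * (Nat.log 2 n + 3)) ≤ 200 * N := by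
      calc (ℓ + 1) * (200 * (Nat.log 2 n + 3)) ≤ (n + 1) * (200 * (Nat.log 2 m + Nat.log 2 n + 3)) :=
            Nat.mul_le_mul (by omega) (by omega)
        _ = 200 * N := by rw [← hN]; ring
    have h3 : n + 1 ≤ N := by rw [← hN]; exact Nat.le_mul_of_pos_right _ (by omega)
    omega

end RealRAM


-- With `s` alone on level 0 the search is a plain reachability test, for which feasibility plays no
-- role. It skips edges into `s`, but `s` is marked anyway.
open RealRAM in
theorem done_iff_walk {n m s : ℕ} {T H good lv : ℕ → ℕ} {w p : ℕ → ℝ} {done : ℕ → ℕ} {D : ℕ → ℝ}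
    (h : (levelProblem n m T H good lv w p 0).Solved done D) (hs : s < n)
    (hg : ∀ e, 1 ≤ e → e ≤ m → good e = 1) (hlv : ∀ v < n, lv v = 0 ↔ v = s)
    (hH : ∀ e, 1 ≤ e → e ≤ m → H e < n) {v : ℕ} (hv : v < n) :
    done v = 1 ↔ ∃ L, Wk (ListedEdge m T H (fun _ => 1) w) s v L := by
  constructor
  · intro hd
    have hr := h.sound v hv hd
    generalize D v = L at hr
    refine ⟨L, ?_⟩
    clear hd hv
    induction hr with
    | src v hv hsv =>
      have : lv v = 0 := hsv
      obtain rfl := (hlv v hv).1 this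
      exact .nil _
    | step e d _ hE ih => exact ih.snoc ⟨e, hE.1, hE.2.1, rfl, rfl, rfl, rfl⟩
  · rintro ⟨L, hL⟩
    have hs' : done s = 1 := (h.src s hs ((hlv s hs).2 rfl)).1
    have key : ∀ x y L, Wk (ListedEdge m T H (fun _ => 1) w) x y L → done x = 1 → done y = 1 := by
      intro x y L hw
      induction hw with
      | nil x => exact id
      | cons e _ ih =>
        intro hx
        obtain ⟨e, e1, e2, -, rfl, rfl, rfl⟩ := e
        refine ih ?_
        by_cases hHs : H e = s
        · rw [hHs]; exact hs'
        · have h0 : lv (H e) ≠ 0 := fun h0 => hHs ((hlv _ (hH e e1 e2)).1 h0)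
          exact (h.closed e ⟨e1, e2, hg e e1 e2, Nat.zero_le _, Nat.pos_of_ne_zero h0⟩ hx).1
    exact key _ _ _ hL hs'

/-! ### Preparing the path, the detour edges and the depths -/

namespace RealRAM

open Function

open Program in
/-- Stores the successors on the path and the lengths of the initial parts of the path. -/
def preparePath : Program :=
  (forTo 30 (.reg 2) <|
    branch (.nlt (.add (.reg 30) (.lit 1)) (.reg 2))
      -- The successor is stored plus 1, since the entry 0 means that there is none.
      (nput 20 (.get 2 (.reg 30)) (.add (.get 2 (.add (.reg 30) (.lit 1))) (.lit 1))) skip).seq <|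
  (forTo 30 (.reg 1) <|
    branch (.neq (.get 20 (.get 0 (.reg 30))) (.add (.get 1 (.reg 30)) (.lit 1)))
      (rput 8 (.get 0 (.reg 30)) (.get 0 (.reg 30))) skip).seq <|
  forTo 30 (.sub (.reg 2) (.lit 1)) <|
    rput 7 (.add (.reg 30) (.lit 1)) (.add (.get 7 (.reg 30)) (.get 8 (.get 2 (.reg 30))))

open Program in
/-- Searches from the vertex with number `x` only. -/
def searchFrom (a b : ℕ) (s : Bool) (x : NExpr) : Program :=
  (forTo 30 (.reg 0) <| nput 7 (.reg 30) (.lit 1)).seq <|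
  (nput 7 x (.lit 0)).seq <| (nset 3 (.lit 0)).seq <| search a b s

open Program in
/-- Marks the edges that detours may use. -/
def markEdges : Program :=
  (forTo 30 (.reg 1) <| nput 6 (.add (.reg 30) (.lit 1)) (.lit 1)).seq <|
  (searchFrom 0 1 false (.get 2 (.lit 0))).seq <|
  (forTo 30 (.reg 0) <| nput 25 (.reg 30) (.get 13 (.reg 30))).seq <|
  (searchFrom 1 0 true (.get 2 (.sub (.reg 2) (.lit 1)))).seq <|
  forTo 30 (.reg 1) <|
    (nset 31 (.get 0 (.reg 30))).seq <|
    (nset 32 (.get 1 (.reg 30))).seq <|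
    branch (.and (.and (.neq (.get 25 (.reg 31)) (.lit 1)) (.neq (.get 13 (.reg 31)) (.lit 1)))
        (.and (.and (.neq (.get 25 (.reg 32)) (.lit 1)) (.neq (.get 13 (.reg 32)) (.lit 1)))
          (.neg (.neq (.get 20 (.reg 31)) (.add (.reg 32) (.lit 1)))))) skip
      (nput 6 (.add (.reg 30) (.lit 1)) (.lit 0))

open Program in
/-- Computes the depths in the forest. -/
def depths : Program :=
  (nset 41 (.lit 0)).seq <|
  forTo 30 (.reg 0) <|
    (nset 31 (.reg 30)).seq <|
    (nset 32 (.lit 0)).seq <|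
    (loop (.neg (.neq (.reg 31) (.reg 0))) <|
      (nset 31 (.get 3 (.reg 31))).seq (nset 32 (.add (.reg 32) (.lit 1)))).seq <|
    (nput 7 (.reg 30) (.reg 32)).seq <|
    branch (.nlt (.reg 41) (.reg 32)) (nset 41 (.reg 32)) skip

open Program in
/-- Deals with all levels, from the deepest one up to the roots. -/
def levels : Program :=
  forTo 40 (.reg 41) <| (nset 3 (.sub (.reg 41) (.reg 40))).seq level

/-- The whole algorithm. -/
def replacementPaths : Program :=
  preparePath.seq <| markEdges.seq <| depths.seq levels

section

attribute [local simp] wp NExpr.val NExpr.Need NExpr.cost RExpr.val RExpr.cost Test.Holds Test.cost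
  State.setReg

theorem wp_preparePath {B n m lenP : ℕ} {T H P : ℕ → ℕ} {w : ℕ → ℝ} (hn : n + 1 < B)
    (hm : m + 1 < B) (hl : lenP < B) {σ : State} {t : ℕ} (h1 : σ.nreg 1 = m) (h2 : σ.nreg 2 = lenP)
    (hT : ∀ e, σ.nmem 0 (e - 1) = T e) (hH : ∀ e, σ.nmem 1 (e - 1) = H e) (hP : σ.nmem 2 = P)
    (hw : ∀ e, σ.rmem 0 (e - 1) = w e) (hPn : ∀ j < lenP, P j < n)
    (hinj : ∀ i j, i < lenP → j < lenP → P i = P j → i = j)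
    (hsimple : ∀ e e', 1 ≤ e → e ≤ m → 1 ≤ e' → e' ≤ m → T e = T e' → H e = H e' → w e = w e')
    (h20 : ∀ v, σ.nmem 20 v = 0) (h7 : σ.rmem 7 0 = 0) :
    wp B preparePath (fun τ t' =>
      (∀ x y, τ.nmem 20 x = y + 1 ↔ ∃ j, j + 1 < lenP ∧ x = P j ∧ y = P (j + 1)) ∧
      τ.rmem 7 0 = 0 ∧ (∀ j, j + 1 < lenP → ∀ e, 1 ≤ e → e ≤ m → T e = P j → H e = P (j + 1) →
        τ.rmem 7 (j + 1) = τ.rmem 7 j + w e) ∧ t' ≤ t + 100 * (lenP + m + 1)) σ t := by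
  unfold preparePath
  refine wp_for (fun j σ' t' =>
    (∀ x y, σ'.nmem 20 x = y + 1 ↔ ∃ i < j, i + 1 < lenP ∧ x = P i ∧ y = P (i + 1)) ∧
    t' ≤ t + 2 + 30 * j) lenP (t + 2 + 30 * lenP) hl rfl ?_ ?_ ?_ ?_ ?_
  · intro σ' hF
    exact (hF.nreg 2 rfl).trans h2
  · simp [h20]
  · rintro j σ' t' hj ⟨-, h⟩; omega
  · rintro j σ' t' hj hF hx ⟨i1, i2⟩
    have e2 : σ'.nreg 2 = lenP := (hF.nreg 2 rfl).trans h2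
    have eP : σ'.nmem 2 = P := (hF.nmem 2 rfl).trans hP
    simp [hx, e2, eP]
    refine ⟨fun k => ⟨?_, fun x y => ?_, by omega⟩, fun k => ⟨fun x y => ?_, by omega⟩⟩
    · have := hPn _ k
      omega
    · by_cases hxj : x = P j
      · subst hxj
        rw [update_self]
        constructor
        · intro h
          exact ⟨j, le_rfl, k, rfl, by omega⟩
        · rintro ⟨i, hi, hi', h, rfl⟩
          rw [hinj _ _ hj (by omega) h]
      · rw [update_of_ne hxj, i1]
        constructor
        · rintro ⟨i, hi, h⟩; exact ⟨i, hi.le, h⟩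
        · rintro ⟨i, hi, h, rfl, h'⟩
          refine ⟨i, lt_of_le_of_ne hi ?_, h, rfl, h'⟩
          rintro rfl; exact hxj rfl
    · rw [i1]
      constructor
      · rintro ⟨i, hi, h⟩; exact ⟨i, hi.le, h⟩
      · rintro ⟨i, hi, h, h'⟩
        exact ⟨i, by omega, h, h'⟩
  rintro σ₁ t₁ hF₁ ⟨g1, g2⟩
  simp only [NExpr.cost]
  refine wp_for (fun j σ' t' =>
    (∀ e, 1 ≤ e → e ≤ j → ∀ i, i + 1 < lenP → T e = P i → H e = P (i + 1) → σ'.rmem 8 (P i) = w e) ∧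
    t' ≤ t + 10 + 30 * lenP + 30 * j) m (t + 10 + 30 * lenP + 30 * m) (by omega) rfl ?_ ?_ ?_ ?_ ?_
  · intro σ' hF
    exact (hF.nreg 1 rfl).trans ((hF₁.nreg 1 rfl).trans h1)
  · refine ⟨fun e h h' => by omega, by omega⟩
  · rintro j σ' t' hj ⟨-, h⟩; omega
  · rintro j σ' t' hj hF hx ⟨i1, i2⟩
    have e20 : σ'.nmem 20 = σ₁.nmem 20 := hF.nmem 20 rfl
    have eT : σ'.nmem 0 j = T (j + 1) := by rw [hF.nmem 0 rfl, hF₁.nmem 0 rfl, ← hT]; rfl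
    have eH : σ'.nmem 1 j = H (j + 1) := by rw [hF.nmem 1 rfl, hF₁.nmem 1 rfl, ← hH]; rfl
    have ew : σ'.rmem 0 j = w (j + 1) := by rw [hF.rmem 0 rfl, hF₁.rmem 0 rfl, ← hw]; rfl
    simp [hx, e20, eT, eH, ew]
    refine ⟨fun k => ⟨fun e he he' i hi hTi hHi => ?_, by omega⟩,
      fun k => ⟨fun e he he' i hi hTi hHi => ?_, by omega⟩⟩
    · by_cases hiT : P i = T (j + 1)
      · rw [hiT, update_self]
        obtain ⟨i', -, hi', a1, a2⟩ := (g1 _ _).1 k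
        refine hsimple _ _ (by omega) (by omega) he (by omega) ?_ ?_
        · rw [hTi, hiT]
        · rw [hHi, a2, hinj i i' (by omega) (by omega) (hiT.trans a1)]
      · rw [update_of_ne hiT]
        refine i1 e he ?_ i hi hTi hHi
        have : e ≠ j + 1 := by rintro rfl; exact hiT hTi.symm
        omega
    · refine i1 e he ?_ i hi hTi hHi
      have : e ≠ j + 1 := by
        rintro rfl
        exact k ((g1 _ _).2 ⟨i, by omega, hi, hTi, hHi⟩)
      omega
  rintro σ₂ t₂ hF₂ ⟨l1, l2⟩
  simp only [NExpr.cost]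
  refine wp_for (fun j σ' t' => σ'.rmem 7 0 = 0 ∧
    (∀ i < j, ∀ e, 1 ≤ e → e ≤ m → T e = P i → H e = P (i + 1) →
      σ'.rmem 7 (i + 1) = σ'.rmem 7 i + w e) ∧
    t' ≤ t + 20 + 30 * lenP + 30 * m + 30 * j) (lenP - 1) (t + 20 + 30 * lenP + 30 * m + 30 * (lenP - 1))
    (by omega) rfl ?_ ?_ ?_ ?_ ?_
  · intro σ' hF
    have : σ'.nreg 2 = lenP := (hF.nreg 2 rfl).trans ((hF₂.nreg 2 rfl).trans ((hF₁.nreg 2 rfl).trans h2))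
    simp [this]
  · refine ⟨?_, fun i hi => by omega, by omega⟩
    change σ₂.rmem 7 0 = 0
    rw [hF₂.rmem 7 rfl, hF₁.rmem 7 rfl, h7]
  · rintro j σ' t' hj ⟨-, -, h⟩; omega
  · rintro j σ' t' hj hF hx ⟨i1, i2, i3⟩
    have e8 : σ'.rmem 8 = σ₂.rmem 8 := hF.rmem 8 rfl
    have eP : σ'.nmem 2 = P := (hF.nmem 2 rfl).trans ((hF₂.nmem 2 rfl).trans ((hF₁.nmem 2 rfl).trans hP))
    simp [hx, e8, eP]
    refine ⟨i1, fun i hi e he he' hTi hHi => ?_, by omega⟩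
    rw [update_of_ne (show i ≠ j + 1 by omega)]
    by_cases hij : i = j
    · subst hij
      rw [update_self, l1 e he he' i (by omega) hTi hHi]
    · rw [update_of_ne (by omega)]
      exact i2 i (by omega) e he he' hTi hHi
  · rintro τ t' hF ⟨i1, i2, i3⟩
    have e20 : τ.nmem 20 = σ₁.nmem 20 := (hF.nmem 20 rfl).trans (hF₂.nmem 20 rfl)
    rw [e20]
    simp
    refine ⟨fun x y => ?_, i1, fun j hj => i2 j (by omega), by omega⟩
    rw [g1]
    constructor
    · rintro ⟨i, -, h⟩; exact ⟨i, h⟩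
    · rintro ⟨i, h, h'⟩; exact ⟨i, by omega, h, h'⟩

/-- Array 7 serves as a temporary list of levels here and holds the depths later. Its entries from
`n` on are preserved because entry `n` has to remain 0, the depth of the sentinel. -/
theorem wp_searchFrom {B n m a b s : ℕ} {c : Bool} {x : NExpr} {T H : ℕ → ℕ} {w : ℕ → ℝ}
    (hBn : n < B) (hBm : 2 * m + 4 ≤ B) (ha : a < 2) (hb : b < 2) {σ : State} {t : ℕ}
    (hn : σ.nreg 0 = n) (hm : σ.nreg 1 = m)
    (hT : ∀ e, σ.nmem a (e - 1) = T e) (hH : ∀ e, σ.nmem b (e - 1) = H e)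
    (hw : ∀ e, σ.rmem 0 (e - 1) = w e) (hgood : ∀ e, 1 ≤ e → e ≤ m → σ.nmem 6 e = 1)
    (hTn : ∀ e, 1 ≤ e → e ≤ m → T e < n) (hHn : ∀ e, 1 ≤ e → e ≤ m → H e < n)
    (hcur : ∀ y, σ.nmem 12 y = 0) (hbkt : ∀ r, σ.nmem 17 r = 0) (hs : s < n)
    (hx : ∀ τ, Frame (.forTo 30 (.reg 0) (.nput 7 (.reg 30) (.lit 1))) σ τ → x.val τ = s)
    (hxc : x.cost ≤ 10) :
    wp B (searchFrom a b c x) (fun τ t' =>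
      (∀ v < n, τ.nmem 13 v = 1 ↔ ∃ L, Wk (ListedEdge m T H (fun _ => 1) w) s v L) ∧
      (∀ y, τ.nmem 12 y = 0) ∧ (∀ r, τ.nmem 17 r = 0) ∧
      (∀ v, n ≤ v → τ.nmem 7 v = σ.nmem 7 v) ∧
      t' ≤ t + 5100 * (m + (n + 1) * (Nat.log 2 m + 1))) σ t := by
  unfold searchFrom
  refine wp_for (fun j σ' t' => (∀ v < j, σ'.nmem 7 v = 1) ∧
    (∀ v, j ≤ v → σ'.nmem 7 v = σ.nmem 7 v) ∧
    t' ≤ t + 2 + 20 * j) n (t + 2 + 20 * n) hBn rfl ?_ ?_ ?_ ?_ ?_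
  · intro σ' hF
    exact (hF.nreg 0 rfl).trans hn
  · simp
  · rintro j σ' t' hj ⟨-, -, h⟩; omega
  · rintro j σ' t' hj hF hx ⟨h1, h2, h3⟩
    simp [hx]
    refine ⟨fun v hv => ?_, fun v hv => ?_, by omega⟩
    · by_cases hvj : v = j
      · subst hvj; simp
      · simp [hvj]
        exact h1 v (by omega)
    · rw [update_of_ne (by omega)]
      exact h2 v (by omega)
  rintro σ₁ t₁ hF₁ ⟨g1, g2, g3⟩
  have hxv := hx _ hF₁
  have ha7 : (7 : ℕ) ≠ a := by omega
  have hb7 : (7 : ℕ) ≠ b := by omega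
  refine ⟨trivial, trivial, ?_⟩
  simp only [NExpr.cost, NExpr.val, hxv]
  refine wp_use (p := search a b c) (wp_search (T := T) (H := H) (w := w) (p := fun v =>
      if c then -σ₁.rmem 5 v else σ₁.rmem 5 v) (good := σ.nmem 6)
      (lv := update (σ₁.nmem 7) s 0) (d := 0) hBn hBm ha hb ?_ ?_ ?_ ?_ ?_ ?_ ?_ ?_ ?_
      hTn hHn ?_ ?_) ?_
  · simpa [hF₁.nreg 0 rfl] using hn
  · simpa [hF₁.nreg 1 rfl] using hm
  · simp
  · intro e
    simp only [update_of_ne ha7.symm]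
    rw [hF₁.nmem a (by simp [Program.forTo, Program.writesNMem]; omega)]
    exact hT e
  · intro e
    simp only [update_of_ne hb7.symm]
    rw [hF₁.nmem b (by simp [Program.forTo, Program.writesNMem]; omega)]
    exact hH e
  · intro e
    rw [← hw e, ← hF₁.rmem 0 rfl]
  · simp [hF₁.nmem 6 rfl]
  · simp
  · intro v; rfl
  · simpa [hF₁.nmem 12 rfl] using hcur
  · simpa [hF₁.nmem 17 rfl] using hbkt
  rintro τ t' hF ⟨hS, h1, h2, h3⟩
  refine ⟨fun v hv => done_iff_walk hS hs hgood (fun v hv => ?_) hHn hv, h1, h2, fun v hv => ?_, ?_⟩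
  · by_cases hvs : v = s
    · simp [hvs]
    · simp [hvs, g1 v hv]
  · rw [hF.nmem 7 (by cases c <;> rfl)]
    simp only [update_self]
    rw [update_of_ne (by omega)]
    exact g2 v hv
  · have : n + 1 ≤ (n + 1) * (Nat.log 2 m + 1) := Nat.le_mul_of_pos_right _ (by omega)
    generalize (n + 1) * (Nat.log 2 m + 1) = N at h3 this ⊢
    omega

theorem wp_markEdges {B n m ℓ : ℕ} {T H P : ℕ → ℕ} {w : ℕ → ℝ}
    (hBn : n + 1 < B) (hBm : 2 * m + 4 ≤ B) {σ : State} {t : ℕ}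
    (hn : σ.nreg 0 = n) (hm : σ.nreg 1 = m) (hl : σ.nreg 2 = ℓ + 1)
    (hT : ∀ e, σ.nmem 0 (e - 1) = T e) (hH : ∀ e, σ.nmem 1 (e - 1) = H e)
    (hw : ∀ e, σ.rmem 0 (e - 1) = w e) (hP : σ.nmem 2 = P)
    (hTn : ∀ e, 1 ≤ e → e ≤ m → T e < n) (hHn : ∀ e, 1 ≤ e → e ≤ m → H e < n)
    (hcur : ∀ y, σ.nmem 12 y = 0) (hbkt : ∀ r, σ.nmem 17 r = 0) (hP0 : P 0 < n) (hPl : P ℓ < n) :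
    wp B markEdges (fun τ t' =>
      (∀ e, 1 ≤ e → e ≤ m → (τ.nmem 6 e = 1 ↔
        ShortestPath.Relevant (ListedEdge m T H (fun _ => 1) w) P ℓ (T e) ∧
        ShortestPath.Relevant (ListedEdge m T H (fun _ => 1) w) P ℓ (H e) ∧
        σ.nmem 20 (T e) ≠ H e + 1)) ∧
      (∀ y, τ.nmem 12 y = 0) ∧ (∀ r, τ.nmem 17 r = 0) ∧
      (∀ v, n ≤ v → τ.nmem 7 v = σ.nmem 7 v) ∧
      t' ≤ t + 12000 * (m + (n + 1) * (Nat.log 2 m + 1))) σ t := by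
  unfold markEdges
  refine wp_for (fun j σ' t' => (∀ e, 1 ≤ e → e ≤ j → σ'.nmem 6 e = 1) ∧
    t' ≤ t + 2 + 20 * j) m (t + 2 + 20 * m) (by omega) rfl ?_ ?_ ?_ ?_ ?_
  · intro σ' hF
    exact (hF.nreg 1 rfl).trans hm
  · refine ⟨fun e h h' => by omega, by omega⟩
  · rintro j σ' t' hj ⟨-, h⟩; omega
  · rintro j σ' t' hj hF hx ⟨h1, h2⟩
    simp [hx]
    refine ⟨fun e he he' => ?_, by omega⟩
    by_cases hej : e = j + 1
    · subst hej; simp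
    · simp [hej]
      exact h1 e he (by omega)
  rintro σ₁ t₁ hF₁ ⟨g1, g2⟩
  refine wp_use (p := searchFrom 0 1 false _) (wp_searchFrom (s := P 0) (T := T) (H := H) (w := w)
    (by omega) hBm (by omega) (by omega)
    ((hF₁.nreg 0 rfl).trans hn) ((hF₁.nreg 1 rfl).trans hm)
    (by rw [hF₁.nmem 0 rfl]; exact hT) (by rw [hF₁.nmem 1 rfl]; exact hH)
    (by rw [hF₁.rmem 0 rfl]; exact hw) g1 hTn hHn (by rw [hF₁.nmem 12 rfl]; exact hcur)
    (by rw [hF₁.nmem 17 rfl]; exact hbkt) hP0 ?_ (by simp)) ?_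
  · intro τ hF
    simp [hF.nmem 2 rfl, hF₁.nmem 2 rfl, hP]
  rintro σ₂ t₂ hF₂ ⟨r1, r2, r3, r4, r5⟩
  refine wp_for (fun j σ' t' => (∀ v < j, σ'.nmem 25 v = σ₂.nmem 13 v) ∧
    t' ≤ t₂ + 2 + 20 * j) n (t₂ + 2 + 20 * n) (by omega) rfl ?_ ?_ ?_ ?_ ?_
  · intro σ' hF
    exact (hF.nreg 0 rfl).trans ((hF₂.nreg 0 rfl).trans ((hF₁.nreg 0 rfl).trans hn))
  · simp
  · rintro j σ' t' hj ⟨-, h⟩; omega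
  · rintro j σ' t' hj hF hx ⟨h1, h2⟩
    have e1 : σ'.nmem 13 = σ₂.nmem 13 := hF.nmem 13 rfl
    simp [hx, e1]
    refine ⟨fun v hv => ?_, by omega⟩
    by_cases hvj : v = j
    · subst hvj; simp
    · simp [hvj]
      exact h1 v (by omega)
  rintro σ₃ t₃ hF₃ ⟨c1, c2⟩
  have hm6 : σ₃.nmem 6 = σ₁.nmem 6 := (hF₃.nmem 6 rfl).trans (hF₂.nmem 6 rfl)
  have n0 : σ₃.nreg 0 = n := (hF₃.nreg 0 rfl).trans ((hF₂.nreg 0 rfl).trans ((hF₁.nreg 0 rfl).trans hn))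
  have n1 : σ₃.nreg 1 = m := (hF₃.nreg 1 rfl).trans ((hF₂.nreg 1 rfl).trans ((hF₁.nreg 1 rfl).trans hm))
  have n2 : σ₃.nreg 2 = ℓ + 1 :=
    (hF₃.nreg 2 rfl).trans ((hF₂.nreg 2 rfl).trans ((hF₁.nreg 2 rfl).trans hl))
  have m0 : σ₃.nmem 0 = σ.nmem 0 := (hF₃.nmem 0 rfl).trans ((hF₂.nmem 0 rfl).trans (hF₁.nmem 0 rfl))
  have m1 : σ₃.nmem 1 = σ.nmem 1 := (hF₃.nmem 1 rfl).trans ((hF₂.nmem 1 rfl).trans (hF₁.nmem 1 rfl))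
  have m2 : σ₃.nmem 2 = P := (hF₃.nmem 2 rfl).trans ((hF₂.nmem 2 rfl).trans ((hF₁.nmem 2 rfl).trans hP))
  have m20 : σ₃.nmem 20 = σ.nmem 20 :=
    (hF₃.nmem 20 rfl).trans ((hF₂.nmem 20 rfl).trans (hF₁.nmem 20 rfl))
  have w0 : σ₃.rmem 0 = σ.rmem 0 := (hF₃.rmem 0 rfl).trans ((hF₂.rmem 0 rfl).trans (hF₁.rmem 0 rfl))
  refine wp_use (p := searchFrom 1 0 true _) (wp_searchFrom (s := P ℓ) (T := H) (H := T) (w := w)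
    (by omega) hBm (by omega) (by omega) n0 n1
    (by rw [m1]; exact hH) (by rw [m0]; exact hT)
    (by rw [w0]; exact hw) (by rw [hm6]; exact g1) hHn hTn (by rw [hF₃.nmem 12 rfl]; exact r2)
    (by rw [hF₃.nmem 17 rfl]; exact r3) hPl ?_ (by simp)) ?_
  · intro τ hF
    simp [hF.nmem 2 rfl, hF.nreg 2 rfl, m2, n2]
  rintro σ₄ t₄ hF₄ ⟨s1, s2, s3, s4, s5⟩
  -- Array 25 keeps what is reachable from `P 0`; the second search, in the reversed graph, marks
  -- what reaches `P ℓ`.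
  have hrel : ∀ v < n, (σ₄.nmem 25 v = 1 ∧ σ₄.nmem 13 v = 1) ↔
      ShortestPath.Relevant (ListedEdge m T H (fun _ => 1) w) P ℓ v := by
    intro v hv
    rw [s1 v hv, hF₄.nmem 25 rfl, c1 v hv, r1 v hv]
    refine and_congr_right fun _ => exists_congr fun L => ⟨fun h => h.reverse.mono ?_,
      fun h => h.reverse.mono ?_⟩ <;>
    · rintro x y c ⟨e, h1, h2, h3, h4, h5, h6⟩
      exact ⟨e, h1, h2, h3, h5, h4, h6⟩
  refine wp_for (fun j σ' t' => (∀ e, 1 ≤ e → e ≤ j → (σ'.nmem 6 e = 1 ↔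
        ShortestPath.Relevant (ListedEdge m T H (fun _ => 1) w) P ℓ (T e) ∧
        ShortestPath.Relevant (ListedEdge m T H (fun _ => 1) w) P ℓ (H e) ∧
        σ.nmem 20 (T e) ≠ H e + 1)) ∧ (∀ e, j < e → σ'.nmem 6 e = σ₁.nmem 6 e) ∧
    t' ≤ t₄ + 2 + 60 * j) m (t₄ + 2 + 60 * m) (by omega) rfl ?_ ?_ ?_ ?_ ?_
  · intro σ' hF
    exact (hF.nreg 1 rfl).trans ((hF₄.nreg 1 rfl).trans n1)
  · refine ⟨fun e h h' => by omega, fun e _ => ?_, by omega⟩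
    change σ₄.nmem 6 e = σ₁.nmem 6 e
    rw [hF₄.nmem 6 rfl, hm6]
  · rintro j σ' t' hj ⟨-, -, h⟩; omega
  · rintro j σ' t' hj hF hx ⟨h1, h2, h3⟩
    have eT : σ'.nmem 0 j = T (j + 1) := by
      rw [hF.nmem 0 rfl, hF₄.nmem 0 rfl, m0, ← hT]; rfl
    have eH : σ'.nmem 1 j = H (j + 1) := by
      rw [hF.nmem 1 rfl, hF₄.nmem 1 rfl, m1, ← hH]; rfl
    have e25 : σ'.nmem 25 = σ₄.nmem 25 := hF.nmem 25 rfl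
    have e13 : σ'.nmem 13 = σ₄.nmem 13 := hF.nmem 13 rfl
    have e20 : σ'.nmem 20 = σ.nmem 20 := (hF.nmem 20 rfl).trans ((hF₄.nmem 20 rfl).trans m20)
    have hrT := hrel _ (hTn (j + 1) (by omega) (by omega))
    have hrH := hrel _ (hHn (j + 1) (by omega) (by omega))
    simp [hx, eT, eH, e25, e13, e20]
    refine ⟨fun k1 k2 k3 k4 k5 => ⟨fun e he he' => ?_, fun e he => h2 e (by omega), by omega⟩,
      fun k => ⟨fun e he he' => ?_, fun e he => ?_, by omega⟩⟩
    · by_cases hej : e = j + 1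
      · subst hej
        rw [h2 _ (by omega), g1 _ (by omega) (by omega)]
        simp only [true_iff]
        exact ⟨hrT.1 ⟨k1, k2⟩, hrH.1 ⟨k3, k4⟩, k5⟩
      · exact h1 e he (by omega)
    · by_cases hej : e = j + 1
      · subst hej
        rw [update_self]
        simp only [zero_ne_one, false_iff]
        rintro ⟨q1, q2, q3⟩
        exact q3 (k (hrT.2 q1).1 (hrT.2 q1).2 (hrH.2 q2).1 (hrH.2 q2).2)
      · rw [update_of_ne hej]
        exact h1 e he (by omega)
    · rw [update_of_ne (by omega)]
      exact h2 e (by omega)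
  · rintro τ t' hF ⟨h1, h2, h3⟩
    refine ⟨h1, ?_, ?_, fun v hv => ?_, ?_⟩
    · rw [hF.nmem 12 rfl]; exact s2
    · rw [hF.nmem 17 rfl]; exact s3
    · rw [hF.nmem 7 rfl, s4 v hv, hF₃.nmem 7 rfl, r4 v hv, hF₁.nmem 7 rfl]
    · simp only [NExpr.cost] at *
      have : n + 1 ≤ (n + 1) * (Nat.log 2 m + 1) := Nat.le_mul_of_pos_right _ (by omega)
      generalize (n + 1) * (Nat.log 2 m + 1) = N at r5 s5 this ⊢
      omega

/-- Climbing from every vertex to the sentinel takes O(k) rounds each. The total O(k n) is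
affordable, so no traversal of the forest is needed. -/
theorem wp_depths {B n k : ℕ} {par dep : ℕ → ℕ} (hn : n + 1 < B) (hf : Forest n par dep)
    (hk : ∀ v < n, dep v ≤ k) (hkn : k ≤ n) {σ : State} {t : ℕ} (h0 : σ.nreg 0 = n)
    (hpar : σ.nmem 3 = par) :
    wp B depths (fun τ t' => (∀ v < n, τ.nmem 7 v = dep v) ∧
      (∀ v, n ≤ v → τ.nmem 7 v = σ.nmem 7 v) ∧ (∀ v < n, dep v ≤ τ.nreg 41) ∧ τ.nreg 41 ≤ k ∧
      t' ≤ t + 10 + n * (20 * k + 60)) σ t := by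
  have hpn : ∀ v < n, par v ≤ n ∧ dep v = dep (par v) + 1 := fun v hv =>
    ⟨hf.par_le v hv, hf.dep_par v hv⟩
  generalize hE : 20 * k + 60 = E
  unfold depths
  refine ⟨trivial, ?_⟩
  refine wp_for (fun j σ' t' => (∀ v < j, σ'.nmem 7 v = dep v) ∧
      (∀ v, j ≤ v → σ'.nmem 7 v = σ.nmem 7 v) ∧ (∀ v < j, dep v ≤ σ'.nreg 41) ∧ σ'.nreg 41 ≤ k ∧
      t' ≤ t + 4 + j * E) n (t + 4 + n * E) (by omega) rfl ?_ ?_ ?_ ?_ ?_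
  · intro σ' hF
    exact (hF.nreg 0 rfl).trans (by simpa using h0)
  · simp
  · rintro j σ' t' hj ⟨-, -, -, -, h⟩
    have := Nat.mul_le_mul_right E hj
    omega
  · rintro j σ' t' hj hF hx ⟨i1, i2, i3, i4, i5⟩
    have hEj : (j + 1) * E = j * E + E := by ring
    have e0 : σ'.nreg 0 = n := (hF.nreg 0 rfl).trans (by simpa using h0)
    have ep : σ'.nmem 3 = par := (hF.nmem 3 rfl).trans hpar
    have hkj := hk j hj
    refine ⟨trivial, trivial, ?_⟩
    change wp B (.loop _ _) _ _ _
    refine wp_loop (fun τ t'' => τ.nreg 31 ≤ n ∧ τ.nreg 32 + dep (τ.nreg 31) = dep j ∧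
      t'' ≤ t' + 20 + 20 * τ.nreg 32) (t' + 20 + 20 * k) ?_ ?_ ?_ ?_
    · simp [hx]
      omega
    · rintro τ t'' ⟨-, h1, h2⟩; omega
    · rintro τ t'' hF' ⟨h1, h2, h3⟩ hb
      have f0 : τ.nreg 0 = n := (hF'.nreg 0 rfl).trans (by simpa using e0)
      have fp : τ.nmem 3 = par := (hF'.nmem 3 rfl).trans (by simpa using ep)
      simp [f0] at hb
      obtain ⟨g1, g2⟩ := hpn _ (lt_of_le_of_ne h1 hb)
      simp [fp]
      omega
    · rintro τ t'' hF' ⟨h1, h2, h3⟩ hb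
      have f0 : τ.nreg 0 = n := (hF'.nreg 0 rfl).trans (by simpa using e0)
      have fj : τ.nreg 30 = j := (hF'.nreg 30 rfl).trans (by simpa using hx)
      have f41 : τ.nreg 41 = σ'.nreg 41 := (hF'.nreg 41 rfl).trans (by simp)
      have f7 : τ.nmem 7 = σ'.nmem 7 := (hF'.nmem 7 rfl).trans (by simp)
      have hb' : τ.nreg 31 = n := by simpa [f0] using hb
      rw [hb', hf.dep_n, add_zero] at h2
      have a1 : ∀ v ≤ j, update (σ'.nmem 7) j (dep j) v = dep v := by
        intro v hv
        by_cases hvj : v = j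
        · subst hvj; simp
        · rw [update_of_ne hvj]; exact i1 v (by omega)
      have a2 : ∀ v, j < v → update (σ'.nmem 7) j (dep j) v = σ.nmem 7 v := by
        intro v hv
        rw [update_of_ne (by omega)]; exact i2 v (by omega)
      simp [fj, f41, f7, h2]
      refine ⟨fun hlt => ⟨a1, a2, fun v hv => ?_, hkj, by omega⟩, fun hlt => ⟨a1, a2, fun v hv => ?_,
        i4, by omega⟩⟩
      · by_cases hvj : v = j
        · subst hvj; rfl
        · have := i3 v (by omega); omega
      · by_cases hvj : v = j
        · subst hvj; exact hlt
        · exact i3 v (by omega)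
  · rintro τ t' hF ⟨i1, i2, i3, i4, i5⟩
    simp only [NExpr.cost]
    exact ⟨i1, i2, i3, i4, by omega⟩

theorem wp_levels {B n m ℓ K : ℕ} {T H P par good dep : ℕ → ℕ} {w pre : ℕ → ℝ} (hBn : 2 * n < B)
    (hBm : 2 * m + 4 ≤ B) (hK : K < B) (h : Elimination n m T H par dep good w)
    (hP : ∀ j ≤ ℓ, P j < n) (hl : ℓ < n) {σ : State} {t : ℕ}
    (hI : LevelsDone n m ℓ T H P par good dep w pre (K + 1) σ) (h41 : σ.nreg 41 = K) :
    wp B levels (fun τ t' => LevelsDone n m ℓ T H P par good dep w pre 1 τ ∧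
      t' ≤ t + 10 + K * (20000 * (m + (n + 1) * (Nat.log 2 m + Nat.log 2 n + 3)) + 50)) σ t := by
  have hset : ∀ {d : ℕ} {τ : State} (x v : ℕ), 3 ≤ x →
      LevelsDone n m ℓ T H P par good dep w pre d τ →
      LevelsDone n m ℓ T H P par good dep w pre d (τ.setReg x v) := by
    intro d τ x v hx hτ
    obtain ⟨⟨a1, a2, a3, a4, a5, a6, a7, a8, a9, a10, a11⟩, b2, b3, b4, b5, b6⟩ := hτ
    refine ⟨⟨?_, ?_, ?_, a4, a5, a6, a7, a8, a9, a10, a11⟩, b2, b3, b4, b5, b6⟩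
    · simpa [State.setReg, update_of_ne (show (0 : ℕ) ≠ x by omega)] using a1
    · simpa [State.setReg, update_of_ne (show (1 : ℕ) ≠ x by omega)] using a2
    · simpa [State.setReg, update_of_ne (show (2 : ℕ) ≠ x by omega)] using a3
  generalize hE : 20000 * (m + (n + 1) * (Nat.log 2 m + Nat.log 2 n + 3)) = E
  refine wp_for (fun j σ' t' => LevelsDone n m ℓ T H P par good dep w pre (K + 1 - j) σ' ∧
    t' ≤ t + 2 + j * (E + 50)) K (t + 2 + K * (E + 50)) hK rfl ?_ ?_ ?_ ?_ ?_
  · intro σ' hF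
    exact (hF.nreg 41 rfl).trans h41
  · exact ⟨hset _ _ (by omega) hI, by omega⟩
  · rintro j σ' t' hj ⟨-, h⟩
    have := Nat.mul_le_mul_right (E + 50) hj
    omega
  · rintro j σ' t' hj hF hx ⟨i1, i2⟩
    have e41 : σ'.nreg 41 = K := (hF.nreg 41 rfl).trans h41
    have hEj : (j + 1) * (E + 50) = j * (E + 50) + (E + 50) := by ring
    obtain ⟨d, hd⟩ : ∃ d, K - j = d := ⟨_, rfl⟩
    refine ⟨trivial, ?_⟩
    refine wp_mono ?_ (wp_level (d := d) hBn hBm h (by omega) hP hl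
      (hset 3 (((NExpr.reg 41).sub (.reg 40)).val σ') le_rfl
        (show LevelsDone n m ℓ T H P par good dep w pre (d + 1) σ' from ?_)) ?_)
    · rintro τ t'' ⟨h1, h2⟩
      refine ⟨hset _ _ (by omega) ?_, ?_⟩
      · rwa [show K + 1 - (j + 1) = d by omega]
      · rw [hE] at h2
        simp at h2
        omega
    · rwa [show d + 1 = K + 1 - j by omega]
    · simp [e41, hx, hd]
  · rintro τ t' hF ⟨i1, i2⟩
    simp only [NExpr.cost]
    refine ⟨by simpa using i1, by omega⟩

end

end RealRAM


/-! ### Correctness and running time of the whole algorithm -/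

/-- A shortest path in a graph with listed edges and an elimination forest; everything is given by
numbers. -/
structure ReplacementInstance (n m ℓ k : ℕ) (T H P par dep : ℕ → ℕ) (w : ℕ → ℝ) : Prop where
  forest : Forest n par dep
  depth_le : ∀ v < n, dep v ≤ k
  depth_le_size : k ≤ n
  tail_lt : ∀ e, 1 ≤ e → e ≤ m → T e < n
  head_lt : ∀ e, 1 ≤ e → e ≤ m → H e < n
  comparable : ∀ e, 1 ≤ e → e ≤ m → Forest.Comparable par dep (T e) (H e)
  simple : ∀ e e', 1 ≤ e → e ≤ m → 1 ≤ e' → e' ≤ m → T e = T e' → H e = H e' → w e = w e'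
  path_lt : ∀ j ≤ ℓ, P j < n
  path_inj : ∀ i j, i ≤ ℓ → j ≤ ℓ → P i = P j → i = j
  path_edge : ∀ j < ℓ, ∃ e, 1 ≤ e ∧ e ≤ m ∧ T e = P j ∧ H e = P (j + 1)
  -- Stated for every function with the right increments, because the actual one is an array that
  -- the program computes.
  shortest : ∀ pre : ℕ → ℝ, pre 0 = 0 →
    (∀ j < ℓ, ∀ e, 1 ≤ e → e ≤ m → T e = P j → H e = P (j + 1) → pre (j + 1) = pre j + w e) →
    ∀ L, Wk (ListedEdge m T H (fun _ => 1) w) (P 0) (P ℓ) L → pre ℓ ≤ L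

namespace ReplacementInstance

variable {n m ℓ k : ℕ} {T H P par dep : ℕ → ℕ} {w pre : ℕ → ℝ}

theorem shortestPath (h : ReplacementInstance n m ℓ k T H P par dep w) (h0 : pre 0 = 0)
    (hpre : ∀ j < ℓ, ∀ e, 1 ≤ e → e ≤ m → T e = P j → H e = P (j + 1) →
      pre (j + 1) = pre j + w e) :
    ShortestPath (ListedEdge m T H (fun _ => 1) w) P ℓ pre := by
  refine ⟨h0, fun j hj => ?_, ?_, h.shortest pre h0 hpre, h.path_inj⟩
  · obtain ⟨e, e1, e2, e3, e4⟩ := h.path_edge j hj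
    exact ⟨w e, ⟨e, e1, e2, rfl, e3, e4, rfl⟩, hpre j hj e e1 e2 e3 e4⟩
  · rintro x y c c' ⟨e, e1, e2, -, e3, e4, rfl⟩ ⟨e', e1', e2', -, e3', e4', rfl⟩
    exact h.simple e e' e1 e2 e1' e2' (e3.trans e3'.symm) (e4.trans e4'.symm)

/-- A nontrivial closed walk of detour edges starts at a relevant vertex, and closed walks there
cannot be negative. -/
theorem elimination (h : ReplacementInstance n m ℓ k T H P par dep w)
    (hP : ShortestPath (ListedEdge m T H (fun _ => 1) w) P ℓ pre) {good dep' : ℕ → ℕ}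
    (hgood : ∀ x y c, ListedEdge m T H good w x y c →
      ShortestPath.Detour (ListedEdge m T H (fun _ => 1) w) P ℓ x y c)
    (hdep : ∀ v ≤ n, dep' v = dep v) : Elimination n m T H par dep' good w := by
  refine ⟨⟨(hdep n le_rfl).trans h.forest.dep_n, h.forest.par_le, fun v hv => ?_⟩, h.tail_lt,
    h.head_lt, fun e e1 e2 => ?_, fun x c hx => ?_⟩
  · rw [hdep v hv.le, hdep _ (h.forest.par_le v hv), h.forest.dep_par v hv]
  · have := h.comparable e e1 e2
    rwa [Forest.Comparable, ← hdep _ (h.tail_lt e e1 e2).le, ← hdep _ (h.head_lt e e1 e2).le] at this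
  · rcases hx.trivial_or with ⟨-, rfl⟩ | ⟨⟨u, c', h1⟩, -⟩
    · exact le_rfl
    · exact hP.cycle_nonneg (hgood _ _ _ h1).2.1 (hx.mono fun x y c h => (hgood x y c h).1)

/-- A walk that avoids the edge yields a detour that is no worse. Split at a vertex of minimum depth
`d`, the detour is one of those that level `d` accounts for. Conversely, the output is realized by
some detour, hence by a walk. -/
theorem minOf_output (h : ReplacementInstance n m ℓ k T H P par dep w)
    (hP : ShortestPath (ListedEdge m T H (fun _ => 1) w) P ℓ pre) {good dep' : ℕ → ℕ}
    (hgood : ∀ x y c, ListedEdge m T H good w x y c ↔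
      ShortestPath.Detour (ListedEdge m T H (fun _ => 1) w) P ℓ x y c)
    (hdep : ∀ v ≤ n, dep' v = dep v) {f : ℕ → ℕ} {r : ℕ → ℝ}
    (ho : OutputAbove m T H dep' good w P pre ℓ 1 f r) {i : ℕ} (hi : i < ℓ) :
    MinOf (f i) (r i) fun L => Wk (ShortestPath.Avoid (ListedEdge m T H (fun _ => 1) w) P i)
      (P 0) (P ℓ) L := by
  have hE := h.elimination hP (fun x y c => (hgood x y c).1) hdep
  obtain ⟨h1, h2⟩ := ho i hi
  have key : ∀ L, Wk (ShortestPath.Avoid (ListedEdge m T H (fun _ => 1) w) P i) (P 0) (P ℓ) L →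
      f i = 1 ∧ r i ≤ L := by
    intro L hL
    obtain ⟨a, b, L', ha, hb, hbl, hw, hle⟩ := hP.exists_detour hi hL
    obtain ⟨u, d, L₁, L₂, hu, rfl, w1, w2, hda, hdb⟩ :=
      (hw.mono fun x y c => (hgood x y c).2).exists_min dep'
    have hun : u < n := by
      rcases w1.trivial_or with ⟨hau, -⟩ | ⟨-, v, c, ⟨e, e1, e2, -, -, e3, -⟩, -⟩
      · rw [← hau]; exact h.path_lt a (by omega)
      · rw [← e3]; exact h.head_lt e e1 e2
    have hd : 1 ≤ d := by rw [← hu]; exact hE.forest.dep_pos hun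
    obtain ⟨k1, k2⟩ := h2 a b u L₁ L₂ d hd ha hb hbl hu hda hdb w1 w2
    exact ⟨k1, k2.trans hle⟩
  rcases h1 with h1 | ⟨h1, a, b, L, ha, hb, hbl, hw, hr⟩
  · refine .inl ⟨h1, fun L hL => ?_⟩
    have := (key L hL).1
    omega
  · refine .inr ⟨h1, ?_, fun L hL => (key L hL).2⟩
    rw [hr]
    exact hP.walk_of_detour hi ha hb hbl (hw.mono fun x y c => (hgood x y c).1)

end ReplacementInstance

namespace RealRAM

open Function

theorem wp_replacementPaths {B n m ℓ k : ℕ} {T H P par dep : ℕ → ℕ} {w : ℕ → ℝ}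
    (h : ReplacementInstance n m ℓ k T H P par dep w) (hBn : 2 * n + 2 ≤ B) (hBm : 2 * m + 4 ≤ B)
    {σ : State} {t : ℕ} (r0 : σ.nreg 0 = n) (r1 : σ.nreg 1 = m) (r2 : σ.nreg 2 = ℓ + 1)
    (hT : ∀ e, σ.nmem 0 (e - 1) = T e) (hH : ∀ e, σ.nmem 1 (e - 1) = H e)
    (hP : σ.nmem 2 = P) (hpar : σ.nmem 3 = par) (hw : ∀ e, σ.rmem 0 (e - 1) = w e)
    (hz : ∀ a v, 4 ≤ a → σ.nmem a v = 0) (h7 : σ.rmem 7 0 = 0) :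
    wp B replacementPaths (fun τ t' => (∀ i < ℓ, MinOf (τ.nmem 4 i) (τ.rmem 1 i) fun L =>
        Wk (ShortestPath.Avoid (ListedEdge m T H (fun _ => 1) w) P i) (P 0) (P ℓ) L) ∧
      t' ≤ t + 40000 * (k + 1) * (m + (n + 1) * (Nat.log 2 m + Nat.log 2 n + 3))) σ t := by
  -- The ℓ + 1 vertices of the path are distinct.
  have hln : ℓ < n := by
    have := Finset.card_le_card_of_injOn (s := Finset.range (ℓ + 1)) (t := Finset.range n) P
      (fun j hj => by
        simp only [Finset.coe_range, Set.mem_Iio] at hj ⊢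
        exact h.path_lt j (by omega))
      (fun i hi j hj hij => by
        simp only [Finset.coe_range, Set.mem_Iio] at hi hj
        exact h.path_inj i j (by omega) (by omega) hij)
    simpa using this
  unfold replacementPaths
  refine wp_use (p := preparePath) (wp_preparePath (n := n) (T := T) (H := H) (w := w) (by omega)
    (by omega) (by omega) r1 r2 hT hH hP hw (fun j hj => h.path_lt j (by omega))
    (fun i j hi hj => h.path_inj i j (by omega) (by omega)) h.simple (fun v => hz 20 v (by omega)) h7) ?_
  rintro σ₁ t₁ hF₁ ⟨a1, a2, a3, a4⟩
  have hm1 : ∀ a, preparePath.writesNMem a = false → σ₁.nmem a = σ.nmem a := hF₁.nmem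
  refine wp_use (p := markEdges) (wp_markEdges (T := T) (H := H) (w := w) (by omega) hBm
    ((hF₁.nreg 0 rfl).trans r0) ((hF₁.nreg 1 rfl).trans r1) ((hF₁.nreg 2 rfl).trans r2)
    (by rw [hF₁.nmem 0 rfl]; exact hT) (by rw [hF₁.nmem 1 rfl]; exact hH)
    (by rw [hF₁.rmem 0 rfl]; exact hw) ((hF₁.nmem 2 rfl).trans hP) h.tail_lt h.head_lt
    (by rw [hF₁.nmem 12 rfl]; exact fun y => hz 12 y (by omega))
    (by rw [hF₁.nmem 17 rfl]; exact fun y => hz 17 y (by omega))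
    (h.path_lt 0 (by omega)) (h.path_lt ℓ le_rfl)) ?_
  rintro σ₂ t₂ hF₂ ⟨b1, b2, b3, b4, b5⟩
  refine wp_use (p := depths) (wp_depths (by omega) h.forest h.depth_le h.depth_le_size
    ((hF₂.nreg 0 rfl).trans ((hF₁.nreg 0 rfl).trans r0))
    ((hF₂.nmem 3 rfl).trans ((hF₁.nmem 3 rfl).trans hpar))) ?_
  rintro σ₃ t₃ hF₃ ⟨c1, c2, c3, c4, c5⟩
  have e7 : σ₃.rmem 7 = σ₁.rmem 7 := (hF₃.rmem 7 rfl).trans (hF₂.rmem 7 rfl)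
  have e6 : σ₃.nmem 6 = σ₂.nmem 6 := hF₃.nmem 6 rfl
  have hdep : ∀ v ≤ n, σ₃.nmem 7 v = dep v := by
    intro v hv
    rcases hv.lt_or_eq with hv | rfl
    · exact c1 v hv
    · rw [c2 v le_rfl, b4 v le_rfl, hF₁.nmem 7 rfl, hz 7 v (by omega), h.forest.dep_n]
  have hsp : ShortestPath (ListedEdge m T H (fun _ => 1) w) P ℓ (σ₁.rmem 7) :=
    h.shortestPath a2 fun j hj => a3 j (by omega)
  have hgood : ∀ x y c, ListedEdge m T H (σ₂.nmem 6) w x y c ↔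
      ShortestPath.Detour (ListedEdge m T H (fun _ => 1) w) P ℓ x y c := by
    intro x y c
    constructor
    · rintro ⟨e, e1, e2, e3, rfl, rfl, rfl⟩
      obtain ⟨f1, f2, f3⟩ := (b1 e e1 e2).1 e3
      exact ⟨⟨e, e1, e2, rfl, rfl, rfl, rfl⟩, f1, f2, fun j hj hj' =>
        f3 ((a1 _ _).2 ⟨j, by omega, hj'.1, hj'.2⟩)⟩
    · rintro ⟨⟨e, e1, e2, -, rfl, rfl, rfl⟩, f1, f2, f3⟩
      refine ⟨e, e1, e2, (b1 e e1 e2).2 ⟨f1, f2, fun h => ?_⟩, rfl, rfl, rfl⟩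
      obtain ⟨j, hj, hj'⟩ := (a1 _ _).1 h
      exact f3 j (by omega) hj'
  have hE := h.elimination hsp (fun x y c => (hgood x y c).1) hdep
  -- No vertex is deeper than register 41 says, so the conditions on ancestors, potentials and lower
  -- bounds are vacuous at this level, and the output is still empty.
  have hI : LevelsDone n m ℓ T H P par (σ₂.nmem 6) (σ₃.nmem 7) w (σ₁.rmem 7) (σ₃.nreg 41 + 1) σ₃ := by
    refine ⟨⟨?_, ?_, ?_, ?_, ?_, ?_, ?_, e6, rfl, ?_, e7⟩, fun v hv hd => ?_, ?_, fun i hi => ⟨.inl ?_, ?_⟩,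
      ?_, ?_⟩
    · rw [hF₃.nreg 0 rfl, hF₂.nreg 0 rfl, hF₁.nreg 0 rfl, r0]
    · rw [hF₃.nreg 1 rfl, hF₂.nreg 1 rfl, hF₁.nreg 1 rfl, r1]
    · rw [hF₃.nreg 2 rfl, hF₂.nreg 2 rfl, hF₁.nreg 2 rfl, r2]
    · rw [hF₃.nmem 0 rfl, hF₂.nmem 0 rfl, hF₁.nmem 0 rfl]; exact hT
    · rw [hF₃.nmem 1 rfl, hF₂.nmem 1 rfl, hF₁.nmem 1 rfl]; exact hH
    · rw [hF₃.nmem 2 rfl, hF₂.nmem 2 rfl, hF₁.nmem 2 rfl, hP]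
    · rw [hF₃.nmem 3 rfl, hF₂.nmem 3 rfl, hF₁.nmem 3 rfl, hpar]
    · rw [hF₃.rmem 0 rfl, hF₂.rmem 0 rfl, hF₁.rmem 0 rfl]; exact hw
    · have := c3 v hv
      rw [hdep v hv.le] at hd
      omega
    · intro e e1 e2 _ e4
      have hT' := h.tail_lt e e1 e2
      have := c3 _ hT'
      rw [hdep _ hT'.le] at e4
      omega
    · rw [hF₃.nmem 4 rfl, hF₂.nmem 4 rfl, hF₁.nmem 4 rfl]; exact hz 4 i le_rfl
    · intro a b u L₁ L₂ d' hd' ha hb hbl hu hda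
      have hPa := h.path_lt a (by omega)
      have := c3 _ hPa
      rw [hdep _ hPa.le] at hda
      omega
    · rw [hF₃.nmem 12 rfl]; exact b2
    · rw [hF₃.nmem 17 rfl]; exact b3
  have hkn := h.depth_le_size
  refine wp_mono ?_ (wp_levels (by omega) hBm (by omega) hE h.path_lt hln hI rfl)
  rintro τ t' ⟨hL, ht⟩
  refine ⟨fun i hi => h.minOf_output hsp hgood hdep hL.output hi, ?_⟩
  have hM0 : (n + 1) * (Nat.log 2 m + 1) ≤ (n + 1) * (Nat.log 2 m + Nat.log 2 n + 3) :=
    Nat.mul_le_mul_left _ (by omega)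
  have hM1 : n + 1 ≤ (n + 1) * (Nat.log 2 m + Nat.log 2 n + 3) :=
    Nat.le_mul_of_pos_right _ (by omega)
  obtain ⟨M, hM⟩ : ∃ M, m + (n + 1) * (Nat.log 2 m + Nat.log 2 n + 3) = M := ⟨_, rfl⟩
  rw [hM] at ht ⊢
  have hK : σ₃.nreg 41 * (20000 * M + 50) ≤ k * (20000 * M + 50) := Nat.mul_le_mul_right _ c4
  have hk1 : n * (20 * k + 60) ≤ M * (20 * k + 60) := Nat.mul_le_mul_right _ (by omega)
  have hk2 : k ≤ k * M := Nat.le_mul_of_pos_right _ (by omega)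
  have h1 : k * (20000 * M + 50) = 20000 * (k * M) + 50 * k := by ring
  have h2 : M * (20 * k + 60) = 20 * (k * M) + 60 * M := by ring
  have h3 : 40000 * (k + 1) * M = 40000 * (k * M) + 40000 * M := by ring
  rw [h3]
  omega

end RealRAM


/-! ## Lists and walks -/

section lists

variable {n : ℕ} {R : Fin n → Fin n → Prop} {w : Fin n → Fin n → ℝ}

/-- The weighted edges of a relation, with numbers as vertices. -/
def RelEdge (R : Fin n → Fin n → Prop) (w : Fin n → Fin n → ℝ) (x y : ℕ) (c : ℝ) : Prop :=
  ∃ u v : Fin n, R u v ∧ (u : ℕ) = x ∧ (v : ℕ) = y ∧ w u v = c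

theorem walkLength_singleton (x : Fin n) : walkLength w [x] = 0 := by
  simp [walkLength, walkEdges]

theorem walkLength_cons_cons (x y : Fin n) (p : List (Fin n)) :
    walkLength w (x :: y :: p) = w x y + walkLength w (y :: p) := by
  simp [walkLength, walkEdges]

theorem walkLength_append (u : Fin n) (b : List (Fin n)) : ∀ a : List (Fin n),
    walkLength w (a ++ u :: b) = walkLength w (a ++ [u]) + walkLength w (u :: b)
  | [] => by simp [walkLength_singleton]
  | [x] => by simp [walkLength_cons_cons, walkLength_singleton]
  | x :: y :: a => by
      have := walkLength_append u b (y :: a)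
      simp only [List.cons_append, walkLength_cons_cons] at this ⊢
      rw [this, add_assoc]

theorem Wk.of_list {x t : Fin n} : ∀ {p : List (Fin n)}, p.head? = some x → p.getLast? = some t →
    p.IsChain R → Wk (RelEdge R w) x t (walkLength w p)
  | [], h, _, _ => by simp at h
  | [y], h, h', _ => by
      simp at h h'
      subst h h'
      rw [walkLength_singleton]
      exact .nil _
  | y :: z :: p, h, h', hc => by
      simp at h
      subst h
      rw [List.isChain_cons_cons] at hc
      rw [walkLength_cons_cons]
      exact .cons ⟨y, z, hc.1, rfl, rfl, rfl⟩ (Wk.of_list (p := z :: p) rfl (by simpa using h') hc.2)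

theorem Wk.exists_list {x y : ℕ} {L : ℝ} (h : Wk (RelEdge R w) x y L) : ∀ (u v : Fin n),
    (u : ℕ) = x → (v : ℕ) = y →
    ∃ p : List (Fin n), p.head? = some u ∧ p.getLast? = some v ∧ p.IsChain R ∧ walkLength w p = L := by
  induction h with
  | nil x =>
    intro u v hu hv
    obtain rfl : u = v := Fin.ext (hu.trans hv.symm)
    exact ⟨[u], rfl, rfl, .singleton u, walkLength_singleton u⟩
  | cons e _ ih =>
    intro u v hu hv
    obtain ⟨u', v', hR, h1, h2, rfl⟩ := e
    obtain rfl : u = u' := Fin.ext (hu.trans h1.symm)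
    obtain ⟨p, p1, p2, p3, p4⟩ := ih v' v h2 hv
    obtain ⟨q, rfl⟩ : ∃ q, p = v' :: q := by
      cases p with
      | nil => simp at p1
      | cons a q => simp at p1; exact ⟨q, by rw [p1]⟩
    exact ⟨u :: v' :: q, rfl, by simpa using p2, List.isChain_cons_cons.2 ⟨hR, p3⟩, by
      rw [walkLength_cons_cons, p4]⟩

/-- Without negative cycles, walks can be shortened to paths. -/
theorem Wk.exists_path {x y : ℕ} {L : ℝ} (h : Wk (RelEdge R w) x y L) :
    (∀ z a b c, Wk (RelEdge R w) x z a → Wk (RelEdge R w) z y b → Wk (RelEdge R w) z z c → 0 ≤ c) →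
    ∀ (u v : Fin n), (u : ℕ) = x → (v : ℕ) = y →
    ∃ p : List (Fin n), p.head? = some u ∧ p.getLast? = some v ∧ p.IsChain R ∧ p.Nodup ∧
      walkLength w p ≤ L := by
  induction h with
  | nil x =>
    intro _ u v hu hv
    obtain rfl : u = v := Fin.ext (hu.trans hv.symm)
    exact ⟨[u], rfl, rfl, .singleton u, by simp, (walkLength_singleton u).le⟩
  | @cons x y z c L e hw ih =>
    intro hcyc u v hu hv
    have e' := e
    obtain ⟨u', v', hR, h1, h2, rfl⟩ := e
    obtain rfl : u = u' := Fin.ext (hu.trans h1.symm)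
    obtain ⟨p, p1, p2, p3, p4, p5⟩ := ih (fun z a b c ha hb hc =>
      hcyc z _ b c (.cons e' ha) hb hc) v' v h2 hv
    -- If `u` occurs again, the closed walk up to that occurrence is cut off; it is nonnegative, so
    -- the length does not increase.
    by_cases hup : u ∈ p
    · obtain ⟨a, b, rfl⟩ := List.append_of_mem hup
      have hab : (a ++ [u]) ++ b = a ++ u :: b := by simp
      have hcl : Wk (RelEdge R w) v' u (walkLength w (a ++ [u])) := by
        refine Wk.of_list ?_ (by simp) ?_
        · cases a with
          | nil => simpa using p1
          | cons y a => simpa using p1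
        · rw [← hab] at p3
          exact p3.left_of_append
      have := hcyc x 0 _ _ (.nil x) (.cons e' hw) (.cons e' (by rw [← h2, ← hu]; exact hcl))
      rw [walkLength_append] at p5
      exact ⟨u :: b, rfl, by simpa using p2, p3.right_of_append, p4.of_append_right, by linarith⟩
    · obtain ⟨q, rfl⟩ : ∃ q, p = v' :: q := by
        cases p with
        | nil => simp at p1
        | cons a q => simp at p1; exact ⟨q, by rw [p1]⟩
      exact ⟨u :: v' :: q, rfl, by simpa using p2, List.isChain_cons_cons.2 ⟨hR, p3⟩,
        List.nodup_cons.2 ⟨hup, p4⟩, by rw [walkLength_cons_cons]; linarith⟩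

theorem isChain_and_notMem_walkEdges {G : Fin n → Fin n → Prop} {e : Fin n × Fin n} :
    ∀ {p : List (Fin n)},
      p.IsChain (fun u v => G u v ∧ (u, v) ≠ e) ↔ p.IsChain G ∧ e ∉ walkEdges p
  | [] => by simp [walkEdges]
  | [x] => by simp [walkEdges]
  | x :: y :: p => by
      have := isChain_and_notMem_walkEdges (G := G) (e := e) (p := y :: p)
      have h : walkEdges (x :: y :: p) = (x, y) :: walkEdges (y :: p) := rfl
      rw [List.isChain_cons_cons, List.isChain_cons_cons, this, h, List.mem_cons]
      constructor
      · rintro ⟨⟨h1, h2⟩, h3, h4⟩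
        exact ⟨⟨h1, h3⟩, fun h => h.elim (fun h => h2 h.symm) h4⟩
      · rintro ⟨⟨h1, h2⟩, h3⟩
        exact ⟨⟨h1, fun h => h3 (.inl h.symm)⟩, h2, fun h => h3 (.inr h)⟩

theorem walkLength_eq_of_step : ∀ {p : List (Fin n)} {pre : ℕ → ℝ},
    (∀ (j : ℕ) (_ : j < p.length) (_ : j + 1 < p.length), pre (j + 1) = pre j + w p[j] p[j + 1]) →
    walkLength w p = pre (p.length - 1) - pre 0
  | [], pre, _ => by simp [walkLength, walkEdges]
  | [x], pre, _ => by simp [walkLength_singleton]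
  | x :: y :: p, pre, h => by
      have h1 := walkLength_eq_of_step (p := y :: p) (pre := fun j => pre (j + 1))
        fun j hj hj' => h (j + 1) (by simpa using hj) (by simpa using hj')
      have h2 := h 0 (by simp) (by simp)
      rw [walkLength_cons_cons, h1]
      simp at h2 ⊢
      linarith

/-- The replacement distance is defined by paths, the computed value by walks. A shortest walk can
be shortened to a path, since cycles on walks from `s` to `t` are nonnegative. -/
theorem minOf_replacementDist {G : Digraph (Fin n)} {s t : Fin n} {e : Fin n × Fin n} {f : ℕ}
    {r : ℝ} (hcyc : ∀ z a b c, Wk (RelEdge G.Adj w) s z a → Wk (RelEdge G.Adj w) z t b →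
      Wk (RelEdge G.Adj w) z z c → 0 ≤ c)
    (h : MinOf f r fun L => Wk (RelEdge (fun u v => G.Adj u v ∧ (u, v) ≠ e) w) s t L) :
    (if f = 0 then (⊤ : EReal) else r) = G.replacementDist w s t e := by
  have hmem : ∀ p : List (Fin n), (G.IsPathFromTo s t p ∧ e ∉ walkEdges p) ↔
      p.head? = some s ∧ p.getLast? = some t ∧
        p.IsChain (fun u v => G.Adj u v ∧ (u, v) ≠ e) ∧ p.Nodup := by
    intro p
    rw [isChain_and_notMem_walkEdges, Digraph.IsPathFromTo, Digraph.IsWalkFromTo]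
    tauto
  rcases h with ⟨rfl, h⟩ | ⟨rfl, h1, h2⟩
  · rw [if_pos rfl, eq_comm, Digraph.replacementDist]
    refine iInf₂_eq_top.2 fun p hp => ?_
    obtain ⟨p1, p2, p3, -⟩ := (hmem p).1 hp
    exact (h _ (Wk.of_list p1 p2 p3)).elim
  · rw [if_neg one_ne_zero]
    refine le_antisymm (le_iInf₂ fun p hp => ?_) ?_
    · obtain ⟨p1, p2, p3, -⟩ := (hmem p).1 hp
      exact EReal.coe_le_coe_iff.2 (h2 _ (Wk.of_list p1 p2 p3))
    · have hm : ∀ x y c, RelEdge (fun u v => G.Adj u v ∧ (u, v) ≠ e) w x y c →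
          RelEdge G.Adj w x y c := fun x y c ⟨u, v, h, h'⟩ => ⟨u, v, h.1, h'⟩
      obtain ⟨p, p1, p2, p3, p4, p5⟩ := h1.exists_path
        (fun z a b c ha hb hc => hcyc z a b c (ha.mono hm) (hb.mono hm) (hc.mono hm)) s t rfl rfl
      exact (iInf₂_le p ((hmem p).2 ⟨p1, p2, p3, p4⟩)).trans (EReal.coe_le_coe_iff.2 p5)

end lists

/-! ## Forests given by parent functions -/

section forest

variable {n : ℕ} {parent : Fin n → Option (Fin n)}

/-- The number of ancestors of a vertex. -/
noncomputable def ancestorCount (parent : Fin n → Option (Fin n)) (v : ℕ) : ℕ :=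
  if h : v < n then {u | IsAncestor parent u ⟨v, h⟩}.ncard else 0

theorem ancestorCount_coe (v : Fin n) :
    ancestorCount parent v = {u | IsAncestor parent u v}.ncard := by
  simp [ancestorCount]

theorem ancestorCount_none {v : Fin n} (h : parent v = none) : ancestorCount parent v = 1 := by
  rw [ancestorCount_coe, Set.ncard_eq_one]
  refine ⟨v, Set.ext fun u => ⟨fun hu => ?_, ?_⟩⟩
  · rcases Relation.ReflTransGen.cases_head hu with rfl | ⟨x, hx, -⟩
    · rfl
    · rw [h] at hx; simp at hx
  · rintro rfl; exact .refl

/-- Acyclicity guarantees that `v` is not among the ancestors of its parent, so the set of ancestors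
grows by exactly one element. -/
theorem ancestorCount_some (hf : IsRootedForest parent) {v p : Fin n} (h : parent v = some p) :
    ancestorCount parent v = ancestorCount parent p + 1 := by
  rw [ancestorCount_coe, ancestorCount_coe]
  have : {u | IsAncestor parent u v} = insert v {u | IsAncestor parent u p} := by
    ext u
    constructor
    · intro hu
      rcases Relation.ReflTransGen.cases_head hu with rfl | ⟨x, hx, hxu⟩
      · exact .inl rfl
      · rw [h, Option.some_inj] at hx
        subst hx
        exact .inr hxu
    · rintro (rfl | hu)
      · exact .refl
      · exact .head h hu
  have hv : v ∉ {u | IsAncestor parent u p} := fun hv => hf v (.head' h hv)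
  rw [this, Set.ncard_insert_of_notMem hv]

theorem forest_of_parent (hf : IsRootedForest parent) {par : ℕ → ℕ}
    (hpar : ∀ v : Fin n, par v = match parent v with
      | some u => (u : ℕ)
      | none => n) : Forest n par (ancestorCount parent) := by
  refine ⟨by simp [ancestorCount], fun v hv => ?_, fun v hv => ?_⟩
  · rw [hpar ⟨v, hv⟩]
    cases parent ⟨v, hv⟩ with
    | none => exact le_rfl
    | some u => exact u.2.le
  · have h1 := hpar ⟨v, hv⟩
    cases hp : parent ⟨v, hv⟩ with
    | none =>
      rw [hp] at h1
      have h2 := ancestorCount_none hp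
      simp only at h1 h2
      rw [h1, h2]
      simp [ancestorCount]
    | some u =>
      rw [hp] at h1
      have h2 := ancestorCount_some hf hp
      simp only at h1 h2
      rw [h1, h2]

theorem comparable_of_isAncestor (hf : IsRootedForest parent) {par : ℕ → ℕ}
    (hpar : ∀ v : Fin n, par v = match parent v with
      | some u => (u : ℕ)
      | none => n) {u v : Fin n} (h : IsAncestor parent u v) :
    ∃ j, par^[j] v = u ∧ ancestorCount parent v = ancestorCount parent u + j := by
  induction h using Relation.ReflTransGen.head_induction_on with
  | refl => exact ⟨0, rfl, rfl⟩
  | @head a c hac _ ih =>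
    obtain ⟨j, h1, h2⟩ := ih
    have h3 := hpar a
    rw [hac] at h3
    refine ⟨j + 1, ?_, ?_⟩
    · rw [Function.iterate_succ_apply, h3]
      exact h1
    · rw [ancestorCount_some hf hac, h2, add_assoc]

theorem ancestorCount_le_forestDepth (v : Fin n) :
    ancestorCount parent v ≤ forestDepth parent := by
  rw [ancestorCount_coe]
  exact Finset.le_sup (f := fun v => {u | IsAncestor parent u v}.ncard) (Finset.mem_univ v)

theorem forestDepth_le : forestDepth parent ≤ n := by
  refine Finset.sup_le fun v _ => ?_
  simpa using Set.ncard_le_card {u | IsAncestor parent u v}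

end forest


/-! ### From the input of the machine to an instance on numbers -/

section input

variable {n m : ℕ} {edge : Fin m → Fin n × Fin n} {w : Fin n → Fin n → ℝ} {P : List (Fin n)}
  {parent : Fin n → Option (Fin n)}

theorem listedEdge_input {G : Digraph (Fin n)} (hG : ∀ u v, G.Adj u v ↔ (u, v) ∈ Set.range edge)
    {x y : ℕ} {c : ℝ} :
    ListedEdge m (fun e => (replacementInput edge w P parent).nmem 0 (e - 1))
      (fun e => (replacementInput edge w P parent).nmem 1 (e - 1)) (fun _ => 1)
      (fun e => (replacementInput edge w P parent).rmem 0 (e - 1)) x y c ↔ RelEdge G.Adj w x y c := by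
  constructor
  · rintro ⟨e, h1, h2, -, rfl, rfl, rfl⟩
    have h : e - 1 < m := by omega
    refine ⟨(edge ⟨e - 1, h⟩).1, (edge ⟨e - 1, h⟩).2, (hG _ _).2 ⟨_, rfl⟩, ?_, ?_, ?_⟩ <;>
      simp [replacementInput, h]
  · rintro ⟨u, v, h, rfl, rfl, rfl⟩
    obtain ⟨i, hi⟩ := (hG _ _).1 h
    refine ⟨i + 1, by omega, i.2, rfl, ?_, ?_, ?_⟩ <;> simp [replacementInput, hi]

theorem bounded_input {B : ℕ} (hn : n < B) (hm : m < B) (hP : P.length < B) :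
    RealRAM.Bounded B (replacementInput edge w P parent) := by
  refine ⟨fun x => ?_, fun a i => ?_⟩
  · simp only [replacementInput]
    split <;> omega
  · simp only [replacementInput]
    split
    · split_ifs
      · exact (Fin.is_lt _).trans hn
      · omega
    · split_ifs
      · exact (Fin.is_lt _).trans hn
      · omega
    · split_ifs
      · exact (Fin.is_lt _).trans hn
      · omega
    · split_ifs
      · split
        · exact (Fin.is_lt _).trans hn
        · exact hn
      · omega
    · omega

theorem path_input {j : ℕ} (hj : j < P.length) :
    (replacementInput edge w P parent).nmem 2 j = P[j] := by
  simp [replacementInput, hj]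

theorem parent_input (v : Fin n) : (replacementInput edge w P parent).nmem 3 v =
    match parent v with
      | some u => (u : ℕ)
      | none => n := by
  cases h : parent v <;> simp [replacementInput, h]

theorem replacementInstance_input {G : Digraph (Fin n)} {s t : Fin n}
    (hG : ∀ u v, G.Adj u v ↔ (u, v) ∈ Set.range edge)
    (hP : G.IsShortestPath w s t P) (hf : G.IsEliminationForest parent) {ℓ : ℕ}
    (hl : P.length = ℓ + 1) :
    ReplacementInstance n m ℓ (forestDepth parent)
      (fun e => (replacementInput edge w P parent).nmem 0 (e - 1))
      (fun e => (replacementInput edge w P parent).nmem 1 (e - 1))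
      ((replacementInput edge w P parent).nmem 2) ((replacementInput edge w P parent).nmem 3)
      (ancestorCount parent) (fun e => (replacementInput edge w P parent).rmem 0 (e - 1)) := by
  obtain ⟨⟨⟨hhead, hlast, hchain⟩, hnodup⟩, hmin⟩ := hP
  have hT : ∀ e (h : e - 1 < m), (replacementInput edge w P parent).nmem 0 (e - 1) =
      (edge ⟨e - 1, h⟩).1 := fun e h => by simp [replacementInput, h]
  have hH : ∀ e (h : e - 1 < m), (replacementInput edge w P parent).nmem 1 (e - 1) =
      (edge ⟨e - 1, h⟩).2 := fun e h => by simp [replacementInput, h]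
  have hw : ∀ e (h : e - 1 < m), (replacementInput edge w P parent).rmem 0 (e - 1) =
      w (edge ⟨e - 1, h⟩).1 (edge ⟨e - 1, h⟩).2 := fun e h => by simp [replacementInput, h]
  have hfor := forest_of_parent hf.1 (parent_input (edge := edge) (w := w) (P := P))
  refine ⟨hfor, fun v hv => ancestorCount_le_forestDepth ⟨v, hv⟩, forestDepth_le,
    fun e h1 h2 => ?_, fun e h1 h2 => ?_, fun e h1 h2 => ?_, fun e e' h1 h2 h1' h2' h3 h4 => ?_,
    fun j hj => ?_, fun i j hi hj h => ?_, fun j hj => ?_, fun pre h0 hpre L hL => ?_⟩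
  · have h : e - 1 < m := by omega
    rw [hT e h]; exact Fin.is_lt _
  · have h : e - 1 < m := by omega
    rw [hH e h]; exact Fin.is_lt _
  · have h : e - 1 < m := by omega
    rw [hT e h, hH e h]
    rcases hf.2 _ _ ((hG _ _).2 ⟨⟨e - 1, h⟩, rfl⟩) with h' | h'
    · obtain ⟨j, h1, h2⟩ := comparable_of_isAncestor hf.1 (parent_input (edge := edge) (w := w) (P := P)) h'
      exact ⟨j, .inr ⟨h1, h2⟩⟩
    · obtain ⟨j, h1, h2⟩ := comparable_of_isAncestor hf.1 (parent_input (edge := edge) (w := w) (P := P)) h'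
      exact ⟨j, .inl ⟨h1, h2⟩⟩
  · have h : e - 1 < m := by omega
    have h' : e' - 1 < m := by omega
    beta_reduce at h3 h4 ⊢
    rw [hT e h, hT e' h'] at h3
    rw [hH e h, hH e' h'] at h4
    rw [hw e h, hw e' h', Fin.ext h3, Fin.ext h4]
  · rw [path_input (by omega)]; exact Fin.is_lt _
  · rw [path_input (by omega), path_input (by omega)] at h
    exact (List.Nodup.getElem_inj_iff hnodup).1 (Fin.ext h)
  · have hadj := List.isChain_iff_getElem.1 hchain j (by omega)
    obtain ⟨i, hi⟩ := (hG _ _).1 hadj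
    refine ⟨i + 1, by omega, i.2, ?_, ?_⟩
    · rw [hT _ (by simp), path_input (by omega)]
      simp [hi]
    · rw [hH _ (by simp), path_input (by omega)]
      simp [hi]
  · obtain ⟨p, p1, p2, p3, rfl⟩ := (hL.mono fun x y c => (listedEdge_input hG).1).exists_list s t
      (by
        rw [path_input (by omega)]
        rw [List.head?_eq_getElem?, List.getElem?_eq_getElem (by omega)] at hhead
        simp at hhead
        rw [hhead])
      (by
        rw [path_input (by omega)]
        rw [List.getLast?_eq_getElem?, List.getElem?_eq_getElem (by omega)] at hlast
        simp [hl] at hlast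
        rw [hlast])
    have h2 := walkLength_eq_of_step (w := w) (p := P) (pre := pre) fun j _ hj => by
      have hadj := List.isChain_iff_getElem.1 hchain j (by omega)
      obtain ⟨i, hi⟩ := (hG _ _).1 hadj
      have := hpre j (by omega) (i + 1) (by omega) i.2
        (by rw [hT _ (by simp), path_input (by omega)]; simp [hi])
        (by rw [hH _ (by simp), path_input (by omega)]; simp [hi])
      beta_reduce at this
      rw [this, hw _ (by simp)]
      simp [hi]
    rw [h0, hl, sub_zero] at h2
    rw [show ℓ = ℓ + 1 - 1 by omega, ← h2]
    exact hmin p ⟨p1, p2, p3⟩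

end input

/-! ### The time bound and the final theorem -/

theorem replacementPaths_time {n m k : ℕ} (hm : m ≤ n * n) (hm1 : n = 1 → m = 0) (hn : 1 ≤ n)
    (hk : 1 ≤ k) (hkn : k ≤ n) :
    ((40000 * (k + 1) * (m + (n + 1) * (Nat.log 2 m + Nat.log 2 n + 3)) : ℕ) : ℝ) ≤
      1440000 * (k * (m + n * Real.log n) + 1) := by
  have hm0 : (0 : ℝ) ≤ m := m.cast_nonneg
  have hk1 : (1 : ℝ) ≤ k := by exact_mod_cast hk
  -- For one vertex the logarithm vanishes, and only the summand 1 of the bound pays for the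
  -- computation.
  rcases hn.eq_or_lt with rfl | hn2
  · obtain rfl : k = 1 := by omega
    obtain rfl := hm1 rfl
    norm_num
  · have h2 : (2 : ℝ) ≤ n := by exact_mod_cast hn2
    have hl2 := Real.log_two_gt_d9
    have hl : Real.log 2 ≤ Real.log n := Real.log_le_log (by norm_num) h2
    have hlog : ∀ x : ℕ, (Nat.log 2 x : ℝ) * Real.log 2 ≤ Real.log x := by
      intro x
      rcases Nat.eq_zero_or_pos x with rfl | hx
      · simp
      · rw [← Real.log_pow]
        refine Real.log_le_log (by positivity) ?_
        exact_mod_cast Nat.pow_log_le_self 2 hx.ne'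
    have h3 := hlog n
    have h4 : (Nat.log 2 m : ℝ) * Real.log 2 ≤ 2 * Real.log n := by
      refine le_trans ?_ ((hlog (n * n)).trans_eq ?_)
      · exact mul_le_mul_of_nonneg_right (by exact_mod_cast Nat.log_mono_right hm) (by linarith)
      · push_cast
        rw [Real.log_mul (by linarith) (by linarith)]
        ring
    -- Multiplied by log 2, the left side is at most 2 log n + log n + 3 log n, and 9 log 2 > 6.
    have h5 : ((Nat.log 2 m : ℝ) + Nat.log 2 n + 3) ≤ 9 * Real.log n := by
      have : ((Nat.log 2 m : ℝ) + Nat.log 2 n + 3) * Real.log 2 ≤ 9 * Real.log n * Real.log 2 := by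
        nlinarith
      exact le_of_mul_le_mul_right this (by linarith)
    have h6 : ((n : ℝ) + 1) * ((Nat.log 2 m : ℝ) + Nat.log 2 n + 3) ≤ 18 * (n * Real.log n) := by
      have h7 : (0 : ℝ) ≤ (Nat.log 2 m : ℝ) + Nat.log 2 n + 3 := by positivity
      nlinarith [mul_nonneg (show (0 : ℝ) ≤ n - 1 by linarith) (show (0 : ℝ) ≤ Real.log n by linarith)]
    have h8 : (0 : ℝ) ≤ n * Real.log n := mul_nonneg (by linarith) (by linarith)
    push_cast
    have h9 : (m : ℝ) + (n + 1) * ((Nat.log 2 m : ℝ) + Nat.log 2 n + 3) ≤ 18 * (m + n * Real.log n) := by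
      linarith
    -- Here k + 1 ≤ 2 k, and 40000 · 2 · 18 = 1440000.
    calc 40000 * ((k : ℝ) + 1) * (m + (n + 1) * ((Nat.log 2 m : ℝ) + Nat.log 2 n + 3))
        ≤ 40000 * (2 * k) * (18 * (m + n * Real.log n)) := by
          refine mul_le_mul (by linarith) h9 (by positivity) (by positivity)
      _ ≤ _ := by linarith

theorem theorem7 :
    ∃ (prog : RealRAM.Program) (C : ℝ) (c : ℕ),
      ∀ (n m k : ℕ) (G : Digraph (Fin n)) (w : Fin n → Fin n → ℝ)
        (edge : Fin m → Fin n × Fin n) (s t : Fin n) (P : List (Fin n))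
        (parent : Fin n → Option (Fin n)),
        (∀ v, ¬ G.Adj v v) →
        Function.Injective edge →
        (∀ u v, G.Adj u v ↔ (u, v) ∈ Set.range edge) →
        G.IsShortestPath w s t P →
        G.IsEliminationForest parent →
        forestDepth parent = k →
        ∃ (T : ℕ) (τ : RealRAM.State),
          RealRAM.Exec ((n + m + 2) ^ c) prog (replacementInput edge w P parent) T τ ∧
          (T : ℝ) ≤ C * (k * (m + n * Real.log n) + 1) ∧
          ∀ (i : ℕ) (hi : i + 1 < P.length),
            replacementOutput τ i = G.replacementDist w s t (P[i], P[i + 1]) := by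
  refine ⟨RealRAM.replacementPaths, 1440000, 6, ?_⟩
  intro n m k G w edge s t P parent hloop hinj hG hP hf hk
  subst hk
  have hn : 1 ≤ n := s.pos
  obtain ⟨ℓ, hl⟩ : ∃ ℓ, P.length = ℓ + 1 := by
    refine Nat.exists_eq_succ_of_ne_zero fun h => ?_
    have := hP.1.1.1
    rw [List.length_eq_zero_iff.1 h] at this
    simp at this
  have hPn : P.length ≤ n := by simpa using hP.1.2.length_le_card
  have hI := replacementInstance_input hG hP hf hl
  have hwp := RealRAM.wp_replacementPaths (B := 4 * (n + m + 2)) (t := 0)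
    (σ := replacementInput edge w P parent) hI (by omega) (by omega) rfl rfl
    (by simp [replacementInput, hl]) (fun _ => rfl) (fun _ => rfl) rfl rfl (fun _ => rfl)
    (fun a v ha => ?_) rfl
  swap
  · match a, ha with
    | a + 4, _ => rfl
  -- There is a vertex, so the base is at least 3, and 3 ^ 5 = 243 exceeds 160.
  have hW : 40 * (4 * (n + m + 2)) ≤ (n + m + 2) ^ 6 := by
    have h3 : 3 ^ 5 ≤ (n + m + 2) ^ 5 := Nat.pow_le_pow_left (by omega) 5
    calc 40 * (4 * (n + m + 2)) ≤ 3 ^ 5 * (n + m + 2) := by omega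
      _ ≤ (n + m + 2) ^ 5 * (n + m + 2) := Nat.mul_le_mul_right _ h3
      _ = (n + m + 2) ^ 6 := by ring
  obtain ⟨T, τ, hexec, ⟨hout, htime⟩, -⟩ := RealRAM.exec_of_wp (by omega) hW (by decide)
    (bounded_input (by omega) (by omega) (by omega)) hwp
  refine ⟨T, τ, hexec, ?_, fun i hi => ?_⟩
  · refine le_trans ?_ (replacementPaths_time (m := m) (n := n) ?_ ?_ hn ?_ forestDepth_le)
    · exact_mod_cast (by simpa using htime)
    · simpa using Fintype.card_le_of_injective edge hinj
    -- On a single vertex every edge would be a loop.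
    · rintro rfl
      by_contra hm
      have h := (hG _ _).2 ⟨⟨0, by omega⟩, rfl⟩
      rw [Subsingleton.elim (edge ⟨0, by omega⟩).1 (edge ⟨0, by omega⟩).2] at h
      exact hloop _ h
    · exact (hI.forest.dep_pos s.2).trans (ancestorCount_le_forestDepth s)
  · have hs : (replacementInput edge w P parent).nmem 2 0 = s := by
      have hhead := hP.1.1.1
      rw [List.head?_eq_getElem?, List.getElem?_eq_getElem (by omega)] at hhead
      rw [path_input (by omega), Option.some_inj.1 hhead]
    have ht : (replacementInput edge w P parent).nmem 2 ℓ = t := by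
      have hlast := hP.1.1.2.1
      rw [List.getLast?_eq_getElem?, List.getElem?_eq_getElem (by omega)] at hlast
      rw [path_input (by omega), ← Option.some_inj.1 hlast]
      simp [hl]
    have hmin := hout i (by omega)
    rw [hs, ht] at hmin
    refine minOf_replacementDist (w := w) (fun z a b c ha hb hc => ?_) (hmin.congr fun L =>
      ⟨fun h => h.mono ?_, fun h => h.mono ?_⟩)
    · refine hc.cycle_nonneg (C := walkLength w P) (fun L hL => ?_) ha hb
      obtain ⟨p, p1, p2, p3, rfl⟩ := hL.exists_list s t rfl rfl
      exact hP.2 p ⟨p1, p2, p3⟩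
    · rintro x y c ⟨h, hne⟩
      obtain ⟨u, v, hadj, rfl, rfl, rfl⟩ := (listedEdge_input hG).1 h
      refine ⟨u, v, ⟨hadj, fun h => hne ?_⟩, rfl, rfl, rfl⟩
      rw [Prod.mk.injEq] at h
      rw [path_input (by omega), path_input (by omega), h.1, h.2]
      exact ⟨rfl, rfl⟩
    · rintro x y c ⟨u, v, ⟨hadj, hne⟩, rfl, rfl, rfl⟩
      refine ⟨(listedEdge_input hG).2 ⟨u, v, hadj, rfl, rfl, rfl⟩, fun h => hne ?_⟩
      rw [path_input (by omega), path_input (by omega)] at h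
      rw [Prod.mk.injEq]
      exact ⟨Fin.ext h.1, Fin.ext h.2⟩
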